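/- Let $n\ge 2$. There is a constant $C(n)>0$, depending only on $n$, with the following property. Let $(M^{n+1},g)$ be a smooth connected Riemannian manifold without boundary, with distance function $d$, and let $K$ be a smooth symmetric $(0,2)$-tensor field on $M$. For an immersed hypersurface with unit normal $\nu$ and induced metric $\gamma$, let $h(X,Y)=-g(\nu,\nabla_XY)$ be its second fundamental form, $H=\operatorname{tr}_\gamma h$ its mean curvature, $P=\operatorname{tr}_\gamma K$, and $\Phi=\sqrt{H^2-P^2}$ its space-time mean curvature. Let $\Sigma^n$ be a smooth manifold without boundary, and let $F\colon\Sigma^n\times[0,T)\to M$ be a smooth family of immersions with unit normal $\nu$ that solves inverse space-time mean curvature flow, i.e. $H^2-P^2>0$ and $$\frac{\partial F}{\partial s}=\frac{\nu}{\sqrt{H^2-P^2}}\qquad\text{on }\Sigma\times[0,T).$$ Write $\Sigma_s=F(\Sigma,s)$. Let $t\in[0,T)$ and assume that $H_{\Sigma_s}>0$ for all $s\in[0,t]$. Let $x\in M$, $d_x=d(x,\cdot)$, and let $R>0$ be such that $B_R(x)$ has compact closure in $M$, $\mathrm{Ric}_g\ge-\frac{1}{100(n+1)R^2}\,g$ in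 $B_R(x)$, and there exists a function $p\in C^2(B_R(x))$ with $$p(x)=0,\qquad d_x^2\le p\le\tfrac32 d_x^2,\qquad |\nabla p|_g\le 3d_x,\qquad \nabla^2p\le 3g\qquad\text{on }B_R(x).$$ Assume finally that $\Sigma$ is closed or, more generally, that $\{(q,s)\in\Sigma\times[0,t] : F(q,s)\in\overline{B_R(x)}\}$ is compact. Then $$\sup_{F(\Sigma,[0,t])\cap B_{R/2}(x)}\Phi\ \le\ \max\left(\sup_{\Sigma_0\cap B_R(x)}\Phi,\ C(n)\left(\frac1R+\sup_{\overline{B_R(x)}}|K|_g+\sup_{\overline{B_R(x)}}|\nabla K|_g^{1/2}\right)\right),$$ where the supremum of the empty set is $0$ and the suprema of $\Phi$ are taken over all points $(q,s)\in\Sigma\times[0,t]$, respectively $(q,0)\in\Sigma\times\{0\}$, that $F$ maps into the ball in question. -/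

import Mathlib

open Bundle Manifold Set
open scoped ContDiff ENNReal

noncomputable section

namespace STIMCF

/-! ### Local coordinate calculus on `ℝᵐ` -/

/-- The model space `ℝᵐ`. -/
abbrev Eucl (m : ℕ) : Type := EuclideanSpace ℝ (Fin m)

/-- The partial derivative `∂_a f (u)` of a real function on `ℝᵐ`. -/
def pd {m : ℕ} (a : Fin m) (f : Eucl m → ℝ) (u : Eucl m) : ℝ :=
  fderiv ℝ f u (EuclideanSpace.single a 1)

/-- The Christoffel symbol `Γ^c_{ab}` at `u` of a metric with coefficient matrix `G`:
`Γ^c_{ab} = ½ ∑_d G^{cd} (∂_a G_{db} + ∂_b G_{da} - ∂_d G_{ab})`. -/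
def christoffel {m : ℕ} (G : Eucl m → Matrix (Fin m) (Fin m) ℝ) (u : Eucl m)
    (c a b : Fin m) : ℝ :=
  (1 / 2) * ∑ d, (G u)⁻¹ c d *
    (pd a (fun v => G v d b) u + pd b (fun v => G v d a) u - pd d (fun v => G v a b) u)

/-- The coefficients `Ric_{ab}` of the Ricci curvature of a metric with coefficient matrix `G`:
`Ric_{ab} = ∂_c Γ^c_{ab} - ∂_a Γ^c_{cb} + Γ^d_{ab} Γ^c_{cd} - Γ^c_{ad} Γ^d_{cb}`
(sum over `c`, `d`); positive on round spheres. -/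
def ricciCoeff {m : ℕ} (G : Eucl m → Matrix (Fin m) (Fin m) ℝ) (u : Eucl m)
    (a b : Fin m) : ℝ :=
  (∑ c, (pd c (fun v => christoffel G v c a b) u - pd a (fun v => christoffel G v c c b) u)) +
    ∑ c, ∑ d, (christoffel G u d a b * christoffel G u c c d -
      christoffel G u c a d * christoffel G u d c b)

/-- The coefficients `∇_c T_{ab} = ∂_c T_{ab} - Γ^d_{ca} T_{db} - Γ^d_{cb} T_{ad}` of the covariant
derivative of a `(0,2)`-tensor with coefficient matrix `T`. -/
def covDerivCoeff {m : ℕ} (G T : Eucl m → Matrix (Fin m) (Fin m) ℝ) (u : Eucl m)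
    (c a b : Fin m) : ℝ :=
  pd c (fun v => T v a b) u -
    ∑ d, (christoffel G u d c a * T u d b + christoffel G u d c b * T u a d)

/-- The coefficients `∇²_{ab} f = ∂_a ∂_b f - Γ^c_{ab} ∂_c f` of the Hessian of a function. -/
def hessianCoeff {m : ℕ} (G : Eucl m → Matrix (Fin m) (Fin m) ℝ) (f : Eucl m → ℝ) (u : Eucl m)
    (a b : Fin m) : ℝ :=
  pd a (fun v => pd b f v) u - ∑ c, christoffel G u c a b * pd c f u

/-! ### Tensors on a Riemannian manifold, read in charts -/

section Ambient

variable {m : ℕ} {M : Type*} [TopologicalSpace M] [ChartedSpace (Eucl m) M]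

/-- The coordinate vector field `∂_a` of the preferred chart at `y`, at the point with
coordinates `u`. -/
def frame (y : M) (u : Eucl m) (a : Fin m) :
    TangentSpace (𝓡 m) ((extChartAt (𝓡 m) y).symm u) :=
  mfderiv 𝓘(ℝ, Eucl m) (𝓡 m) (extChartAt (𝓡 m) y).symm u
    (EuclideanSpace.single a 1 : Eucl m)

/-- The components `v^a` of a tangent vector `v` at `y` in the preferred chart at `y`. -/
def comp (y : M) (v : TangentSpace (𝓡 m) y) (a : Fin m) : ℝ :=
  let w : Eucl m := mfderiv (𝓡 m) 𝓘(ℝ, Eucl m) (extChartAt (𝓡 m) y) y v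
  w a

/-- The coefficients `T_{ab}` of a `(0,2)`-tensor field in the preferred chart at `y`, as functions
of the coordinates `u`. -/
def tensorCoeff
    (T : ∀ y : M, TangentSpace (𝓡 m) y →L[ℝ] TangentSpace (𝓡 m) y →L[ℝ] ℝ)
    (y : M) (u : Eucl m) : Matrix (Fin m) (Fin m) ℝ :=
  Matrix.of fun a b => T _ (frame y u a) (frame y u b)

variable [RiemannianBundle (fun y : M => TangentSpace (𝓡 m) y)]

/-- The coefficients `g_{ab}` of the Riemannian metric in the preferred chart at `y`, as functions
of the coordinates `u`. -/
def metricCoeff (y : M) (u : Eucl m) : Matrix (Fin m) (Fin m) ℝ :=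
  Matrix.of fun a b => inner ℝ (frame y u a) (frame y u b)

/-- The Ricci curvature `Ric(v, w)` at `y`. -/
def ricci (y : M) (v w : TangentSpace (𝓡 m) y) : ℝ :=
  ∑ a, ∑ b, ricciCoeff (metricCoeff y) (extChartAt (𝓡 m) y y) a b * comp y v a * comp y w b

/-- The Hessian `∇²f(v, w)` at `y`. -/
def hessian (f : M → ℝ) (y : M) (v w : TangentSpace (𝓡 m) y) : ℝ :=
  ∑ a, ∑ b, hessianCoeff (metricCoeff y) (fun u => f ((extChartAt (𝓡 m) y).symm u))
    (extChartAt (𝓡 m) y y) a b * comp y v a * comp y w b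

/-- The length `|∇f|_g` of the gradient at `y`: `|∇f|² = g^{ab} ∂_a f ∂_b f`. -/
def gradNorm (f : M → ℝ) (y : M) : ℝ :=
  let u := extChartAt (𝓡 m) y y
  let df : Fin m → ℝ := fun a => pd a (fun v => f ((extChartAt (𝓡 m) y).symm v)) u
  Real.sqrt (∑ a, ∑ b, (metricCoeff y u)⁻¹ a b * df a * df b)

/-- The norm `|T|_g` of a `(0,2)`-tensor at `y`: `|T|² = g^{aa'} g^{bb'} T_{ab} T_{a'b'}`. -/
def tensorNorm
    (T : ∀ y : M, TangentSpace (𝓡 m) y →L[ℝ] TangentSpace (𝓡 m) y →L[ℝ] ℝ) (y : M) : ℝ :=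
  let u := extChartAt (𝓡 m) y y
  let ginv := (metricCoeff y u)⁻¹
  let t := tensorCoeff T y u
  Real.sqrt (∑ a, ∑ b, ∑ a', ∑ b', ginv a a' * ginv b b' * t a b * t a' b')

/-- The norm `|∇T|_g` of the covariant derivative of a `(0,2)`-tensor field at `y`:
`|∇T|² = g^{cc'} g^{aa'} g^{bb'} ∇_c T_{ab} ∇_{c'} T_{a'b'}`. -/
def covDerivNorm
    (T : ∀ y : M, TangentSpace (𝓡 m) y →L[ℝ] TangentSpace (𝓡 m) y →L[ℝ] ℝ) (y : M) : ℝ :=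
  let u := extChartAt (𝓡 m) y y
  let ginv := (metricCoeff y u)⁻¹
  let dT := covDerivCoeff (metricCoeff y) (tensorCoeff T y) u
  Real.sqrt (∑ c, ∑ a, ∑ b, ∑ c', ∑ a', ∑ b',
    ginv c c' * ginv a a' * ginv b b' * dT c a b * dT c' a' b')

end Ambient

/-! ### Geometry of an immersed hypersurface -/

section Hypersurface

variable {n m : ℕ} {S M : Type*}
  [TopologicalSpace S] [ChartedSpace (Eucl n) S]
  [TopologicalSpace M] [ChartedSpace (Eucl m) M]

/-- The component `f^a` of the map `f : S → M` in the preferred charts at `q` and at `f q`. -/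
def localRep (f : S → M) (q : S) (a : Fin m) (u : Eucl n) : ℝ :=
  (extChartAt (𝓡 m) (f q) (f ((extChartAt (𝓡 n) q).symm u)) : Eucl m) a

/-- `∂_i f^a` at `q`. -/
def tangentCoeff (f : S → M) (q : S) (i : Fin n) (a : Fin m) : ℝ :=
  pd i (localRep f q a) (extChartAt (𝓡 n) q q)

/-- The restriction `T(∂_i f, ∂_j f)` to the hypersurface of a bilinear form with coefficient
matrix `t` at `f q`. -/
def restrict (f : S → M) (q : S) (t : Matrix (Fin m) (Fin m) ℝ) : Matrix (Fin n) (Fin n) ℝ :=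
  Matrix.of fun i j => ∑ a, ∑ b, t a b * tangentCoeff f q i a * tangentCoeff f q j b

variable [RiemannianBundle (fun y : M => TangentSpace (𝓡 m) y)]

/-- The induced metric `γ_{ij} = g(∂_i f, ∂_j f)` at `q`. -/
def inducedMetric (f : S → M) (q : S) : Matrix (Fin n) (Fin n) ℝ :=
  restrict f q (metricCoeff (f q) (extChartAt (𝓡 m) (f q) (f q)))

/-- The second fundamental form `h_{ij} = -g(ν, ∇_{∂_i f} ∂_j f)` at `q` with respect to the unit
normal `ν` at `f q`, where
`(∇_{∂_i f} ∂_j f)^b = ∂_i ∂_j f^b + Γ^b_{cd} ∂_i f^c ∂_j f^d`. -/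
def secondFundForm (f : S → M) (q : S) (ν : TangentSpace (𝓡 m) (f q)) :
    Matrix (Fin n) (Fin n) ℝ :=
  let u := extChartAt (𝓡 m) (f q) (f q)
  Matrix.of fun i j => -∑ a, ∑ b, metricCoeff (f q) u a b * comp (f q) ν a *
    (pd i (fun w => pd j (localRep f q b) w) (extChartAt (𝓡 n) q q) +
      ∑ c, ∑ d, christoffel (metricCoeff (f q)) u b c d *
        tangentCoeff f q i c * tangentCoeff f q j d)

/-- The mean curvature `H = γ^{ij} h_{ij}` at `q` with respect to `ν`. -/
def meanCurv (f : S → M) (q : S) (ν : TangentSpace (𝓡 m) (f q)) : ℝ :=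
  ∑ i, ∑ j, (inducedMetric (n := n) (m := m) f q)⁻¹ i j * secondFundForm (n := n) f q ν i j

/-- `P = tr_γ K = γ^{ij} K(∂_i f, ∂_j f)` at `q`. -/
def traceK (K : ∀ y : M, TangentSpace (𝓡 m) y →L[ℝ] TangentSpace (𝓡 m) y →L[ℝ] ℝ)
    (f : S → M) (q : S) : ℝ :=
  ∑ i, ∑ j, (inducedMetric (n := n) (m := m) f q)⁻¹ i j *
    restrict (n := n) f q (tensorCoeff K (f q) (extChartAt (𝓡 m) (f q) (f q))) i j

/-- The space-time mean curvature `Φ = √(H² - P²)` at `q`. -/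
def spacetimeMeanCurv (K : ∀ y : M, TangentSpace (𝓡 m) y →L[ℝ] TangentSpace (𝓡 m) y →L[ℝ] ℝ)
    (f : S → M) (q : S) (ν : TangentSpace (𝓡 m) (f q)) : ℝ :=
  Real.sqrt (meanCurv (n := n) f q ν ^ 2 - traceK (n := n) K f q ^ 2)

end Hypersurface

/-! ### The flow -/

/-- `F : Σⁿ × [0, T) → Mⁿ⁺¹` is a smooth solution of inverse space-time mean curvature flow with unit
normal `ν`. No regularity of `ν` is asked for: `ν = √(H² - P²) ∂F/∂t`, and `H² - P²` does not depend
on the choice of `ν`, so `ν` is automatically smooth. -/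
structure IsSmoothSolution {n : ℕ} {S M : Type*}
    [TopologicalSpace S] [ChartedSpace (Eucl n) S]
    [TopologicalSpace M] [ChartedSpace (Eucl (n + 1)) M]
    [RiemannianBundle (fun y : M => TangentSpace (𝓡 (n + 1)) y)]
    (K : ∀ y : M, TangentSpace (𝓡 (n + 1)) y →L[ℝ] TangentSpace (𝓡 (n + 1)) y →L[ℝ] ℝ)
    (T : ℝ) (F : S → ℝ → M) (ν : ∀ q s, TangentSpace (𝓡 (n + 1)) (F q s)) : Prop where
  smooth : ContMDiffOn ((𝓡 n).prod 𝓘(ℝ, ℝ)) (𝓡 (n + 1)) ∞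
    (fun z : S × ℝ => F z.1 z.2) (univ ×ˢ Ico 0 T)
  immersion : ∀ q, ∀ s ∈ Ico 0 T,
    Function.Injective (mfderiv (𝓡 n) (𝓡 (n + 1)) (fun q' => F q' s) q)
  unit : ∀ q, ∀ s ∈ Ico 0 T, inner ℝ (ν q s) (ν q s) = (1 : ℝ)
  normal : ∀ q, ∀ s ∈ Ico 0 T, ∀ w : TangentSpace (𝓡 n) q,
    inner ℝ (ν q s) (mfderiv (𝓡 n) (𝓡 (n + 1)) (fun q' => F q' s) q w) = (0 : ℝ)
  pos : ∀ q, ∀ s ∈ Ico 0 T,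
    0 < meanCurv (n := n) (fun q' => F q' s) q (ν q s) ^ 2 -
      traceK (n := n) K (fun q' => F q' s) q ^ 2
  flow : ∀ q, ∀ s ∈ Ico 0 T,
    mfderivWithin 𝓘(ℝ, ℝ) (𝓡 (n + 1)) (F q) (Ico 0 T) s (1 : ℝ) =
      (spacetimeMeanCurv (n := n) K (fun q' => F q' s) q (ν q s))⁻¹ • ν q s

end STIMCF

end

open STIMCF

noncomputable section

namespace STIMCF

section

set_option synthInstance.maxHeartbeats 400000

/-! ### Covariant derivatives along maps -/

section CovAlong

open Filter Topology

variable {E Z W : Type*} [NormedAddCommGroup E] [NormedSpace ℝ E]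
  [NormedAddCommGroup Z] [NormedSpace ℝ Z] [NormedAddCommGroup W] [NormedSpace ℝ W]

-- The estimate is a maximum principle for `η Φ`, where `η` is a cutoff of the ball built from `p`.
--
-- The flow is treated as a hypersurface moving in its normal direction, with velocity `T = ∂F/∂s`.
-- Two scalars describe it: the squared speed `a = |T|² = Φ⁻²`, and the expansion `E`, half the
-- `γ`-trace of `∂γ/∂s`, which equals `H/Φ`. The flow equation becomes the constraint `E² - a P² =
-- 1` (`expansion_sq_sub`). In particular `E ≥ 1` once `H > 0`.
--
-- At a positive maximum of `η Φ` over all earlier times, `a` is touched from below by an ambient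
-- function `θ = (c ψ(p))²`. Touching determines the spatial gradient of `a`, bounds its second
-- spatial derivatives from below, and gives `∂a/∂s ≤ dθ(T)` (`touching`, `touching_time`).
--
-- The expansion satisfies a Riccati equation (`hasDerivAt_expansion`): its time derivative consists
-- of a divergence of the acceleration, which involves second derivatives of `a`, a term `-Ric(T,
-- T)`, a gradient term, and `-|b|²`, where `b` is speed times second fundamental form. Since `|b|²
-- ≥ E²/n`, this is a strong damping. Multiplying by `E` and inserting the time derivative of the
-- constraint, the uncontrolled products of `∂a/∂s` with `P²` cancel, and what is left is a bound
-- for `E³/n` by first and second derivatives of `θ`, by `Ric`, by `K` and by `∇K`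
-- (`expansion_cube_le`).
--
-- Putting `y = ψ E Φ`, so that `ψ Φ ≤ y`, this becomes a quadratic inequality of the shape `y²/n ≤
-- C (y/R + 1/R² + |K|/R + |∇K|)`, which bounds `y` by a multiple of `1/R + |K| + |∇K|^(1/2)`
-- (`div_le_of_cube_le`, `le_of_cube_le`).
--
-- The calculus takes place in one fixed chart of `M` and one of the hypersurface. `meanCurv_eq`,
-- `traceK_eq` and `speedSq_eq` connect it with the intrinsic quantities, and a constant linear
-- change of parameter directions makes the tangent frame orthonormal at the maximum point. The
-- cutoff is only continuous; at each point where it is positive, a smooth function touching it from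
-- below replaces it (`exists_smooth_touching_cutoff`). If the maximum occurs at time `0`, the
-- initial surface bounds `Φ` instead.

local instance instNormedAddCommGroupCLM : NormedAddCommGroup (E →L[ℝ] W) :=
  ContinuousLinearMap.toNormedAddCommGroup

local instance instNormedSpaceCLM : NormedSpace ℝ (E →L[ℝ] W) := ContinuousLinearMap.toNormedSpace

local instance instNormedAddCommGroupCLM₂ : NormedAddCommGroup (E →L[ℝ] E →L[ℝ] W) :=
  ContinuousLinearMap.toNormedAddCommGroup

local instance instNormedSpaceCLM₂ : NormedSpace ℝ (E →L[ℝ] E →L[ℝ] W) :=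
  ContinuousLinearMap.toNormedSpace

/-- The derivative of `V` in the direction `ξ`, as a function of the base point. -/
def dirDeriv (V : Z → W) (ξ : Z) : Z → W := fun z => fderiv ℝ V z ξ

/-- The covariant derivative in the direction `ξ` of a vector field `V` along the map `X`. -/
def covAlong (Γ : E → E →L[ℝ] E →L[ℝ] E) (X : Z → E) (ξ : Z) (V : Z → E) : Z → E :=
  fun z => dirDeriv V ξ z + Γ (X z) (dirDeriv X ξ z) (V z)

/-- The curvature `R(a, b) v` of the connection with Christoffel symbols `Γ`. -/
def curv (Γ : E → E →L[ℝ] E →L[ℝ] E) (x a b v : E) : E :=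
  fderiv ℝ Γ x a b v - fderiv ℝ Γ x b a v + Γ x a (Γ x b v) - Γ x b (Γ x a v)

/-- The covariant derivative `(∇_a K)(v, w)` of a `(0,2)`-tensor. -/
def covBil (Γ : E → E →L[ℝ] E →L[ℝ] E) (K : E → E →L[ℝ] E →L[ℝ] ℝ) (x a v w : E) : ℝ :=
  fderiv ℝ K x a v w - K x (Γ x a v) w - K x v (Γ x a w)

theorem contDiffAt_dirDeriv {k m : ℕ∞ω} {V : Z → W} {z : Z} (h : ContDiffAt ℝ m V z)
    (hkm : k + 1 ≤ m) (ξ : Z) : ContDiffAt ℝ k (dirDeriv V ξ) z :=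
  (h.fderiv_right hkm).clm_apply contDiffAt_const

theorem dirDeriv_congr {V V' : Z → W} {z : Z} (h : V =ᶠ[𝓝 z] V') (ξ : Z) :
    dirDeriv V ξ =ᶠ[𝓝 z] dirDeriv V' ξ := by
  filter_upwards [h.fderiv (𝕜 := ℝ)] with y hy
  simp only [dirDeriv, hy]

theorem dirDeriv_comm {V : Z → W} {z : Z} (h : ContDiffAt ℝ 2 V z) (ξ ζ : Z) :
    dirDeriv (dirDeriv V ξ) ζ z = dirDeriv (dirDeriv V ζ) ξ z := by
  have hd : DifferentiableAt ℝ (fderiv ℝ V) z :=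
    (h.fderiv_right (m := 1) (by norm_num)).differentiableAt (by norm_num)
  have hs : IsSymmSndFDerivAt ℝ V z := h.isSymmSndFDerivAt (by simp)
  have key : ∀ a b : Z, dirDeriv (dirDeriv V a) b z = fderiv ℝ (fderiv ℝ V) z b a := by
    intro a b
    unfold dirDeriv
    rw [fderiv_clm_apply hd (differentiableAt_const a)]
    simp
  rw [key, key]
  exact hs ζ ξ

theorem contDiffAt_covAlong {k m : ℕ∞ω} {Γ : E → E →L[ℝ] E →L[ℝ] E} {X V : Z → E} {z : Z}
    (hΓ : ContDiffAt ℝ k Γ (X z)) (hX : ContDiffAt ℝ m X z) (hV : ContDiffAt ℝ m V z)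
    (hkm : k + 1 ≤ m) (ξ : Z) : ContDiffAt ℝ k (covAlong Γ X ξ V) z := by
  have hk : k ≤ m := le_self_add.trans hkm
  refine (contDiffAt_dirDeriv hV hkm ξ).add ?_
  exact ((hΓ.comp z (hX.of_le hk)).clm_apply (contDiffAt_dirDeriv hX hkm ξ)).clm_apply
    (hV.of_le hk)

theorem fderiv_bilin {B : E → E →L[ℝ] E →L[ℝ] W} {X : Z → E} {V V' : Z → E} {z : Z}
    (hB : DifferentiableAt ℝ B (X z)) (hX : DifferentiableAt ℝ X z)
    (hV : DifferentiableAt ℝ V z) (hV' : DifferentiableAt ℝ V' z) (ξ : Z) :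
    dirDeriv (fun y => B (X y) (V y) (V' y)) ξ z =
      fderiv ℝ B (X z) (dirDeriv X ξ z) (V z) (V' z) + B (X z) (dirDeriv V ξ z) (V' z) +
        B (X z) (V z) (dirDeriv V' ξ z) := by
  have h1 : DifferentiableAt ℝ (fun y => B (X y)) z :=
    DifferentiableAt.comp (G := E →L[ℝ] E →L[ℝ] W) z hB hX
  have h2 : fderiv ℝ (fun y => B (X y)) z = (fderiv ℝ B (X z)).comp (fderiv ℝ X z) :=
    fderiv_comp (G := E →L[ℝ] E →L[ℝ] W) z hB hX
  have h3 : DifferentiableAt ℝ (fun y => B (X y) (V y)) z := h1.clm_apply hV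
  unfold dirDeriv
  rw [fderiv_clm_apply h3 hV', fderiv_clm_apply h1 hV, h2]
  simp
  abel

/-- The Christoffel terms subtracted in `covBil` are those added in the two `covAlong` terms, so the
Leibniz rule holds for any `Γ`, with no symmetry or compatibility. -/
theorem dirDeriv_bilin {Γ : E → E →L[ℝ] E →L[ℝ] E} {K : E → E →L[ℝ] E →L[ℝ] ℝ} {X : Z → E}
    {V V' : Z → E} {z : Z}
    (hK : DifferentiableAt ℝ K (X z)) (hX : DifferentiableAt ℝ X z)
    (hV : DifferentiableAt ℝ V z) (hV' : DifferentiableAt ℝ V' z) (ξ : Z) :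
    dirDeriv (fun y => K (X y) (V y) (V' y)) ξ z =
      covBil Γ K (X z) (dirDeriv X ξ z) (V z) (V' z) + K (X z) (covAlong Γ X ξ V z) (V' z) +
        K (X z) (V z) (covAlong Γ X ξ V' z) := by
  rw [fderiv_bilin hK hX hV hV']
  simp only [covBil, covAlong, map_add, _root_.add_apply]
  ring

/-- Absence of torsion along a map: second partial derivatives commute and `Γ` is symmetric. -/
theorem covAlong_dirDeriv_comm {Γ : E → E →L[ℝ] E →L[ℝ] E} {X : Z → E} {z : Z}
    (hX : ContDiffAt ℝ 2 X z) (hΓ : ∀ v w, Γ (X z) v w = Γ (X z) w v) (ξ ζ : Z) :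
    covAlong Γ X ξ (dirDeriv X ζ) z = covAlong Γ X ζ (dirDeriv X ξ) z := by
  simp only [covAlong]
  rw [dirDeriv_comm hX, hΓ]

/-- Ricci identity along a map. The directions `ξ`, `ζ` are constant and hence commute, so the
commutator is pure curvature. This is the source of the Ricci term in the final estimate. -/
theorem covAlong_covAlong_sub {Γ : E → E →L[ℝ] E →L[ℝ] E} {X V : Z → E} {z : Z}
    (hΓ : DifferentiableAt ℝ Γ (X z)) (hX : ContDiffAt ℝ 2 X z) (hV : ContDiffAt ℝ 2 V z)
    (ξ ζ : Z) :
    covAlong Γ X ξ (covAlong Γ X ζ V) z = covAlong Γ X ζ (covAlong Γ X ξ V) z +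
      curv Γ (X z) (dirDeriv X ξ z) (dirDeriv X ζ z) (V z) := by
  have hX1 : DifferentiableAt ℝ X z := hX.differentiableAt (by norm_num)
  have hV1 : DifferentiableAt ℝ V z := hV.differentiableAt (by norm_num)
  have hdX : ∀ a, DifferentiableAt ℝ (dirDeriv X a) z := fun a =>
    (contDiffAt_dirDeriv (k := 1) hX (by norm_num) a).differentiableAt (by norm_num)
  have hdV : ∀ a, DifferentiableAt ℝ (dirDeriv V a) z := fun a =>
    (contDiffAt_dirDeriv (k := 1) hV (by norm_num) a).differentiableAt (by norm_num)
  have hΓX : DifferentiableAt ℝ (fun y => Γ (X y)) z :=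
    DifferentiableAt.comp (G := E →L[ℝ] E →L[ℝ] E) z hΓ hX1
  have key : ∀ a b : Z, dirDeriv (covAlong Γ X a V) b z =
      dirDeriv (dirDeriv V a) b z +
        (fderiv ℝ Γ (X z) (dirDeriv X b z) (dirDeriv X a z) (V z) +
          Γ (X z) (dirDeriv (dirDeriv X a) b z) (V z) +
          Γ (X z) (dirDeriv X a z) (dirDeriv V b z)) := by
    intro a b
    rw [← fderiv_bilin hΓ hX1 (hdX a) hV1]
    unfold covAlong
    have h := fderiv_add (hdV a) ((hΓX.clm_apply (hdX a)).clm_apply hV1)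
    exact congrArg (fun L => L b) h
  have e1 : covAlong Γ X ξ (covAlong Γ X ζ V) z = dirDeriv (covAlong Γ X ζ V) ξ z +
      Γ (X z) (dirDeriv X ξ z) (covAlong Γ X ζ V z) := rfl
  have e2 : covAlong Γ X ζ (covAlong Γ X ξ V) z = dirDeriv (covAlong Γ X ξ V) ζ z +
      Γ (X z) (dirDeriv X ζ z) (covAlong Γ X ξ V z) := rfl
  rw [e1, e2, key, key, dirDeriv_comm hV ζ ξ, dirDeriv_comm hX ζ ξ]
  simp only [covAlong, curv, map_add]
  abel

theorem curv_self (Γ : E → E →L[ℝ] E →L[ℝ] E) (x a v : E) : curv Γ x a a v = 0 := by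
  simp [curv]

theorem curv_swap (Γ : E → E →L[ℝ] E →L[ℝ] E) (x a b v : E) :
    curv Γ x a b v = -curv Γ x b a v := by
  simp only [curv]; abel

end CovAlong

end

section

set_option synthInstance.maxHeartbeats 400000

/-! ### Differentiation along lines -/

section Lines

open Filter Topology

variable {Z : Type*} [NormedAddCommGroup Z] [NormedSpace ℝ Z]

theorem contDiffAt_matrix_det {ι : Type*} [Fintype ι] [DecidableEq ι] {k : ℕ∞ω}
    {M : Z → Matrix ι ι ℝ} {z : Z} (hM : ∀ i j, ContDiffAt ℝ k (fun y => M y i j) z) :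
    ContDiffAt ℝ k (fun y => (M y).det) z := by
  simp only [Matrix.det_apply]
  refine ContDiffAt.sum fun σ _ => ?_
  refine ContDiffAt.const_smul _ ?_
  exact contDiffAt_prod fun i _ => hM _ _

theorem contDiffAt_matrix_inv {ι : Type*} [Fintype ι] [DecidableEq ι] {k : ℕ∞ω}
    {M : Z → Matrix ι ι ℝ} {z : Z} (hM : ∀ i j, ContDiffAt ℝ k (fun y => M y i j) z)
    (hdet : (M z).det ≠ 0) (i j : ι) : ContDiffAt ℝ k (fun y => (M y)⁻¹ i j) z := by
  have h1 : (fun y => (M y)⁻¹ i j) =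
      fun y => (M y).det⁻¹ * ((M y).updateRow j (Pi.single i 1)).det := by
    funext y
    rw [Matrix.inv_def, Matrix.smul_apply, Matrix.adjugate_apply, smul_eq_mul,
      Ring.inverse_eq_inv']
  rw [h1]
  refine ((contDiffAt_matrix_det hM).inv hdet).mul (contDiffAt_matrix_det fun a b => ?_)
  by_cases h : a = j
  · subst h; simpa using contDiffAt_const
  · simpa [Matrix.updateRow_ne h] using hM a b

theorem hasDerivAt_line {f : Z → ℝ} {z : Z} (hf : DifferentiableAt ℝ f z) (ξ : Z) :
    HasDerivAt (fun r : ℝ => f (z + r • ξ)) (dirDeriv f ξ z) 0 := by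
  have h2 : HasDerivAt (fun r : ℝ => z + r • ξ) ξ 0 := by
    simpa using ((hasDerivAt_id (0 : ℝ)).smul_const ξ).const_add z
  have h1 : HasFDerivAt f (fderiv ℝ f z) (z + (0 : ℝ) • ξ) := by
    simpa using hf.hasFDerivAt
  exact h1.comp_hasDerivAt 0 h2

theorem tendsto_line (z ξ : Z) : Tendsto (fun r : ℝ => z + r • ξ) (𝓝 0) (𝓝 z) := by
  have : Continuous fun r : ℝ => z + r • ξ := by fun_prop
  simpa using this.tendsto 0

/-- At a point where `M = 1` the derivative of `M⁻¹` is minus that of `M`. Normalizing `M` only at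
this one point keeps the formula short, which is why orthonormal parameter directions are introduced
later. -/
theorem hasDerivAt_trace_inv_mul {ι : Type*} [Fintype ι] [DecidableEq ι]
    {M N : Z → Matrix ι ι ℝ} {z : Z} (hM : ∀ i j, ContDiffAt ℝ 1 (fun y => M y i j) z)
    (hN : ∀ i j, ContDiffAt ℝ 1 (fun y => N y i j) z) (h1 : M z = 1) (ξ : Z) :
    HasDerivAt (fun r : ℝ => ∑ i, ∑ j, (M (z + r • ξ))⁻¹ i j * N (z + r • ξ) i j)
      (∑ i, dirDeriv (fun y => N y i i) ξ z -
        ∑ i, ∑ j, dirDeriv (fun y => M y i j) ξ z * N z i j) 0 := by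
  have hdet : (M z).det ≠ 0 := by simp [h1]
  have hI : ∀ i j, DifferentiableAt ℝ (fun y => (M y)⁻¹ i j) z := fun i j =>
    (contDiffAt_matrix_inv hM hdet i j).differentiableAt (by norm_num)
  have hMd : ∀ i j, DifferentiableAt ℝ (fun y => M y i j) z := fun i j =>
    (hM i j).differentiableAt (by norm_num)
  have hNd : ∀ i j, DifferentiableAt ℝ (fun y => N y i j) z := fun i j =>
    (hN i j).differentiableAt (by norm_num)
  -- Differentiate `M⁻¹ M = 1`, valid near `z` because the determinant stays nonzero.
  have hinv : ∀ i j, dirDeriv (fun y => (M y)⁻¹ i j) ξ z =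
      -dirDeriv (fun y => M y i j) ξ z := by
    intro i j
    have hc : ∀ᶠ y in 𝓝 z, ∑ l, (M y)⁻¹ i l * M y l j = (1 : Matrix ι ι ℝ) i j := by
      have : ∀ᶠ y in 𝓝 z, (M y).det ≠ 0 :=
        (contDiffAt_matrix_det hM).continuousAt.eventually_ne hdet
      filter_upwards [this] with y hy
      rw [← Matrix.mul_apply, Matrix.nonsing_inv_mul _ (isUnit_iff_ne_zero.2 hy)]
    have hd : HasDerivAt (fun r : ℝ => ∑ l, (M (z + r • ξ))⁻¹ i l * M (z + r • ξ) l j)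
        (∑ l, (dirDeriv (fun y => (M y)⁻¹ i l) ξ z * M (z + (0 : ℝ) • ξ) l j +
          (M (z + (0 : ℝ) • ξ))⁻¹ i l * dirDeriv (fun y => M y l j) ξ z)) 0 :=
      HasDerivAt.fun_sum fun l _ =>
        (hasDerivAt_line (hI i l) ξ).mul (hasDerivAt_line (hMd l j) ξ)
    have hd' : HasDerivAt (fun r : ℝ => ∑ l, (M (z + r • ξ))⁻¹ i l * M (z + r • ξ) l j) 0 0 :=
      (hasDerivAt_const (0 : ℝ) ((1 : Matrix ι ι ℝ) i j)).congr_of_eventuallyEq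
        ((tendsto_line z ξ).eventually hc)
    have := hd.unique hd'
    simp only [zero_smul, add_zero, h1, inv_one, Matrix.one_apply, mul_ite, mul_one, mul_zero,
      ite_mul, one_mul, zero_mul, Finset.sum_add_distrib, Finset.sum_ite_eq, Finset.sum_ite_eq',
      Finset.mem_univ, if_true] at this
    linarith
  have hd : HasDerivAt (fun r : ℝ => ∑ i, ∑ j, (M (z + r • ξ))⁻¹ i j * N (z + r • ξ) i j)
      (∑ i, ∑ j, (dirDeriv (fun y => (M y)⁻¹ i j) ξ z * N (z + (0 : ℝ) • ξ) i j +
        (M (z + (0 : ℝ) • ξ))⁻¹ i j * dirDeriv (fun y => N y i j) ξ z)) 0 :=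
    HasDerivAt.fun_sum fun i _ => HasDerivAt.fun_sum fun j _ =>
      (hasDerivAt_line (hI i j) ξ).mul (hasDerivAt_line (hNd i j) ξ)
  convert hd using 1
  simp only [zero_smul, add_zero, h1, inv_one, hinv, Matrix.one_apply, ite_mul, one_mul,
    zero_mul, Finset.sum_add_distrib, Finset.sum_ite_eq, Finset.mem_univ, if_true, neg_mul,
    Finset.sum_neg_distrib]
  ring

/-- A negative second derivative would make the minimum also a local maximum, so `φ` would be
locally constant and its second derivative zero. -/
theorem deriv_deriv_nonneg_of_isLocalMin {φ : ℝ → ℝ} {x : ℝ} (h : IsLocalMin φ x)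
    (hc : ContinuousAt φ x) : 0 ≤ deriv (deriv φ) x := by
  by_contra hneg
  push Not at hneg
  have hd : deriv φ x = 0 := h.deriv_eq_zero
  have hmax : IsLocalMax φ x := isLocalMax_of_deriv_deriv_neg hneg hd hc
  have heq : φ =ᶠ[𝓝 x] fun _ => φ x := by
    filter_upwards [h, hmax] with y h1 h2 using le_antisymm h2 h1
  have h1 : deriv φ =ᶠ[𝓝 x] fun _ => 0 := by
    filter_upwards [heq.deriv] with y hy
    rw [hy]; simp
  have h2 : deriv (deriv φ) x = 0 := by rw [h1.deriv_eq]; simp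
  linarith

theorem dirDeriv_of_nonneg {u : Z → ℝ} {z ξ : Z} (hu : ContDiffAt ℝ 2 u z) (h0 : u z = 0)
    (hpos : ∀ᶠ r in 𝓝 (0 : ℝ), 0 ≤ u (z + r • ξ)) :
    dirDeriv u ξ z = 0 ∧ 0 ≤ dirDeriv (dirDeriv u ξ) ξ z := by
  have hmin : IsLocalMin (fun r : ℝ => u (z + r • ξ)) 0 := by
    filter_upwards [hpos] with r hr
    simpa [h0] using hr
  have hd1 := hasDerivAt_line (hu.differentiableAt (by norm_num)) ξ
  refine ⟨by rw [← hd1.deriv]; exact hmin.deriv_eq_zero, ?_⟩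
  have hev : deriv (fun r : ℝ => u (z + r • ξ)) =ᶠ[𝓝 0] fun r => dirDeriv u ξ (z + r • ξ) := by
    have h1 : ∀ᶠ y in 𝓝 z, DifferentiableAt ℝ u y := by
      filter_upwards [hu.eventually (by simp)] with y hy
      exact hy.differentiableAt (by norm_num)
    filter_upwards [(tendsto_line z ξ).eventually h1] with r hr
    have h2 := hasDerivAt_line hr ξ
    have h3 : HasDerivAt (fun r' : ℝ => u (z + r' • ξ)) (dirDeriv u ξ (z + r • ξ)) (r + 0) := by
      have h4 : HasDerivAt (fun r' : ℝ => u (z + r • ξ + (r' - r) • ξ))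
          (dirDeriv u ξ (z + r • ξ)) r := by
        have h2' : HasDerivAt (fun r : ℝ => u (z + r • ξ)) (dirDeriv u ξ z) 0 := hd1
        have := HasDerivAt.comp_sub_const (f := fun s : ℝ => u (z + r • ξ + s • ξ)) r r
          (by simpa using h2)
        simpa using this
      rw [add_zero]
      convert h4 using 3 with r'
      module
    rw [add_zero] at h3
    exact h3.deriv
  have hd2 := hasDerivAt_line
    ((contDiffAt_dirDeriv (k := 1) hu (by norm_num) ξ).differentiableAt (by norm_num)) ξ
  rw [← hd2.deriv, ← hev.deriv_eq]
  exact deriv_deriv_nonneg_of_isLocalMin hmin hd1.continuousAt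

/-- Only one side of the line is used, since a parabolic maximum controls past times only;
difference quotients from the left are then nonpositive. -/
theorem dirDeriv_nonpos_of_nonneg {u : Z → ℝ} {z ξ : Z} (hu : DifferentiableAt ℝ u z)
    (h0 : u z = 0) (hpos : ∀ᶠ r in 𝓝[≤] (0 : ℝ), 0 ≤ u (z + r • ξ)) : dirDeriv u ξ z ≤ 0 := by
  have hd := (hasDerivAt_line hu ξ).hasDerivWithinAt (s := Iio 0)
  rw [hasDerivWithinAt_iff_tendsto_slope' (by simp)] at hd
  refine le_of_tendsto hd ?_
  have h1 : ∀ᶠ r in 𝓝[<] (0 : ℝ), 0 ≤ u (z + r • ξ) :=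
    hpos.filter_mono (nhdsWithin_mono _ Iio_subset_Iic_self)
  filter_upwards [h1, self_mem_nhdsWithin] with r hr hr0
  rw [slope_def_field]
  simp only [zero_smul, add_zero, h0, sub_zero]
  exact div_nonpos_of_nonneg_of_nonpos hr (le_of_lt hr0)

end Lines

end

section

set_option synthInstance.maxHeartbeats 400000

/-! ### Hypersurfaces moving in the normal direction -/

section NormalMotion

open Filter Topology

variable {E Z W : Type*} [NormedAddCommGroup E] [NormedSpace ℝ E]
  [NormedAddCommGroup Z] [NormedSpace ℝ Z] [NormedAddCommGroup W] [NormedSpace ℝ W] {n : ℕ}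

local instance instNormedAddCommGroupCLM' : NormedAddCommGroup (E →L[ℝ] W) :=
  ContinuousLinearMap.toNormedAddCommGroup

local instance instNormedSpaceCLM' : NormedSpace ℝ (E →L[ℝ] W) :=
  ContinuousLinearMap.toNormedSpace

local instance instNormedAddCommGroupCLM₂' : NormedAddCommGroup (E →L[ℝ] E →L[ℝ] W) :=
  ContinuousLinearMap.toNormedAddCommGroup

local instance instNormedSpaceCLM₂' : NormedSpace ℝ (E →L[ℝ] E →L[ℝ] W) :=
  ContinuousLinearMap.toNormedSpace

theorem dirDeriv_const_mul {f : Z → ℝ} {z : Z} (hf : DifferentiableAt ℝ f z) (c : ℝ) (ξ : Z) :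
    dirDeriv (fun y => c * f y) ξ z = c * dirDeriv f ξ z := by
  unfold dirDeriv
  rw [fderiv_const_mul hf]
  rfl

theorem dirDeriv_sub {f g : Z → ℝ} {z : Z} (hf : DifferentiableAt ℝ f z)
    (hg : DifferentiableAt ℝ g z) (ξ : Z) :
    dirDeriv (fun y => f y - g y) ξ z = dirDeriv f ξ z - dirDeriv g ξ z := by
  unfold dirDeriv
  rw [fderiv_fun_sub hf hg]
  rfl

/-- Near `z`, the map `X` describes a hypersurface, with parameter directions `β i`, that moves in
the time direction `τ` normally to itself with respect to the metric `B` with Christoffel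
symbols `Γ`. -/
structure IsNormalMotion (B : E → E →L[ℝ] E →L[ℝ] ℝ) (Γ : E → E →L[ℝ] E →L[ℝ] E) (X : Z → E)
    (β : Fin n → Z) (τ : Z) (z : Z) : Prop where
  contDiff_map : ContDiffAt ℝ 4 X z
  contDiff_metric : ContDiffAt ℝ 2 B (X z)
  contDiff_christoffel : ContDiffAt ℝ 2 Γ (X z)
  symm : ∀ᶠ x in 𝓝 (X z), ∀ v w, B x v w = B x w v
  torsion : ∀ᶠ x in 𝓝 (X z), ∀ v w, Γ x v w = Γ x w v
  compat : ∀ᶠ x in 𝓝 (X z), ∀ a v w, covBil Γ B x a v w = 0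
  orth : ∀ᶠ y in 𝓝 z, ∀ i, B (X y) (dirDeriv X (β i) y) (dirDeriv X τ y) = 0

namespace IsNormalMotion

variable {B : E → E →L[ℝ] E →L[ℝ] ℝ} {Γ : E → E →L[ℝ] E →L[ℝ] E} {X : Z → E} {β : Fin n → Z}
  {τ z : Z}

/-- Being an open condition, it gives every pointwise identity below in a neighbourhood, so that the
identity can be differentiated again. -/
theorem eventually (h : IsNormalMotion B Γ X β τ z) :
    ∀ᶠ y in 𝓝 z, IsNormalMotion B Γ X β τ y := by
  have hc : ContinuousAt X z := h.contDiff_map.continuousAt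
  filter_upwards [h.contDiff_map.eventually (by simp),
    hc.eventually (h.contDiff_metric.eventually (by simp)),
    hc.eventually (h.contDiff_christoffel.eventually (by simp)),
    hc.eventually h.symm.eventually_nhds, hc.eventually h.torsion.eventually_nhds,
    hc.eventually h.compat.eventually_nhds, h.orth.eventually_nhds] with y h1 h2 h3 h4 h5 h6 h7
  exact ⟨h1, h2, h3, h4, h5, h6, h7⟩

theorem contDiffAt_dirDeriv (h : IsNormalMotion B Γ X β τ z) (ξ : Z) :
    ContDiffAt ℝ 3 (dirDeriv X ξ) z :=
  STIMCF.contDiffAt_dirDeriv h.contDiff_map (by norm_num) ξ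

theorem contDiffAt_covAlong (h : IsNormalMotion B Γ X β τ z) (ξ ζ : Z) :
    ContDiffAt ℝ 2 (covAlong Γ X ξ (dirDeriv X ζ)) z :=
  STIMCF.contDiffAt_covAlong (m := 3) h.contDiff_christoffel
    (h.contDiff_map.of_le (by norm_num)) (h.contDiffAt_dirDeriv ζ) (by norm_num) ξ

theorem contDiffAt_bilin {k : ℕ∞ω} (hk : k ≤ 4) (h : IsNormalMotion B Γ X β τ z)
    {K : E → E →L[ℝ] E →L[ℝ] ℝ} (hK : ContDiffAt ℝ k K (X z))
    {V V' : Z → E} (hV : ContDiffAt ℝ k V z) (hV' : ContDiffAt ℝ k V' z) :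
    ContDiffAt ℝ k (fun y => K (X y) (V y) (V' y)) z :=
  ((ContDiffAt.comp (G := E →L[ℝ] E →L[ℝ] ℝ) z hK (h.contDiff_map.of_le hk)).clm_apply
    hV).clm_apply hV'

theorem symm_self (h : IsNormalMotion B Γ X β τ z) (v w : E) : B (X z) v w = B (X z) w v :=
  h.symm.self_of_nhds v w

theorem dirDeriv_metric (h : IsNormalMotion B Γ X β τ z) {V V' : Z → E}
    (hV : DifferentiableAt ℝ V z) (hV' : DifferentiableAt ℝ V' z) (ξ : Z) :
    dirDeriv (fun y => B (X y) (V y) (V' y)) ξ z =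
      B (X z) (covAlong Γ X ξ V z) (V' z) + B (X z) (V z) (covAlong Γ X ξ V' z) := by
  rw [dirDeriv_bilin (Γ := Γ) (h.contDiff_metric.differentiableAt (by norm_num))
    (h.contDiff_map.differentiableAt (by norm_num)) hV hV', h.compat.self_of_nhds]
  ring

theorem covAlong_comm (h : IsNormalMotion B Γ X β τ z) (ξ ζ : Z) :
    covAlong Γ X ξ (dirDeriv X ζ) z = covAlong Γ X ζ (dirDeriv X ξ) z :=
  covAlong_dirDeriv_comm (h.contDiff_map.of_le (by norm_num)) (h.torsion.self_of_nhds) ξ ζ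

theorem differentiableAt_dirDeriv (h : IsNormalMotion B Γ X β τ z) (ξ : Z) :
    DifferentiableAt ℝ (dirDeriv X ξ) z :=
  (h.contDiffAt_dirDeriv ξ).differentiableAt (by norm_num)

theorem differentiableAt_covAlong (h : IsNormalMotion B Γ X β τ z) (ξ ζ : Z) :
    DifferentiableAt ℝ (covAlong Γ X ξ (dirDeriv X ζ)) z :=
  (h.contDiffAt_covAlong ξ ζ).differentiableAt (by norm_num)

/-- Weingarten-type relation, from differentiating the orthogonality of `∂_i X` and `∂_τ X`. -/
theorem metric_covAlong_tangent (h : IsNormalMotion B Γ X β τ z) (ξ : Z) (i : Fin n) :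
    B (X z) (covAlong Γ X ξ (dirDeriv X (β i)) z) (dirDeriv X τ z) =
      -B (X z) (dirDeriv X (β i) z) (covAlong Γ X ξ (dirDeriv X τ) z) := by
  have h1 := h.dirDeriv_metric (h.differentiableAt_dirDeriv (β i))
    (h.differentiableAt_dirDeriv τ) ξ
  have h2 : (fun y => B (X y) (dirDeriv X (β i) y) (dirDeriv X τ y)) =ᶠ[𝓝 z] fun _ => 0 := by
    filter_upwards [h.orth] with y hy using hy i
  have h3 := (dirDeriv_congr h2 ξ).self_of_nhds
  rw [h1] at h3
  simp only [dirDeriv, fderiv_fun_const, Pi.zero_apply, _root_.zero_apply] at h3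
  simp only [dirDeriv]
  linarith

/-- Both sides equal minus the pairing of `∂_τ X` with `∇_i ∂_j X`, which is symmetric in `i`, `j`.
-/
theorem secondFund_symm (h : IsNormalMotion B Γ X β τ z) (i j : Fin n) :
    B (X z) (covAlong Γ X (β i) (dirDeriv X τ) z) (dirDeriv X (β j) z) =
      B (X z) (covAlong Γ X (β j) (dirDeriv X τ) z) (dirDeriv X (β i) z) := by
  have h1 := h.metric_covAlong_tangent (β i) j
  have h2 := h.metric_covAlong_tangent (β j) i
  rw [h.covAlong_comm] at h1
  rw [h.symm_self, h.symm_self (covAlong Γ X (β j) (dirDeriv X τ) z)]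
  linarith

/-- First variation of the induced metric: the right-hand side is twice speed times second
fundamental form. It allows curvature to be expressed by time derivatives of the metric alone. -/
theorem dirDeriv_induced (h : IsNormalMotion B Γ X β τ z) (i j : Fin n) :
    dirDeriv (fun y => B (X y) (dirDeriv X (β i) y) (dirDeriv X (β j) y)) τ z =
      2 * B (X z) (covAlong Γ X (β i) (dirDeriv X τ) z) (dirDeriv X (β j) z) := by
  rw [h.dirDeriv_metric (h.differentiableAt_dirDeriv _) (h.differentiableAt_dirDeriv _),
    h.covAlong_comm, h.covAlong_comm τ, h.symm_self (dirDeriv X (β i) z), h.secondFund_symm j i]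
  ring

theorem dirDeriv_speedSq (h : IsNormalMotion B Γ X β τ z) (ξ : Z) :
    dirDeriv (fun y => B (X y) (dirDeriv X τ y) (dirDeriv X τ y)) ξ z =
      2 * B (X z) (covAlong Γ X ξ (dirDeriv X τ) z) (dirDeriv X τ z) := by
  rw [h.dirDeriv_metric (h.differentiableAt_dirDeriv _) (h.differentiableAt_dirDeriv _),
    h.symm_self (dirDeriv X τ z)]
  ring

/-- Normality of the motion forces the tangential acceleration to be `-½` times the gradient of the
squared speed. -/
theorem metric_accel_tangent (h : IsNormalMotion B Γ X β τ z) (j : Fin n) :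
    B (X z) (covAlong Γ X τ (dirDeriv X τ) z) (dirDeriv X (β j) z) =
      -(1 / 2) * dirDeriv (fun y => B (X y) (dirDeriv X τ y) (dirDeriv X τ y)) (β j) z := by
  have h1 := h.metric_covAlong_tangent τ j
  rw [h.dirDeriv_speedSq, h.covAlong_comm (β j) τ, h1, h.symm_self]
  ring

/-- Differentiating the first variation once more, `∇_τ` has to be moved past `∇_i`; this produces
the curvature term and leaves the derivative of the acceleration. -/
theorem dirDeriv_dirDeriv_induced (h : IsNormalMotion B Γ X β τ z) (i j : Fin n) :
    dirDeriv (dirDeriv (fun y => B (X y) (dirDeriv X (β i) y) (dirDeriv X (β j) y)) τ) τ z =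
      2 * (B (X z) (covAlong Γ X (β i) (covAlong Γ X τ (dirDeriv X τ)) z) (dirDeriv X (β j) z) +
        B (X z) (curv Γ (X z) (dirDeriv X τ z) (dirDeriv X (β i) z) (dirDeriv X τ z))
          (dirDeriv X (β j) z) +
        B (X z) (covAlong Γ X (β i) (dirDeriv X τ) z)
          (covAlong Γ X (β j) (dirDeriv X τ) z)) := by
  have h1 : dirDeriv (fun y => B (X y) (dirDeriv X (β i) y) (dirDeriv X (β j) y)) τ =ᶠ[𝓝 z]
      fun y => 2 * B (X y) (covAlong Γ X (β i) (dirDeriv X τ) y) (dirDeriv X (β j) y) := by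
    filter_upwards [h.eventually] with y hy using hy.dirDeriv_induced i j
  have hd : DifferentiableAt ℝ
      (fun y => B (X y) (covAlong Γ X (β i) (dirDeriv X τ) y) (dirDeriv X (β j) y)) z :=
    (h.contDiffAt_bilin (k := 2) (by norm_num) h.contDiff_metric (h.contDiffAt_covAlong _ _)
      ((h.contDiffAt_dirDeriv _).of_le (by norm_num))).differentiableAt (by norm_num)
  rw [(dirDeriv_congr h1 τ).self_of_nhds, dirDeriv_const_mul hd,
    h.dirDeriv_metric (h.differentiableAt_covAlong _ _) (h.differentiableAt_dirDeriv _),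
    covAlong_covAlong_sub (h.contDiff_christoffel.differentiableAt (by norm_num))
      (h.contDiff_map.of_le (by norm_num)) ((h.contDiffAt_dirDeriv τ).of_le (by norm_num)),
    h.covAlong_comm τ (β j), map_add, _root_.add_apply]

/-- The Leibniz rule applied to the tangential acceleration formula, which turns derivatives of the
acceleration into second derivatives of the squared speed, the quantity that touching controls. -/
theorem metric_covAlong_accel (h : IsNormalMotion B Γ X β τ z) (i j : Fin n) :
    B (X z) (covAlong Γ X (β i) (covAlong Γ X τ (dirDeriv X τ)) z) (dirDeriv X (β j) z) =
      -(1 / 2) * dirDeriv (dirDeriv (fun y => B (X y) (dirDeriv X τ y) (dirDeriv X τ y)) (β j))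
        (β i) z -
      B (X z) (covAlong Γ X τ (dirDeriv X τ) z) (covAlong Γ X (β i) (dirDeriv X (β j)) z) := by
  have h1 : (fun y => B (X y) (covAlong Γ X τ (dirDeriv X τ) y) (dirDeriv X (β j) y)) =ᶠ[𝓝 z]
      fun y => -(1 / 2) *
        dirDeriv (fun y => B (X y) (dirDeriv X τ y) (dirDeriv X τ y)) (β j) y := by
    filter_upwards [h.eventually] with y hy using hy.metric_accel_tangent j
  have ha : ContDiffAt ℝ 2 (fun y => B (X y) (dirDeriv X τ y) (dirDeriv X τ y)) z :=
    h.contDiffAt_bilin (by norm_num) h.contDiff_metric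
      ((h.contDiffAt_dirDeriv _).of_le (by norm_num))
      ((h.contDiffAt_dirDeriv _).of_le (by norm_num))
  have hd := (STIMCF.contDiffAt_dirDeriv (k := 1) ha (by norm_num) (β j)).differentiableAt
    (by norm_num)
  have h2 := (dirDeriv_congr h1 (β i)).self_of_nhds
  rw [h.dirDeriv_metric (h.differentiableAt_covAlong _ _) (h.differentiableAt_dirDeriv _)] at h2
  rw [dirDeriv_const_mul hd] at h2
  linarith

end IsNormalMotion

/-- The coefficients of the metric induced on the hypersurface. -/
def gram (B : E → E →L[ℝ] E →L[ℝ] ℝ) (X : Z → E) (β : Fin n → Z) (y : Z) :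
    Matrix (Fin n) (Fin n) ℝ :=
  Matrix.of fun i j => B (X y) (dirDeriv X (β i) y) (dirDeriv X (β j) y)

/-- The squared speed of the motion. -/
def speedSq (B : E → E →L[ℝ] E →L[ℝ] ℝ) (X : Z → E) (τ : Z) (y : Z) : ℝ :=
  B (X y) (dirDeriv X τ y) (dirDeriv X τ y)

/-- The rate of expansion of the area element, which is speed times mean curvature. -/
def expansion (B : E → E →L[ℝ] E →L[ℝ] ℝ) (X : Z → E) (β : Fin n → Z) (τ : Z) (y : Z) : ℝ :=
  ∑ i, ∑ j, (gram B X β y)⁻¹ i j * (1 / 2 * dirDeriv (fun y => gram B X β y i j) τ y)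

/-- The trace over the hypersurface of a `(0,2)`-tensor. -/
def hyperTrace (B K : E → E →L[ℝ] E →L[ℝ] ℝ) (X : Z → E) (β : Fin n → Z) (y : Z) : ℝ :=
  ∑ i, ∑ j, (gram B X β y)⁻¹ i j * gram K X β y i j

/-- The Hessian of a function. -/
def hessBil (Γ : E → E →L[ℝ] E →L[ℝ] E) (θ : E → ℝ) (x v w : E) : ℝ :=
  fderiv ℝ (fderiv ℝ θ) x v w - fderiv ℝ θ x (Γ x v w)

/-! ### Evolution of the expansion and of the trace of a tensor. -/

namespace IsNormalMotion

variable {B : E → E →L[ℝ] E →L[ℝ] ℝ} {Γ : E → E →L[ℝ] E →L[ℝ] E} {X : Z → E} {β : Fin n → Z}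
  {τ z : Z}

theorem contDiffAt_gram (h : IsNormalMotion B Γ X β τ z) {K : E → E →L[ℝ] E →L[ℝ] ℝ}
    (hK : ContDiffAt ℝ 2 K (X z)) (i j : Fin n) :
    ContDiffAt ℝ 2 (fun y => gram K X β y i j) z :=
  h.contDiffAt_bilin (by norm_num) hK ((h.contDiffAt_dirDeriv _).of_le (by norm_num))
    ((h.contDiffAt_dirDeriv _).of_le (by norm_num))

theorem contDiffAt_speedSq (h : IsNormalMotion B Γ X β τ z) :
    ContDiffAt ℝ 2 (speedSq B X τ) z :=
  h.contDiffAt_bilin (by norm_num) h.contDiff_metric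
    ((h.contDiffAt_dirDeriv _).of_le (by norm_num))
    ((h.contDiffAt_dirDeriv _).of_le (by norm_num))

theorem expansion_eq (h : IsNormalMotion B Γ X β τ z) (honb : gram B X β z = 1) :
    expansion B X β τ z =
      ∑ i, B (X z) (covAlong Γ X (β i) (dirDeriv X τ) z) (dirDeriv X (β i) z) := by
  simp only [expansion, honb, inv_one, Matrix.one_apply, ite_mul, one_mul, zero_mul,
    Finset.sum_ite_eq, Finset.mem_univ, if_true]
  refine Finset.sum_congr rfl fun i _ => ?_
  have := h.dirDeriv_induced i i
  simp only [gram, Matrix.of_apply]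
  rw [this]; ring

/-- Riccati equation. The last sum comes from differentiating the inverse metric. The squared length
of `∇_i ∂_τ X` in the first sum gives half of it back, up to its normal part, so the net quadratic
term is minus the squared norm of `b`. -/
theorem hasDerivAt_expansion (h : IsNormalMotion B Γ X β τ z) (honb : gram B X β z = 1) :
    HasDerivAt (fun r : ℝ => expansion B X β τ (z + r • τ))
      (∑ i, (B (X z) (covAlong Γ X (β i) (covAlong Γ X τ (dirDeriv X τ)) z) (dirDeriv X (β i) z) +
        B (X z) (curv Γ (X z) (dirDeriv X τ z) (dirDeriv X (β i) z) (dirDeriv X τ z))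
          (dirDeriv X (β i) z) +
        B (X z) (covAlong Γ X (β i) (dirDeriv X τ) z) (covAlong Γ X (β i) (dirDeriv X τ) z)) -
        2 * ∑ i, ∑ j,
          B (X z) (covAlong Γ X (β i) (dirDeriv X τ) z) (dirDeriv X (β j) z) ^ 2) 0 := by
  have hc : ∀ i j, ContDiffAt ℝ 2 (fun y => gram B X β y i j) z :=
    fun i j => h.contDiffAt_gram h.contDiff_metric i j
  have hc' : ∀ i j, ContDiffAt ℝ 1 (dirDeriv (fun y => gram B X β y i j) τ) z :=
    fun i j => STIMCF.contDiffAt_dirDeriv (hc i j) (by norm_num) τ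
  have key := hasDerivAt_trace_inv_mul (M := gram B X β)
    (N := fun y => Matrix.of fun i j => 1 / 2 * dirDeriv (fun y => gram B X β y i j) τ y)
    (fun i j => (hc i j).of_le (by norm_num)) (fun i j => contDiffAt_const.mul (hc' i j)) honb τ
  simp only [Matrix.of_apply] at key
  refine key.congr_deriv (Eq.symm ?_)
  rw [Finset.mul_sum]
  congr 1
  · refine Finset.sum_congr rfl fun i _ => ?_
    have h1 := h.dirDeriv_dirDeriv_induced i i
    have h2 := dirDeriv_const_mul ((hc' i i).differentiableAt (by norm_num)) (1 / 2) τ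
    rw [h2]
    change _ = 1 / 2 * dirDeriv (dirDeriv
      (fun y => B (X y) (dirDeriv X (β i) y) (dirDeriv X (β i) y)) τ) τ z
    rw [h1]; ring
  · refine Finset.sum_congr rfl fun i _ => ?_
    rw [Finset.mul_sum]
    refine Finset.sum_congr rfl fun j _ => ?_
    have h1 : dirDeriv (fun y => gram B X β y i j) τ z = _ := h.dirDeriv_induced i j
    rw [h1]; ring

/-- The vectors `∂_i X` and `∂_τ X` span the ambient space orthogonally. -/
def Spans (B : E → E →L[ℝ] E →L[ℝ] ℝ) (X : Z → E) (β : Fin n → Z) (τ z : Z) : Prop :=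
  ∀ Y : E, Y = ∑ i, B (X z) Y (dirDeriv X (β i) z) • dirDeriv X (β i) z +
    (B (X z) Y (dirDeriv X τ z) / speedSq B X τ z) • dirDeriv X τ z

/-- Inserting the tangential part of `∇_i ∂_τ X` into `K` is cancelled by the derivative of the
inverse metric. Hence the second fundamental form drops out, and only `∇K` and the gradient of the
speed remain. -/
theorem hasDerivAt_hyperTrace (h : IsNormalMotion B Γ X β τ z) (honb : gram B X β z = 1)
    (hspan : Spans B X β τ z) {K : E → E →L[ℝ] E →L[ℝ] ℝ} (hK : ContDiffAt ℝ 2 K (X z))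
    (hKsymm : ∀ v w, K (X z) v w = K (X z) w v) :
    HasDerivAt (fun r : ℝ => hyperTrace B K X β (z + r • τ))
      (∑ i, covBil Γ K (X z) (dirDeriv X τ z) (dirDeriv X (β i) z) (dirDeriv X (β i) z) +
        ∑ i, dirDeriv (speedSq B X τ) (β i) z / speedSq B X τ z *
          K (X z) (dirDeriv X τ z) (dirDeriv X (β i) z)) 0 := by
  have key := hasDerivAt_trace_inv_mul (M := gram B X β) (N := gram K X β)
    (fun i j => (h.contDiffAt_gram h.contDiff_metric i j).of_le (by norm_num))
    (fun i j => (h.contDiffAt_gram hK i j).of_le (by norm_num)) honb τ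
  unfold hyperTrace
  convert key using 1
  rw [← Finset.sum_add_distrib, ← Finset.sum_sub_distrib]
  set b : Fin n → Fin n → ℝ := fun i j =>
    B (X z) (covAlong Γ X (β i) (dirDeriv X τ) z) (dirDeriv X (β j) z) with hb
  -- Split `∇_i ∂_τ X` into tangential and normal parts; the normal coefficient is half the
  -- logarithmic derivative of the squared speed.
  have hsum : ∀ i, K (X z) (covAlong Γ X (β i) (dirDeriv X τ) z) (dirDeriv X (β i) z) =
      ∑ j, b i j * K (X z) (dirDeriv X (β j) z) (dirDeriv X (β i) z) +
        1 / 2 * (dirDeriv (speedSq B X τ) (β i) z / speedSq B X τ z *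
          K (X z) (dirDeriv X τ z) (dirDeriv X (β i) z)) := by
    intro i
    have h1 : dirDeriv (speedSq B X τ) (β i) z = _ := h.dirDeriv_speedSq (β i)
    conv_lhs => rw [hspan (covAlong Γ X (β i) (dirDeriv X τ) z)]
    rw [h1]
    simp only [map_add, map_sum, map_smul, _root_.add_apply, _root_.sum_apply,
      _root_.smul_apply, smul_eq_mul, hb]
    ring
  refine Finset.sum_congr rfl fun i _ => ?_
  have h1 : dirDeriv (fun y => gram K X β y i i) τ z =
      covBil Γ K (X z) (dirDeriv X τ z) (dirDeriv X (β i) z) (dirDeriv X (β i) z) +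
        2 * K (X z) (covAlong Γ X (β i) (dirDeriv X τ) z) (dirDeriv X (β i) z) := by
    have := dirDeriv_bilin (Γ := Γ) (ξ := τ) (hK.differentiableAt (by norm_num))
      (h.contDiff_map.differentiableAt (by norm_num)) (h.differentiableAt_dirDeriv (β i))
      (h.differentiableAt_dirDeriv (β i))
    rw [h.covAlong_comm τ (β i), hKsymm (dirDeriv X (β i) z)] at this
    simp only [gram, Matrix.of_apply]
    rw [this]; ring
  have h2 : ∀ j, dirDeriv (fun y => gram B X β y i j) τ z * gram K X β z i j =
      2 * (b i j * K (X z) (dirDeriv X (β j) z) (dirDeriv X (β i) z)) := by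
    intro j
    have h3 : dirDeriv (fun y => gram B X β y i j) τ z = _ := h.dirDeriv_induced i j
    rw [h3, hKsymm (dirDeriv X (β j) z)]
    simp only [gram, Matrix.of_apply, hb]
    ring
  rw [h1, hsum, Finset.sum_congr rfl fun j _ => h2 j, ← Finset.mul_sum]
  ring

theorem dirDeriv_comp {θ : E → ℝ} {z : Z} {X : Z → E} (hX : DifferentiableAt ℝ X z)
    (hθ : DifferentiableAt ℝ θ (X z)) (ξ : Z) :
    dirDeriv (fun y => θ (X y)) ξ z = fderiv ℝ θ (X z) (dirDeriv X ξ z) := by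
  unfold dirDeriv
  have := fderiv_comp z hθ hX
  change fderiv ℝ (θ ∘ X) z ξ = _
  rw [this]; rfl

theorem dirDeriv_dirDeriv_comp (h : IsNormalMotion B Γ X β τ z) {θ : E → ℝ}
    (hθ : ContDiffAt ℝ 2 θ (X z)) (ξ : Z) :
    dirDeriv (dirDeriv (fun y => θ (X y)) ξ) ξ z =
      hessBil Γ θ (X z) (dirDeriv X ξ z) (dirDeriv X ξ z) +
        fderiv ℝ θ (X z) (covAlong Γ X ξ (dirDeriv X ξ) z) := by
  have hc := h.contDiff_map.continuousAt
  have hX1 : DifferentiableAt ℝ X z := h.contDiff_map.differentiableAt (by norm_num)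
  have h1 : dirDeriv (fun y => θ (X y)) ξ =ᶠ[𝓝 z] fun y => fderiv ℝ θ (X y) (dirDeriv X ξ y) := by
    filter_upwards [h.eventually, hc.eventually (hθ.eventually (by simp))] with y hy hy'
    exact dirDeriv_comp (hy.contDiff_map.differentiableAt (by norm_num))
      (hy'.differentiableAt (by norm_num)) ξ
  rw [(dirDeriv_congr h1 ξ).self_of_nhds]
  have hd : DifferentiableAt ℝ (fderiv ℝ θ) (X z) :=
    (hθ.fderiv_right (m := 1) (by norm_num)).differentiableAt (by norm_num)
  have h2 : DifferentiableAt ℝ (fun y => fderiv ℝ θ (X y)) z :=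
    DifferentiableAt.comp (G := E →L[ℝ] ℝ) z hd hX1
  have h3 : fderiv ℝ (fun y => fderiv ℝ θ (X y)) z =
      (fderiv ℝ (fderiv ℝ θ) (X z)).comp (fderiv ℝ X z) :=
    fderiv_comp (G := E →L[ℝ] ℝ) z hd hX1
  conv_lhs => unfold dirDeriv
  rw [show (fun y => fderiv ℝ θ (X y) (fderiv ℝ X y ξ)) =
    fun y => fderiv ℝ θ (X y) (dirDeriv X ξ y) from rfl,
    fderiv_clm_apply h2 (h.differentiableAt_dirDeriv ξ), h3]
  simp only [hessBil, covAlong, map_add, dirDeriv, _root_.add_apply,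
    ContinuousLinearMap.comp_apply, ContinuousLinearMap.flip_apply]
  ring

end IsNormalMotion

end NormalMotion

end

section

set_option synthInstance.maxHeartbeats 400000

/-! ### The Riccati inequality at a touching point. -/

section Riccati

open Filter Topology

variable {E Z W : Type*} [NormedAddCommGroup E] [NormedSpace ℝ E]
  [NormedAddCommGroup Z] [NormedSpace ℝ Z] [NormedAddCommGroup W] [NormedSpace ℝ W] {n : ℕ}

local instance instNormedAddCommGroupCLM'' : NormedAddCommGroup (E →L[ℝ] W) :=
  ContinuousLinearMap.toNormedAddCommGroup

local instance instNormedSpaceCLM'' : NormedSpace ℝ (E →L[ℝ] W) :=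
  ContinuousLinearMap.toNormedSpace

local instance instNormedAddCommGroupCLM₂'' : NormedAddCommGroup (E →L[ℝ] E →L[ℝ] W) :=
  ContinuousLinearMap.toNormedAddCommGroup

local instance instNormedSpaceCLM₂'' : NormedSpace ℝ (E →L[ℝ] E →L[ℝ] W) :=
  ContinuousLinearMap.toNormedSpace

namespace IsNormalMotion

variable {B : E → E →L[ℝ] E →L[ℝ] ℝ} {Γ : E → E →L[ℝ] E →L[ℝ] E} {X : Z → E} {β : Fin n → Z}
  {τ z : Z}

/-- First and second derivatives of the squared speed at a point where it is touched from below. -/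
theorem touching (h : IsNormalMotion B Γ X β τ z) {θ : E → ℝ} (hθ : ContDiffAt ℝ 2 θ (X z))
    (h0 : θ (X z) = speedSq B X τ z) {ξ : Z}
    (hξ : ∀ᶠ r in 𝓝 (0 : ℝ), θ (X (z + r • ξ)) ≤ speedSq B X τ (z + r • ξ)) :
    dirDeriv (speedSq B X τ) ξ z = fderiv ℝ θ (X z) (dirDeriv X ξ z) ∧
    hessBil Γ θ (X z) (dirDeriv X ξ z) (dirDeriv X ξ z) +
        fderiv ℝ θ (X z) (covAlong Γ X ξ (dirDeriv X ξ) z) ≤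
      dirDeriv (dirDeriv (speedSq B X τ) ξ) ξ z := by
  have hX1 : DifferentiableAt ℝ X z := h.contDiff_map.differentiableAt (by norm_num)
  have hs := h.contDiffAt_speedSq
  have hc : ContDiffAt ℝ 2 (fun y => θ (X y)) z :=
    hθ.comp z (h.contDiff_map.of_le (by norm_num))
  obtain ⟨h1, h2⟩ := dirDeriv_of_nonneg (u := fun y => speedSq B X τ y - θ (X y)) (ξ := ξ)
    (hs.sub hc) (by simp [h0]) (by filter_upwards [hξ] with r hr; linarith)
  have hev : dirDeriv (fun y => speedSq B X τ y - θ (X y)) ξ =ᶠ[𝓝 z]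
      fun y => dirDeriv (speedSq B X τ) ξ y - dirDeriv (fun y => θ (X y)) ξ y := by
    filter_upwards [hs.eventually (by simp), hc.eventually (by simp)] with y hy hy'
    exact dirDeriv_sub (hy.differentiableAt (by norm_num)) (hy'.differentiableAt (by norm_num)) ξ
  rw [hev.self_of_nhds] at h1
  beta_reduce at h1
  rw [dirDeriv_comp hX1 (hθ.differentiableAt (by norm_num))] at h1
  rw [(dirDeriv_congr hev ξ).self_of_nhds, dirDeriv_sub
    ((STIMCF.contDiffAt_dirDeriv (k := 1) hs (by norm_num) ξ).differentiableAt (by norm_num))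
    ((STIMCF.contDiffAt_dirDeriv (k := 1) hc (by norm_num) ξ).differentiableAt (by norm_num)),
    h.dirDeriv_dirDeriv_comp hθ] at h2
  exact ⟨by linarith, by linarith⟩

/-- Touching is assumed only at earlier times, so the first derivative is compared by an inequality,
unlike in the spatial directions. -/
theorem touching_time (h : IsNormalMotion B Γ X β τ z) {θ : E → ℝ} (hθ : ContDiffAt ℝ 2 θ (X z))
    (h0 : θ (X z) = speedSq B X τ z) {ξ : Z}
    (hξ : ∀ᶠ r in 𝓝[≤] (0 : ℝ), θ (X (z + r • ξ)) ≤ speedSq B X τ (z + r • ξ)) :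
    dirDeriv (speedSq B X τ) ξ z ≤ fderiv ℝ θ (X z) (dirDeriv X ξ z) := by
  have hX1 : DifferentiableAt ℝ X z := h.contDiff_map.differentiableAt (by norm_num)
  have hs := h.contDiffAt_speedSq.differentiableAt (by norm_num)
  have hc : DifferentiableAt ℝ (fun y => θ (X y)) z :=
    (hθ.differentiableAt (by norm_num)).comp z hX1
  have h1 := dirDeriv_nonpos_of_nonneg (u := fun y => speedSq B X τ y - θ (X y)) (ξ := ξ)
    (hs.sub hc) (by simp [h0]) (by filter_upwards [hξ] with r hr; linarith)
  rw [dirDeriv_sub hs hc, dirDeriv_comp hX1 (hθ.differentiableAt (by norm_num))] at h1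
  linarith

/-- The differential inequality behind the gradient estimate for inverse space-time mean curvature
flow, at a point where the squared speed is touched from below by a function `θ` of the ambient
space. -/
theorem expansion_cube_le (h : IsNormalMotion B Γ X β τ z) (honb : gram B X β z = 1)
    (hspan : Spans B X β τ z) (ha : 0 < speedSq B X τ z)
    {K : E → E →L[ℝ] E →L[ℝ] ℝ} (hK : ContDiffAt ℝ 2 K (X z))
    (hKsymm : ∀ v w, K (X z) v w = K (X z) w v)
    {θ : E → ℝ} (hθ : ContDiffAt ℝ 2 θ (X z)) (h0 : θ (X z) = speedSq B X τ z)
    (hβ : ∀ i, ∀ᶠ r in 𝓝 (0 : ℝ), θ (X (z + r • β i)) ≤ speedSq B X τ (z + r • β i))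
    (hτ : ∀ᶠ r in 𝓝[≤] (0 : ℝ), θ (X (z + r • τ)) ≤ speedSq B X τ (z + r • τ))
    (heq : ∀ᶠ r in 𝓝 (0 : ℝ), expansion B X β τ (z + r • τ) ^ 2 -
      speedSq B X τ (z + r • τ) * hyperTrace B K X β (z + r • τ) ^ 2 = 1)
    (hpos : 0 < expansion B X β τ z) :
    expansion B X β τ z ^ 3 / n ≤
      fderiv ℝ θ (X z) (dirDeriv X τ z) / (2 * speedSq B X τ z) * (1 + expansion B X β τ z ^ 2) +
      expansion B X β τ z *
        ((∑ i, (-(1 / 2) * hessBil Γ θ (X z) (dirDeriv X (β i) z) (dirDeriv X (β i) z) +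
          (1 / 2 * fderiv ℝ θ (X z) (dirDeriv X (β i) z)) ^ 2 / speedSq B X τ z)) +
          ∑ i, B (X z) (curv Γ (X z) (dirDeriv X τ z) (dirDeriv X (β i) z) (dirDeriv X τ z))
            (dirDeriv X (β i) z)) -
      speedSq B X τ z * hyperTrace B K X β z *
        (∑ i, covBil Γ K (X z) (dirDeriv X τ z) (dirDeriv X (β i) z) (dirDeriv X (β i) z) +
          ∑ i, fderiv ℝ θ (X z) (dirDeriv X (β i) z) / speedSq B X τ z *
            K (X z) (dirDeriv X τ z) (dirDeriv X (β i) z)) := by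
  have hE := h.hasDerivAt_expansion honb
  have hP := h.hasDerivAt_hyperTrace honb hspan hK hKsymm
  have hS := hasDerivAt_line (h.contDiffAt_speedSq.differentiableAt (by norm_num)) τ
  have hHt := h.expansion_eq honb
  have ht1 := fun i => (h.touching hθ h0 (hβ i)).1
  have ht2 := fun i => (h.touching hθ h0 (hβ i)).2
  have ht3 := h.touching_time hθ h0 hτ
  simp only [ht1] at hP
  set a := speedSq B X τ z with ha_def
  set aτ := dirDeriv (speedSq B X τ) τ z
  set D := fderiv ℝ θ (X z) (dirDeriv X τ z) with hD
  set P := hyperTrace B K X β z with hP_def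
  set Ht := expansion B X β τ z with hHt_def
  set P' := (∑ i, covBil Γ K (X z) (dirDeriv X τ z) (dirDeriv X (β i) z) (dirDeriv X (β i) z) +
          ∑ i, fderiv ℝ θ (X z) (dirDeriv X (β i) z) / a *
            K (X z) (dirDeriv X τ z) (dirDeriv X (β i) z))
  set b : Fin n → Fin n → ℝ := fun i j =>
    B (X z) (covAlong Γ X (β i) (dirDeriv X τ) z) (dirDeriv X (β j) z) with hb
  set Q := ∑ i, ∑ j, b i j ^ 2 with hQ
  -- the acceleration
  have hW : ∀ Y, B (X z) (covAlong Γ X τ (dirDeriv X τ) z) Y =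
      -(1 / 2) * fderiv ℝ θ (X z) Y + 1 / 2 * (aτ + D) / a * B (X z) Y (dirDeriv X τ z) := by
    intro Y
    have e1 : ∀ j, B (X z) (covAlong Γ X τ (dirDeriv X τ) z) (dirDeriv X (β j) z) =
        -(1 / 2) * fderiv ℝ θ (X z) (dirDeriv X (β j) z) := fun j => by
      rw [← ht1 j]; exact h.metric_accel_tangent j
    have e2 : B (X z) (covAlong Γ X τ (dirDeriv X τ) z) (dirDeriv X τ z) = 1 / 2 * aτ := by
      have : aτ = _ := h.dirDeriv_speedSq τ
      rw [this]; ring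
    have e3 : fderiv ℝ θ (X z) Y = ∑ i, B (X z) Y (dirDeriv X (β i) z) *
        fderiv ℝ θ (X z) (dirDeriv X (β i) z) + B (X z) Y (dirDeriv X τ z) / a * D := by
      conv_lhs => rw [hspan Y]
      simp [hD, ha_def]
    have e4 : B (X z) (covAlong Γ X τ (dirDeriv X τ) z) Y = ∑ i, B (X z) Y (dirDeriv X (β i) z) *
        B (X z) (covAlong Γ X τ (dirDeriv X τ) z) (dirDeriv X (β i) z) +
        B (X z) Y (dirDeriv X τ z) / a *
          B (X z) (covAlong Γ X τ (dirDeriv X τ) z) (dirDeriv X τ z) := by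
      conv_lhs => rw [hspan Y]
      simp [ha_def]
    rw [e4, e3, e2]
    simp only [e1, mul_add, Finset.mul_sum]
    have : ∀ i, B (X z) Y (dirDeriv X (β i) z) *
        (-(1 / 2) * fderiv ℝ θ (X z) (dirDeriv X (β i) z)) = -(1 / 2) *
        (B (X z) Y (dirDeriv X (β i) z) * fderiv ℝ θ (X z) (dirDeriv X (β i) z)) := fun i => by
      ring
    simp only [this]
    ring
  -- Pythagoras: the tangential part contributes row `i` of `b`, the normal part half the derivative
  -- of `θ`.
  have hZZ : ∀ i, B (X z) (covAlong Γ X (β i) (dirDeriv X τ) z)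
      (covAlong Γ X (β i) (dirDeriv X τ) z) = ∑ j, b i j ^ 2 +
        (1 / 2 * fderiv ℝ θ (X z) (dirDeriv X (β i) z)) ^ 2 / a := by
    intro i
    have e1 : B (X z) (covAlong Γ X (β i) (dirDeriv X τ) z) (dirDeriv X τ z) =
        1 / 2 * fderiv ℝ θ (X z) (dirDeriv X (β i) z) := by
      have : dirDeriv (speedSq B X τ) (β i) z = _ := h.dirDeriv_speedSq (β i)
      rw [← ht1 i, this]; ring
    conv_lhs => arg 2; rw [hspan (covAlong Γ X (β i) (dirDeriv X τ) z)]
    simp only [map_add, map_sum, map_smul, smul_eq_mul, e1]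
    congr 1
    · exact Finset.sum_congr rfl fun j _ => by simp only [hb]; ring
    · ring
  -- The differential of `θ` on the acceleration `∇_i ∂_i X` occurs both here and in the touching
  -- inequality, and cancels, leaving the ambient Hessian of `θ`. The normal component of `∇_i ∂_i
  -- X` yields the `b i i` term.
  have hDW : ∀ i, B (X z) (covAlong Γ X (β i) (covAlong Γ X τ (dirDeriv X τ)) z)
      (dirDeriv X (β i) z) ≤
      -(1 / 2) * hessBil Γ θ (X z) (dirDeriv X (β i) z) (dirDeriv X (β i) z) +
        1 / 2 * (aτ + D) / a * b i i := by
    intro i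
    have e1 := h.metric_covAlong_accel i i
    rw [hW] at e1
    have e2 := h.metric_covAlong_tangent (β i) i
    rw [h.symm_self (dirDeriv X (β i) z)] at e2
    have e3 : dirDeriv (dirDeriv (fun y => B (X y) (dirDeriv X τ y) (dirDeriv X τ y)) (β i))
      (β i) z = dirDeriv (dirDeriv (speedSq B X τ) (β i)) (β i) z := rfl
    rw [e1, e2, e3]
    have := ht2 i
    simp only [hb]
    linarith
  set U := (∑ i, (-(1 / 2) * hessBil Γ θ (X z) (dirDeriv X (β i) z) (dirDeriv X (β i) z) +
          (1 / 2 * fderiv ℝ θ (X z) (dirDeriv X (β i) z)) ^ 2 / a)) +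
          ∑ i, B (X z) (curv Γ (X z) (dirDeriv X τ z) (dirDeriv X (β i) z) (dirDeriv X τ z))
            (dirDeriv X (β i) z) with hU
  set E' := ∑ i, (B (X z) (covAlong Γ X (β i) (covAlong Γ X τ (dirDeriv X τ)) z)
          (dirDeriv X (β i) z) +
        B (X z) (curv Γ (X z) (dirDeriv X τ z) (dirDeriv X (β i) z) (dirDeriv X τ z))
          (dirDeriv X (β i) z) +
        B (X z) (covAlong Γ X (β i) (dirDeriv X τ) z) (covAlong Γ X (β i) (dirDeriv X τ) z)) -
        2 * Q with hE'
  have hE'le : E' ≤ U + 1 / 2 * (aτ + D) / a * Ht - Q := by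
    have : E' + 2 * Q ≤ U + 1 / 2 * (aτ + D) / a * Ht + Q := by
      rw [hE', sub_add_cancel, hU, hHt, hQ, ← Finset.sum_add_distrib, Finset.mul_sum,
        ← Finset.sum_add_distrib, ← Finset.sum_add_distrib]
      refine Finset.sum_le_sum fun i _ => ?_
      have := hDW i
      rw [hZZ]
      simp only [hb] at this ⊢
      linarith
    linarith
  -- Cauchy–Schwarz for the trace of `b`, after dropping the off-diagonal entries.
  have hQle : Ht ^ 2 / n ≤ Q := by
    have e1 : Ht ^ 2 ≤ n * ∑ i, b i i ^ 2 := by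
      have := sq_sum_le_card_mul_sum_sq (s := Finset.univ) (f := fun i => b i i)
      rw [hHt]
      simpa using this
    have e2 : ∑ i, b i i ^ 2 ≤ Q := Finset.sum_le_sum fun i _ =>
      Finset.single_le_sum (f := fun j => b i j ^ 2) (fun j _ => sq_nonneg _) (Finset.mem_univ i)
    have hQ0 : 0 ≤ Q := Finset.sum_nonneg fun i _ => Finset.sum_nonneg fun j _ => sq_nonneg _
    refine div_le_of_le_mul₀ (by positivity) hQ0 ?_
    rw [mul_comm]
    exact e1.trans (by gcongr)
  -- The constraint `Ht² - a P² = 1`, differentiated in time.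
  have hd : 2 * Ht * E' - (aτ * P ^ 2 + a * (2 * P * P')) = 0 := by
    have h1 := (hE.pow 2).sub (hS.mul (hP.pow 2))
    have h2 := (hasDerivAt_const (0 : ℝ) (1 : ℝ)).congr_of_eventuallyEq heq
    have := h1.unique h2
    simp only [zero_smul, add_zero] at this
    simpa using this
  have h1 : Ht ^ 2 - a * P ^ 2 = 1 := by
    have := heq.self_of_nhds
    simpa using this
  have h2 : Ht * E' ≤ Ht * (U + 1 / 2 * (aτ + D) / a * Ht - Ht ^ 2 / n) :=
    mul_le_mul_of_nonneg_left (hE'le.trans (by linarith)) hpos.le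
  -- The decisive cancellation: replacing `Ht²` by `1 + a P²` in the `aτ` term splits off `½ aτ P²`,
  -- which is exactly what `hd` contributes. Only `aτ / (2a)` is left, and `aτ ≤ D` suffices for it.
  have h3 : 1 / 2 * (aτ + D) / a * Ht ^ 2 =
      1 / 2 * aτ / a + 1 / 2 * aτ * P ^ 2 + 1 / 2 * D / a * Ht ^ 2 := by
    have : Ht ^ 2 = 1 + a * P ^ 2 := by linarith
    rw [this]; field_simp
  have h4 : 1 / 2 * aτ / a ≤ 1 / 2 * D / a := by gcongr
  have h5 : D / (2 * a) * (1 + Ht ^ 2) = 1 / 2 * D / a + 1 / 2 * D / a * Ht ^ 2 := by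
    field_simp
  have h6 : Ht ^ 3 / n = Ht * (Ht ^ 2 / n) := by ring
  rw [h5, h6]
  have h7 : Ht * (1 / 2 * (aτ + D) / a * Ht) = 1 / 2 * (aτ + D) / a * Ht ^ 2 := by ring
  linear_combination h2 + h4 - (1 / 2) * hd + h3

end IsNormalMotion

end Riccati

end

section

set_option synthInstance.maxHeartbeats 400000

/-! ### Coordinate tensors as multilinear maps -/

section Coordinates

open Filter Topology

variable {m : ℕ}

local instance instNormedAddCommGroupEucl : NormedAddCommGroup (Eucl m →L[ℝ] Eucl m →L[ℝ] ℝ) :=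
  ContinuousLinearMap.toNormedAddCommGroup

local instance instNormedSpaceEucl : NormedSpace ℝ (Eucl m →L[ℝ] Eucl m →L[ℝ] ℝ) :=
  ContinuousLinearMap.toNormedSpace

local instance instNormedAddCommGroupEucl' :
    NormedAddCommGroup (Eucl m →L[ℝ] Eucl m →L[ℝ] Eucl m) :=
  ContinuousLinearMap.toNormedAddCommGroup

local instance instNormedSpaceEucl' : NormedSpace ℝ (Eucl m →L[ℝ] Eucl m →L[ℝ] Eucl m) :=
  ContinuousLinearMap.toNormedSpace

/-- The coordinate vector `e_a`. -/
abbrev basisVec (a : Fin m) : Eucl m := EuclideanSpace.single a 1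

/-- The bilinear form with coefficient matrix `A`. -/
def bilin (A : Matrix (Fin m) (Fin m) ℝ) : Eucl m →L[ℝ] Eucl m →L[ℝ] ℝ :=
  ∑ a, ∑ b, A a b • (EuclideanSpace.proj a : Eucl m →L[ℝ] ℝ).smulRight
    (EuclideanSpace.proj b : Eucl m →L[ℝ] ℝ)

/-- The Christoffel symbols of the metric with coefficient matrix `G`, as a bilinear map. -/
def chris (G : Eucl m → Matrix (Fin m) (Fin m) ℝ) (x : Eucl m) :
    Eucl m →L[ℝ] Eucl m →L[ℝ] Eucl m :=
  ∑ a, ∑ b, ∑ c, christoffel G x c a b • (EuclideanSpace.proj a : Eucl m →L[ℝ] ℝ).smulRight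
    ((EuclideanSpace.proj b : Eucl m →L[ℝ] ℝ).smulRight (basisVec c))

theorem bilin_apply (A : Matrix (Fin m) (Fin m) ℝ) (v w : Eucl m) :
    bilin A v w = ∑ a, ∑ b, A a b * v a * w b := by
  simp [bilin, _root_.sum_apply, mul_assoc]

theorem bilin_basisVec (A : Matrix (Fin m) (Fin m) ℝ) (a b : Fin m) :
    bilin A (basisVec a) (basisVec b) = A a b := by
  simp [bilin_apply, PiLp.single_apply]

theorem chris_apply (G : Eucl m → Matrix (Fin m) (Fin m) ℝ) (x v w : Eucl m) (c : Fin m) :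
    chris G x v w c = ∑ a, ∑ b, christoffel G x c a b * v a * w b := by
  simp [chris, _root_.sum_apply, mul_assoc, Pi.single_apply]

theorem chris_basisVec (G : Eucl m → Matrix (Fin m) (Fin m) ℝ) (x : Eucl m) (a b c : Fin m) :
    chris G x (basisVec a) (basisVec b) c = christoffel G x c a b := by
  simp [chris_apply, PiLp.single_apply]

theorem sum_smul_basisVec (v : Eucl m) : ∑ a, v a • basisVec a = v := by
  ext b
  simp [Pi.single_apply]

theorem clm_apply_eq_sum {W : Type*} [AddCommGroup W] [Module ℝ W] [TopologicalSpace W]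
    (L : Eucl m →L[ℝ] W) (v : Eucl m) : L v = ∑ a, v a • L (basisVec a) := by
  conv_lhs => rw [← sum_smul_basisVec v]
  simp

theorem contDiffAt_bilin {k : ℕ∞ω} {A : Eucl m → Matrix (Fin m) (Fin m) ℝ} {x : Eucl m}
    (hA : ∀ a b, ContDiffAt ℝ k (fun y => A y a b) x) :
    ContDiffAt ℝ k (fun y => bilin (A y)) x := by
  unfold bilin
  exact ContDiffAt.sum fun a _ => ContDiffAt.sum fun b _ => (hA a b).smul contDiffAt_const

theorem contDiffAt_pd {k k' : ℕ∞ω} {f : Eucl m → ℝ} {x : Eucl m} (hf : ContDiffAt ℝ k' f x)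
    (hk : k + 1 ≤ k') (a : Fin m) : ContDiffAt ℝ k (pd a f) x :=
  contDiffAt_dirDeriv hf hk _

theorem contDiffAt_christoffel {k k' : ℕ∞ω} {G : Eucl m → Matrix (Fin m) (Fin m) ℝ} {x : Eucl m}
    (hG : ∀ a b, ContDiffAt ℝ k' (fun y => G y a b) x) (hdet : (G x).det ≠ 0) (hk : k + 1 ≤ k')
    (c a b : Fin m) : ContDiffAt ℝ k (fun y => christoffel G y c a b) x := by
  unfold christoffel
  refine contDiffAt_const.mul (ContDiffAt.sum fun d _ => ?_)
  exact (contDiffAt_matrix_inv (fun i j => (hG i j).of_le (le_self_add.trans hk)) hdet c d).mul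
    (((contDiffAt_pd (hG _ _) hk _).add (contDiffAt_pd (hG _ _) hk _)).sub
      (contDiffAt_pd (hG _ _) hk _))

theorem contDiffAt_chris {k k' : ℕ∞ω} {G : Eucl m → Matrix (Fin m) (Fin m) ℝ} {x : Eucl m}
    (hG : ∀ a b, ContDiffAt ℝ k' (fun y => G y a b) x) (hdet : (G x).det ≠ 0) (hk : k + 1 ≤ k') :
    ContDiffAt ℝ k (chris G) x := by
  unfold chris
  exact ContDiffAt.sum fun a _ => ContDiffAt.sum fun b _ => ContDiffAt.sum fun c _ =>
    (contDiffAt_christoffel hG hdet hk c a b).smul contDiffAt_const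

theorem fderiv_apply_apply {E W : Type*} [NormedAddCommGroup E] [NormedSpace ℝ E]
    [NormedAddCommGroup W] [NormedSpace ℝ W] {L : Eucl m → E →L[ℝ] E →L[ℝ] W} {x : Eucl m}
    (hL : DifferentiableAt ℝ L x) (ξ : Eucl m) (v w : E) :
    fderiv ℝ L x ξ v w = fderiv ℝ (fun y => L y v w) x ξ := by
  have h1 : DifferentiableAt ℝ (fun y => L y v) x := hL.clm_apply (differentiableAt_const v)
  rw [fderiv_clm_apply h1 (differentiableAt_const w), fderiv_clm_apply hL
    (differentiableAt_const v)]
  simp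

theorem fderiv_bilin_basisVec {A : Eucl m → Matrix (Fin m) (Fin m) ℝ} {x : Eucl m}
    (hA : ∀ a b, ContDiffAt ℝ 1 (fun y => A y a b) x) (c a b : Fin m) :
    fderiv ℝ (fun y => bilin (A y)) x (basisVec c) (basisVec a) (basisVec b) =
      pd c (fun y => A y a b) x := by
  rw [fderiv_apply_apply ((contDiffAt_bilin hA).differentiableAt (by norm_num))]
  simp only [bilin_basisVec]
  rfl

theorem covBil_eq_sum (Γ : Eucl m → Eucl m →L[ℝ] Eucl m →L[ℝ] Eucl m)
    (K : Eucl m → Eucl m →L[ℝ] Eucl m →L[ℝ] ℝ) (x u v w : Eucl m) :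
    covBil Γ K x u v w = ∑ c, ∑ a, ∑ b, u c * v a * w b *
      covBil Γ K x (basisVec c) (basisVec a) (basisVec b) := by
  have h1 : ∀ u v, covBil Γ K x u v w = ∑ b, w b * covBil Γ K x u v (basisVec b) := fun u v =>
    clm_apply_eq_sum (fderiv ℝ K x u v - K x (Γ x u v) - (K x v).comp (Γ x u)) w
  have h2 : ∀ u w, covBil Γ K x u v w = ∑ a, v a * covBil Γ K x u (basisVec a) w := fun u w =>
    clm_apply_eq_sum ((fderiv ℝ K x u).flip w - ((K x).flip w).comp (Γ x u) -
      (K x).flip (Γ x u w)) v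
  have h3 : ∀ v w, covBil Γ K x u v w = ∑ c, u c * covBil Γ K x (basisVec c) v w := fun v w =>
    clm_apply_eq_sum (((fderiv ℝ K x).flip v).flip w - ((K x).flip w).comp ((Γ x).flip v) -
      (K x v).comp ((Γ x).flip w)) u
  rw [h3]
  refine Finset.sum_congr rfl fun c _ => ?_
  rw [h2, Finset.mul_sum]
  refine Finset.sum_congr rfl fun a _ => ?_
  rw [h1, Finset.mul_sum, Finset.mul_sum]
  exact Finset.sum_congr rfl fun b _ => by ring

theorem bilin_left_basisVec (A : Matrix (Fin m) (Fin m) ℝ) (v : Eucl m) (b : Fin m) :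
    bilin A v (basisVec b) = ∑ d, v d * A d b := by
  simp [bilin_apply, PiLp.single_apply, mul_comm]

theorem bilin_right_basisVec (A : Matrix (Fin m) (Fin m) ℝ) (v : Eucl m) (a : Fin m) :
    bilin A (basisVec a) v = ∑ d, v d * A a d := by
  simp [bilin_apply, PiLp.single_apply, mul_comm]

theorem covBil_basisVec {G K : Eucl m → Matrix (Fin m) (Fin m) ℝ} {x : Eucl m}
    (hK : ∀ a b, ContDiffAt ℝ 1 (fun y => K y a b) x) (c a b : Fin m) :
    covBil (chris G) (fun y => bilin (K y)) x (basisVec c) (basisVec a) (basisVec b) =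
      covDerivCoeff G K x c a b := by
  simp only [covBil, covDerivCoeff, fderiv_bilin_basisVec hK, bilin_left_basisVec,
    bilin_right_basisVec, chris_basisVec, Finset.sum_add_distrib]
  ring

/-- Lowering the index cancels the inverse metric and leaves the Christoffel symbols of the first
kind. -/
theorem sum_metric_christoffel {G : Eucl m → Matrix (Fin m) (Fin m) ℝ} {x : Eucl m}
    (hdet : (G x).det ≠ 0) (e a b : Fin m) :
    ∑ c, G x e c * christoffel G x c a b = 1 / 2 * (pd a (fun v => G v e b) x +
      pd b (fun v => G v e a) x - pd e (fun v => G v a b) x) := by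
  simp only [christoffel]
  set f : Fin m → ℝ := fun d => pd a (fun v => G v d b) x + pd b (fun v => G v d a) x -
    pd d (fun v => G v a b) x with hf
  change ∑ c, G x e c * (1 / 2 * ∑ d, (G x)⁻¹ c d * f d) = 1 / 2 * f e
  have h1 : ∀ d, ∑ c, G x e c * (G x)⁻¹ c d = (1 : Matrix (Fin m) (Fin m) ℝ) e d := fun d => by
    rw [← Matrix.mul_apply, Matrix.mul_nonsing_inv _ (isUnit_iff_ne_zero.2 hdet)]
  calc ∑ c, G x e c * (1 / 2 * ∑ d, (G x)⁻¹ c d * f d)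
      = ∑ c, ∑ d, 1 / 2 * (G x e c * (G x)⁻¹ c d * f d) := by
        refine Finset.sum_congr rfl fun c _ => ?_
        rw [Finset.mul_sum, Finset.mul_sum]
        exact Finset.sum_congr rfl fun d _ => by ring
    _ = ∑ d, 1 / 2 * ((∑ c, G x e c * (G x)⁻¹ c d) * f d) := by
        rw [Finset.sum_comm]
        refine Finset.sum_congr rfl fun d _ => ?_
        rw [Finset.sum_mul, Finset.mul_sum]
    _ = 1 / 2 * f e := by
        simp [h1, Matrix.one_apply]

theorem christoffel_symm {G : Eucl m → Matrix (Fin m) (Fin m) ℝ} {x : Eucl m}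
    (hG : ∀ᶠ y in 𝓝 x, ∀ a b, G y a b = G y b a) (c a b : Fin m) :
    christoffel G x c a b = christoffel G x c b a := by
  have h : ∀ d, pd d (fun v => G v a b) x = pd d (fun v => G v b a) x := fun d =>
    (dirDeriv_congr (by filter_upwards [hG] with y hy using hy a b) (basisVec d)).self_of_nhds
  simp only [christoffel, h]
  congr 1
  exact Finset.sum_congr rfl fun d _ => by ring

theorem chris_symm {G : Eucl m → Matrix (Fin m) (Fin m) ℝ} {x : Eucl m}
    (hG : ∀ᶠ y in 𝓝 x, ∀ a b, G y a b = G y b a) (v w : Eucl m) :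
    chris G x v w = chris G x w v := by
  ext c
  rw [chris_apply, chris_apply, Finset.sum_comm]
  refine Finset.sum_congr rfl fun a _ => Finset.sum_congr rfl fun b _ => ?_
  rw [christoffel_symm hG]; ring

theorem bilin_symm {A : Matrix (Fin m) (Fin m) ℝ} (hA : ∀ a b, A a b = A b a) (v w : Eucl m) :
    bilin A v w = bilin A w v := by
  rw [bilin_apply, bilin_apply, Finset.sum_comm]
  refine Finset.sum_congr rfl fun a _ => Finset.sum_congr rfl fun b _ => ?_
  rw [hA]; ring

/-- Metric compatibility: the two first-kind symbols with indices `a`, `b` exchanged add up to the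
`c`-derivative of `G a b`. -/
theorem covBil_metric {G : Eucl m → Matrix (Fin m) (Fin m) ℝ} {x : Eucl m}
    (hG : ∀ a b, ContDiffAt ℝ 1 (fun y => G y a b) x)
    (hsymm : ∀ᶠ y in 𝓝 x, ∀ a b, G y a b = G y b a) (hdet : (G x).det ≠ 0) (u v w : Eucl m) :
    covBil (chris G) (fun y => bilin (G y)) x u v w = 0 := by
  rw [covBil_eq_sum]
  refine Finset.sum_eq_zero fun c _ => Finset.sum_eq_zero fun a _ =>
    Finset.sum_eq_zero fun b _ => mul_eq_zero_of_right _ ?_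
  rw [covBil_basisVec hG, covDerivCoeff, Finset.sum_add_distrib]
  have h : ∀ d a b, pd d (fun v => G v a b) x = pd d (fun v => G v b a) x := fun d a b =>
    (dirDeriv_congr (by filter_upwards [hsymm] with y hy using hy a b) (basisVec d)).self_of_nhds
  have h1 : ∑ d, christoffel G x d c a * G x d b = ∑ d, G x b d * christoffel G x d c a :=
    Finset.sum_congr rfl fun d _ => by rw [hsymm.self_of_nhds d b, mul_comm]
  have h2 : ∑ d, christoffel G x d c b * G x a d = ∑ d, G x a d * christoffel G x d c b :=
    Finset.sum_congr rfl fun d _ => by rw [mul_comm]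
  rw [h1, h2, sum_metric_christoffel hdet, sum_metric_christoffel hdet, h c b a, h a b c,
    h b c a]
  ring

theorem hessBil_eq_sum {G : Eucl m → Matrix (Fin m) (Fin m) ℝ} {θ : Eucl m → ℝ} {x : Eucl m}
    (hθ : ContDiffAt ℝ 2 θ x) (v w : Eucl m) :
    hessBil (chris G) θ x v w = ∑ a, ∑ b, hessianCoeff G θ x a b * v a * w b := by
  have hd : DifferentiableAt ℝ (fderiv ℝ θ) x :=
    (hθ.fderiv_right (m := 1) (by norm_num)).differentiableAt (by norm_num)
  have h1 : ∀ a b, hessBil (chris G) θ x (basisVec a) (basisVec b) = hessianCoeff G θ x a b := by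
    intro a b
    unfold hessBil hessianCoeff
    congr 1
    · unfold pd
      rw [fderiv_clm_apply hd (differentiableAt_const _)]
      simp
    · rw [clm_apply_eq_sum]
      exact Finset.sum_congr rfl fun c _ => by rw [chris_basisVec]; rfl
  have h2 : ∀ v, hessBil (chris G) θ x v w = ∑ b, w b * hessBil (chris G) θ x v (basisVec b) :=
    fun v => clm_apply_eq_sum (fderiv ℝ (fderiv ℝ θ) x v - (fderiv ℝ θ x).comp (chris G x v)) w
  have h3 : ∀ w, hessBil (chris G) θ x v w = ∑ a, v a * hessBil (chris G) θ x (basisVec a) w :=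
    fun w => clm_apply_eq_sum ((fderiv ℝ (fderiv ℝ θ) x).flip w -
      (fderiv ℝ θ x).comp ((chris G x).flip w)) v
  rw [h3]
  refine Finset.sum_congr rfl fun a _ => ?_
  rw [h2, Finset.mul_sum]
  refine Finset.sum_congr rfl fun b _ => ?_
  rw [h1]; ring

theorem fderiv_chris_basisVec {G : Eucl m → Matrix (Fin m) (Fin m) ℝ} {x : Eucl m}
    (hG : ∀ a b, ContDiffAt ℝ 2 (fun y => G y a b) x) (hdet : (G x).det ≠ 0)
    (d a b c : Fin m) :
    fderiv ℝ (chris G) x (basisVec d) (basisVec a) (basisVec b) c =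
      pd d (fun y => christoffel G y c a b) x := by
  have h := (contDiffAt_chris (k := 1) hG hdet (by norm_num)).differentiableAt (by norm_num)
  have h1 : DifferentiableAt ℝ (fun y => chris G y (basisVec a) (basisVec b)) x :=
    (h.clm_apply (differentiableAt_const _)).clm_apply (differentiableAt_const _)
  rw [fderiv_apply_apply h]
  have h2 := ((EuclideanSpace.proj c : Eucl m →L[ℝ] ℝ).hasFDerivAt.comp x h1.hasFDerivAt).fderiv
  have h3 : ((EuclideanSpace.proj c : Eucl m →L[ℝ] ℝ) ∘
      fun y => chris G y (basisVec a) (basisVec b)) = fun y => christoffel G y c a b := by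
    funext y
    exact chris_basisVec G y a b c
  rw [h3] at h2
  unfold pd
  rw [h2]; rfl

/-- Identifies the coordinate formula with the trace of `u ↦ R(u, v) w`, thereby fixing the sign
with which Ricci enters the Riccati equation. -/
theorem sum_ricciCoeff {G : Eucl m → Matrix (Fin m) (Fin m) ℝ} {x : Eucl m}
    (hG : ∀ a b, ContDiffAt ℝ 2 (fun y => G y a b) x) (hdet : (G x).det ≠ 0) (v w : Eucl m) :
    ∑ a, ∑ b, ricciCoeff G x a b * v a * w b = ∑ c, curv (chris G) x (basisVec c) v w c := by
  have h1 : ∀ c v, curv (chris G) x (basisVec c) v w c =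
      ∑ b, w b * curv (chris G) x (basisVec c) v (basisVec b) c := fun c v =>
    clm_apply_eq_sum ((EuclideanSpace.proj c : Eucl m →L[ℝ] ℝ).comp
      (fderiv ℝ (chris G) x (basisVec c) v - fderiv ℝ (chris G) x v (basisVec c) +
      (chris G x (basisVec c)).comp (chris G x v) -
      (chris G x v).comp (chris G x (basisVec c)))) w
  have h2 : ∀ c w, curv (chris G) x (basisVec c) v w c =
      ∑ a, v a * curv (chris G) x (basisVec c) (basisVec a) w c := fun c w =>
    clm_apply_eq_sum ((EuclideanSpace.proj c : Eucl m →L[ℝ] ℝ).comp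
      ((fderiv ℝ (chris G) x (basisVec c)).flip w -
      ((fderiv ℝ (chris G) x).flip (basisVec c)).flip w +
      (chris G x (basisVec c)).comp ((chris G x).flip w) -
      (chris G x).flip (chris G x (basisVec c) w))) v
  have h3 : ∀ a b c, curv (chris G) x (basisVec c) (basisVec a) (basisVec b) c =
      (pd c (fun v => christoffel G v c a b) x - pd a (fun v => christoffel G v c c b) x) +
      ∑ d, (christoffel G x d a b * christoffel G x c c d -
        christoffel G x c a d * christoffel G x d c b) := by
    intro a b c
    have e : ∀ (u v : Eucl m), chris G x u v c = ∑ d, v d * chris G x u (basisVec d) c :=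
      fun u v => clm_apply_eq_sum
        ((EuclideanSpace.proj c : Eucl m →L[ℝ] ℝ).comp (chris G x u)) v
    unfold curv
    simp only [PiLp.sub_apply, PiLp.add_apply, fderiv_chris_basisVec hG hdet]
    rw [e (basisVec c), e (basisVec a)]
    simp only [chris_basisVec, Finset.sum_sub_distrib]
    have : ∑ d, christoffel G x d c b * christoffel G x c a d =
      ∑ d, christoffel G x c a d * christoffel G x d c b :=
      Finset.sum_congr rfl fun d _ => mul_comm _ _
    rw [this]; ring
  have h4 : ∀ c, curv (chris G) x (basisVec c) v w c = ∑ a, ∑ b, v a * w b *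
      curv (chris G) x (basisVec c) (basisVec a) (basisVec b) c := by
    intro c
    rw [h2]
    refine Finset.sum_congr rfl fun a _ => ?_
    rw [h1, Finset.mul_sum]
    exact Finset.sum_congr rfl fun b _ => by ring
  simp only [h4]
  symm
  rw [Finset.sum_comm]
  refine Finset.sum_congr rfl fun a _ => ?_
  rw [Finset.sum_comm]
  refine Finset.sum_congr rfl fun b _ => ?_
  simp only [h3]
  rw [← Finset.mul_sum, Finset.sum_add_distrib, ricciCoeff]
  ring

end Coordinates

end

section

set_option synthInstance.maxHeartbeats 400000

/-! ### Orthonormal frames -/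

section OrthoFrame

variable {m : ℕ} {G : Matrix (Fin m) (Fin m) ℝ} {e : Fin m → Eucl m}

/-- `e` is an orthonormal frame of the scalar product with coefficient matrix `G`. -/
def IsOrthoFrame (G : Matrix (Fin m) (Fin m) ℝ) (e : Fin m → Eucl m) : Prop :=
  ∀ k l, bilin G (e k) (e l) = (1 : Matrix (Fin m) (Fin m) ℝ) k l

namespace IsOrthoFrame

/-- With the frame as columns of `Q`, orthonormality says `Qᵀ G Q = 1`; a one-sided inverse of a
square matrix is two-sided. -/
theorem mul_eq_one (h : IsOrthoFrame G e) :
    (Matrix.of fun a k => e k a) * (Matrix.of fun a k => e k a).transpose * G = 1 := by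
  set Q : Matrix (Fin m) (Fin m) ℝ := Matrix.of fun a k => e k a
  have h1 : Q.transpose * G * Q = 1 := by
    ext k l
    rw [← h k l, bilin_apply, Matrix.mul_apply]
    simp only [Matrix.mul_apply, Finset.sum_mul]
    rw [Finset.sum_comm]
    refine Finset.sum_congr rfl fun a _ => Finset.sum_congr rfl fun b _ => ?_
    simp only [Q, Matrix.transpose_apply, Matrix.of_apply]
    ring
  rw [Matrix.mul_assoc]
  exact mul_eq_one_comm.1 h1

theorem inv_apply (h : IsOrthoFrame G e) (a b : Fin m) : G⁻¹ a b = ∑ k, e k a * e k b := by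
  rw [Matrix.inv_eq_left_inv h.mul_eq_one, Matrix.mul_apply]
  rfl

theorem det_ne_zero (h : IsOrthoFrame G e) : G.det ≠ 0 := by
  intro h0
  have := congrArg Matrix.det h.mul_eq_one
  rw [Matrix.det_mul, h0] at this
  simp at this

theorem sum_smul (h : IsOrthoFrame G e) (Y : Eucl m) : ∑ k, bilin G (e k) Y • e k = Y := by
  ext c
  have h1 : ∀ b, ∑ k, ∑ a, e k c * e k a * G a b = (1 : Matrix (Fin m) (Fin m) ℝ) c b := by
    intro b
    rw [← h.mul_eq_one, Matrix.mul_apply, Finset.sum_comm]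
    refine Finset.sum_congr rfl fun a _ => ?_
    rw [Matrix.mul_apply, Finset.sum_mul]
    rfl
  have h2 : (∑ k, bilin G (e k) Y • e k) c = ∑ b, Y b * ∑ k, ∑ a, e k c * e k a * G a b := by
    simp only [PiLp.smul_apply, WithLp.ofLp_sum, Finset.sum_apply, smul_eq_mul, bilin_apply,
      Finset.mul_sum, Finset.sum_mul]
    conv_rhs => rw [Finset.sum_comm]
    refine Finset.sum_congr rfl fun k _ => ?_
    rw [Finset.sum_comm]
    exact Finset.sum_congr rfl fun b _ => Finset.sum_congr rfl fun a _ => by ring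
  rw [h2]
  simp [h1, Matrix.one_apply]

/-- Independence of the trace from the basis, used to read the Ricci contraction in the frame
adapted to the hypersurface. -/
theorem sum_trace (h : IsOrthoFrame G e) (L : Eucl m →L[ℝ] Eucl m) :
    ∑ c, L (basisVec c) c = ∑ k, bilin G (e k) (L (e k)) := by
  have h1 : ∀ c, L (basisVec c) c = ∑ k, e k c * bilin G (e k) (L (basisVec c)) := by
    intro c
    conv_lhs => rw [← h.sum_smul (L (basisVec c))]
    simp [mul_comm]
  simp only [h1]
  rw [Finset.sum_comm]
  refine Finset.sum_congr rfl fun k _ => ?_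
  exact (clm_apply_eq_sum ((bilin G (e k)).comp L) (e k)).symm

theorem sum_inv (h : IsOrthoFrame G e) (φ ψ : Fin m → ℝ) :
    ∑ a, ∑ b, G⁻¹ a b * φ a * ψ b = ∑ k, (∑ a, e k a * φ a) * ∑ b, e k b * ψ b := by
  simp only [h.inv_apply, Finset.sum_mul, Finset.mul_sum]
  conv_rhs => rw [Finset.sum_comm]
  rw [Finset.sum_comm]
  refine Finset.sum_congr rfl fun b _ => ?_
  rw [Finset.sum_comm]
  exact Finset.sum_congr rfl fun k _ => Finset.sum_congr rfl fun a _ => by ring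

theorem sum_inv₂ (h : IsOrthoFrame G e) (t t' : Fin m → Fin m → ℝ) :
    ∑ a, ∑ b, ∑ a', ∑ b', G⁻¹ a a' * G⁻¹ b b' * t a b * t' a' b' =
      ∑ k, ∑ l, (∑ a, ∑ b, e k a * e l b * t a b) * ∑ a, ∑ b, e k a * e l b * t' a b := by
  have h1 : ∀ a a', ∑ b, ∑ b', G⁻¹ a a' * G⁻¹ b b' * t a b * t' a' b' =
      ∑ l, G⁻¹ a a' * (∑ b, e l b * t a b) * ∑ b, e l b * t' a' b := by
    intro a a'
    simp only [mul_assoc]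
    rw [← Finset.mul_sum, ← h.sum_inv, Finset.mul_sum]
    refine Finset.sum_congr rfl fun b _ => ?_
    rw [Finset.mul_sum]
    exact Finset.sum_congr rfl fun b' _ => by ring
  have h2 : ∀ a, ∑ b, ∑ a', ∑ b', G⁻¹ a a' * G⁻¹ b b' * t a b * t' a' b' =
      ∑ l, ∑ a', G⁻¹ a a' * (∑ b, e l b * t a b) * ∑ b, e l b * t' a' b := by
    intro a
    rw [Finset.sum_comm]
    simp only [h1]
    rw [Finset.sum_comm]
  simp only [h2]
  rw [Finset.sum_comm]
  simp only [h.sum_inv]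
  rw [Finset.sum_comm]
  refine Finset.sum_congr rfl fun k _ => Finset.sum_congr rfl fun l _ => ?_
  simp only [Finset.mul_sum, mul_assoc]

theorem sum_inv₃ (h : IsOrthoFrame G e) (t : Fin m → Fin m → Fin m → ℝ) :
    ∑ c, ∑ a, ∑ b, ∑ c', ∑ a', ∑ b',
      G⁻¹ c c' * G⁻¹ a a' * G⁻¹ b b' * t c a b * t c' a' b' =
      ∑ j, ∑ k, ∑ l, (∑ c, ∑ a, ∑ b, e j c * e k a * e l b * t c a b) ^ 2 := by
  have h1 : ∀ c c', ∑ a, ∑ b, ∑ a', ∑ b',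
      G⁻¹ c c' * G⁻¹ a a' * G⁻¹ b b' * t c a b * t c' a' b' =
      ∑ k, ∑ l, G⁻¹ c c' * (∑ a, ∑ b, e k a * e l b * t c a b) *
        ∑ a, ∑ b, e k a * e l b * t c' a b := by
    intro c c'
    simp only [mul_assoc]
    simp only [← Finset.mul_sum]
    congr 1
    have := h.sum_inv₂ (t c) (t c')
    simp only [mul_assoc, ← Finset.mul_sum] at this ⊢
    exact this
  have h2 : ∀ c, ∑ a, ∑ b, ∑ c', ∑ a', ∑ b',
      G⁻¹ c c' * G⁻¹ a a' * G⁻¹ b b' * t c a b * t c' a' b' =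
      ∑ k, ∑ l, ∑ c', G⁻¹ c c' * (∑ a, ∑ b, e k a * e l b * t c a b) *
        ∑ a, ∑ b, e k a * e l b * t c' a b := by
    intro c
    have : ∀ a, ∑ b, ∑ c', ∑ a', ∑ b',
      G⁻¹ c c' * G⁻¹ a a' * G⁻¹ b b' * t c a b * t c' a' b' = ∑ c', ∑ b, ∑ a', ∑ b',
      G⁻¹ c c' * G⁻¹ a a' * G⁻¹ b b' * t c a b * t c' a' b' := fun a => Finset.sum_comm
    simp only [this]
    rw [Finset.sum_comm]
    simp only [h1]
    rw [Finset.sum_comm]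
    exact Finset.sum_congr rfl fun k _ => Finset.sum_comm
  simp only [h2]
  rw [Finset.sum_comm]
  have h3 : ∀ k, ∑ c, ∑ l, ∑ c', G⁻¹ c c' * (∑ a, ∑ b, e k a * e l b * t c a b) *
        ∑ a, ∑ b, e k a * e l b * t c' a b =
      ∑ l, ∑ j, (∑ c, ∑ a, ∑ b, e j c * e k a * e l b * t c a b) ^ 2 := by
    intro k
    rw [Finset.sum_comm]
    refine Finset.sum_congr rfl fun l _ => ?_
    rw [h.sum_inv]
    refine Finset.sum_congr rfl fun j _ => ?_
    simp only [Finset.mul_sum, mul_assoc, sq]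
  simp only [h3]
  conv_rhs => rw [Finset.sum_comm]
  refine Finset.sum_congr rfl fun k _ => ?_
  rw [Finset.sum_comm]

/-- In an orthonormal frame the squared tensor norm is the sum of squared components, so it
dominates each of them. -/
theorem abs_bilin_le (h : IsOrthoFrame G e) (t : Matrix (Fin m) (Fin m) ℝ) (k l : Fin m) :
    |bilin t (e k) (e l)| ≤
      Real.sqrt (∑ a, ∑ b, ∑ a', ∑ b', G⁻¹ a a' * G⁻¹ b b' * t a b * t a' b') := by
  refine Real.abs_le_sqrt ?_
  rw [h.sum_inv₂ (fun a b => t a b) (fun a b => t a b)]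
  have h1 : bilin t (e k) (e l) = ∑ a, ∑ b, e k a * e l b * t a b := by
    rw [bilin_apply]
    exact Finset.sum_congr rfl fun a _ => Finset.sum_congr rfl fun b _ => by ring
  rw [h1, sq]
  refine le_trans ?_ (Finset.single_le_sum (f := fun k => ∑ l,
    (∑ a, ∑ b, e k a * e l b * t a b) * ∑ a, ∑ b, e k a * e l b * t a b)
    (fun k _ => Finset.sum_nonneg fun l _ => mul_self_nonneg _) (Finset.mem_univ k))
  exact Finset.single_le_sum (f := fun l =>
    (∑ a, ∑ b, e k a * e l b * t a b) * ∑ a, ∑ b, e k a * e l b * t a b)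
    (fun l _ => mul_self_nonneg _) (Finset.mem_univ l)

theorem abs_trilin_le (h : IsOrthoFrame G e) (t : Fin m → Fin m → Fin m → ℝ) (j k l : Fin m) :
    |∑ c, ∑ a, ∑ b, e j c * e k a * e l b * t c a b| ≤
      Real.sqrt (∑ c, ∑ a, ∑ b, ∑ c', ∑ a', ∑ b',
        G⁻¹ c c' * G⁻¹ a a' * G⁻¹ b b' * t c a b * t c' a' b') := by
  refine Real.abs_le_sqrt ?_
  rw [h.sum_inv₃]
  set s : Fin m → Fin m → Fin m → ℝ := fun j k l =>
    ∑ c, ∑ a, ∑ b, e j c * e k a * e l b * t c a b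
  change s j k l ^ 2 ≤ ∑ j, ∑ k, ∑ l, s j k l ^ 2
  calc s j k l ^ 2 ≤ ∑ l, s j k l ^ 2 := Finset.single_le_sum
        (f := fun l => s j k l ^ 2) (fun l _ => sq_nonneg _) (Finset.mem_univ l)
    _ ≤ ∑ k, ∑ l, s j k l ^ 2 := Finset.single_le_sum (f := fun k => ∑ l, s j k l ^ 2)
        (fun k _ => Finset.sum_nonneg fun l _ => sq_nonneg _) (Finset.mem_univ k)
    _ ≤ _ := Finset.single_le_sum (f := fun j => ∑ k, ∑ l, s j k l ^ 2)
        (fun j _ => Finset.sum_nonneg fun k _ => Finset.sum_nonneg fun l _ => sq_nonneg _)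
        (Finset.mem_univ j)

end IsOrthoFrame

end OrthoFrame

end

section

set_option synthInstance.maxHeartbeats 400000

/-! ### The estimate at a touching point, in coordinates -/

section CoordinateEstimate

open Filter Topology

variable {m n : ℕ}

/-- The cubic inequality is quadratic in `y = ψ E / s`, and `ψ / s ≤ y` because `E ≥ 1`. A quadratic
inequality with leading coefficient `1/n` bounds `y` linearly in the lower-order data. -/
theorem le_of_cube_le {n : ℕ} (hn : 1 ≤ n) {s E R ψ k₀ k₁ : ℝ} (hs : 0 < s) (hE : 1 ≤ E)
    (hR : 0 < R) (hψ : 0 < ψ) (hψ1 : ψ ≤ 1) (hk₀ : 0 ≤ k₀) (hk₁ : 0 ≤ k₁)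
    (h : E ^ 3 / n ≤ 24 * s * E ^ 2 / (R * ψ) +
      E * (s ^ 2 * (12 * n + 72) / (ψ * R ^ 2) + s ^ 2 / (100 * (n + 1) * R ^ 2)) +
      s * E * (n * s * k₁ + 24 * n * s * k₀ / (R * ψ))) :
    ψ / s ≤ 100 * n * (1 / R + k₀ + Real.sqrt k₁) := by
  have hn' : (1 : ℝ) ≤ n := by exact_mod_cast hn
  have hn0 : (0 : ℝ) < n := by linarith
  have hE0 : 0 < E := by linarith
  set y := ψ * E / s with hy
  set r := 1 / R with hr
  set k := Real.sqrt k₁ with hk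
  have hk2 : k ^ 2 = k₁ := Real.sq_sqrt hk₁
  have hk0 : 0 ≤ k := Real.sqrt_nonneg _
  have hr0 : 0 < r := by positivity
  have hy0 : 0 < y := by positivity
  have hψy : ψ / s ≤ y := by
    rw [hy]; gcongr; nlinarith
  refine hψy.trans ?_
  have h1 : y ^ 2 / n ≤ 24 * y * r + ψ * (12 * n + 72) * r ^ 2 +
      ψ ^ 2 * r ^ 2 / (100 * (n + 1)) + n * k₁ * ψ ^ 2 + 24 * n * k₀ * r * ψ := by
    -- This factor turns `E³/n` into `y²/n` and removes every negative power of `ψ`.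
    have h2 := mul_le_mul_of_nonneg_left h (show 0 ≤ ψ ^ 2 / (s ^ 2 * E) by positivity)
    have e1 : ψ ^ 2 / (s ^ 2 * E) * (E ^ 3 / n) = y ^ 2 / n := by
      rw [hy]; field_simp
    have e2 : ψ ^ 2 / (s ^ 2 * E) * (24 * s * E ^ 2 / (R * ψ) +
      E * (s ^ 2 * (12 * n + 72) / (ψ * R ^ 2) + s ^ 2 / (100 * (n + 1) * R ^ 2)) +
      s * E * (n * s * k₁ + 24 * n * s * k₀ / (R * ψ))) = 24 * y * r +
      ψ * (12 * n + 72) * r ^ 2 +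
      ψ ^ 2 * r ^ 2 / (100 * (n + 1)) + n * k₁ * ψ ^ 2 + 24 * n * k₀ * r * ψ := by
      rw [hy, hr]; field_simp; ring
    rwa [e1, e2] at h2
  have hψ2 : ψ ^ 2 ≤ 1 := by nlinarith
  have h2 : y ^ 2 / n ≤ 24 * y * r + (12 * n + 73) * r ^ 2 + n * k ^ 2 + 24 * n * k₀ * r := by
    have a1 : ψ * (12 * n + 72) * r ^ 2 ≤ 1 * (12 * n + 72) * r ^ 2 := by gcongr
    have a2 : ψ ^ 2 * r ^ 2 / (100 * (n + 1)) ≤ r ^ 2 := by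
      rw [div_le_iff₀ (by positivity)]
      nlinarith [mul_le_mul_of_nonneg_right hψ2 (sq_nonneg r), sq_nonneg r,
        mul_nonneg hn0.le (sq_nonneg r)]
    have a3 : n * k₁ * ψ ^ 2 ≤ n * k₁ * 1 := by gcongr
    have a4 : 24 * n * k₀ * r * ψ ≤ 24 * n * k₀ * r * 1 := by gcongr
    rw [hk2]; linarith
  set S := r + k₀ + k with hS
  have hSr : r ≤ S := by linarith
  have hS0 : 0 < S := by linarith
  have h3 : y ^ 2 / n ≤ 24 * y * S + (37 * n + 73) * S ^ 2 := by
    have b1 : r ^ 2 ≤ S ^ 2 := by gcongr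
    have b2 : k ^ 2 ≤ S ^ 2 := by gcongr; linarith
    have b3 : k₀ * r ≤ S ^ 2 := by
      rw [sq]; exact mul_le_mul (by linarith) hSr hr0.le hS0.le
    have b4 : y * r ≤ y * S := by gcongr
    nlinarith [mul_le_mul_of_nonneg_left b1 hn0.le, mul_le_mul_of_nonneg_left b2 hn0.le,
      mul_le_mul_of_nonneg_left b3 hn0.le]
  -- If `y > 100 n S`, then `37 n + 73 ≤ 200 n` absorbs the `S²` term into `2 S y`, so `y² ≤ 26 n S
  -- y`, contradicting `y² > 100 n S y`.
  by_contra hcon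
  push Not at hcon
  rw [div_le_iff₀ hn0] at h3
  have c1 : 100 * n * S * y < y ^ 2 := by
    rw [sq]; exact mul_lt_mul_of_pos_right hcon hy0
  have c2 : (37 * n + 73) * S ^ 2 ≤ 2 * S * y := by
    calc (37 * n + 73) * S ^ 2 ≤ 200 * n * S ^ 2 := by gcongr; linarith
      _ = 2 * S * (100 * n * S) := by ring
      _ ≤ 2 * S * y := by gcongr
  have c3 : (24 * y * S + (37 * n + 73) * S ^ 2) * n ≤ (24 * y * S + 2 * S * y) * n := by gcongr
  have c4 : 0 < n * S * y := by positivity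
  linarith

/-- Estimating the terms of the differential inequality at a touching point. -/
theorem div_le_of_cube_le {n : ℕ} (hn : 1 ≤ n) {a s E P R c ψ₀ ψ₁ ψ₂ k₀ k₁ D Rc : ℝ}
    {Hs d N κ : Fin n → ℝ} (ha : 0 < a) (hs0 : 0 < s) (hsq : s ^ 2 = a) (hR : 0 < R)
    (hc : 0 < c) (hk₀ : 0 ≤ k₀) (hk₁ : 0 ≤ k₁) (hpos : 0 < E) (hEP : E ^ 2 - a * P ^ 2 = 1)
    (hψ0 : 0 < ψ₀) (hψ1 : ψ₀ ≤ 1) (hψ' : ψ₁ ≤ 0) (hψ'' : -(4 / R ^ 2) ≤ ψ₁)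
    (hψ2 : -(8 / R ^ 4) ≤ ψ₂) (haψ : a = c ^ 2 * ψ₀ ^ 2)
    (hD : |D| ≤ s * (3 * R)) (hd : ∀ i, |d i| ≤ 3 * R) (hd2 : ∑ i, d i ^ 2 ≤ (3 * R) ^ 2)
    (hHs : ∀ i, Hs i ≤ 3) (hRc : -(1 / (100 * (n + 1) * R ^ 2)) * a ≤ Rc)
    (hN : ∀ i, |N i| ≤ s * k₁) (hκ : ∀ i, |κ i| ≤ s * k₀)
    (key : E ^ 3 / n ≤ 2 * c ^ 2 * (ψ₀ * ψ₁) * D / (2 * a) * (1 + E ^ 2) +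
      E * (∑ i, (-(1 / 2) * (2 * c ^ 2 * (ψ₀ * ψ₁) * Hs i +
        2 * c ^ 2 * (ψ₁ * ψ₁ + ψ₀ * ψ₂) * (d i * d i)) +
        (1 / 2 * (2 * c ^ 2 * (ψ₀ * ψ₁) * d i)) ^ 2 / a) + -Rc) -
      a * P * (∑ i, N i + ∑ i, 2 * c ^ 2 * (ψ₀ * ψ₁) * d i / a * κ i)) :
    ψ₀ / s ≤ 100 * n * (1 / R + k₀ + Real.sqrt k₁) := by
  have hψabs : |ψ₁| ≤ 4 / R ^ 2 := abs_le.2 ⟨hψ'', hψ'.trans (by positivity)⟩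
  -- The logarithmic derivative of `θ = c² ψ²`; the constant `c` disappears.
  have hdq : ∀ y : ℝ, 2 * c ^ 2 * (ψ₀ * ψ₁) * y / a = 2 * ψ₁ / ψ₀ * y := by
    intro y; rw [haψ]; field_simp
  have hE1 : 1 ≤ E ^ 2 := by linarith [mul_nonneg ha.le (sq_nonneg P)]
  have hE1' : 1 ≤ E := by nlinarith
  -- By the constraint, `P` is controlled by `E` itself, so no bound on `P` through `K` is needed
  -- here.
  have hsP : s * |P| ≤ E := by
    refine abs_le_of_sq_le_sq' ?_ hpos.le |>.2
    rw [mul_pow, sq_abs, hsq]; linarith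
  have t1 : 2 * c ^ 2 * (ψ₀ * ψ₁) * D / (2 * a) * (1 + E ^ 2) ≤
      24 * s * E ^ 2 / (R * ψ₀) := by
    have e1 : 2 * c ^ 2 * (ψ₀ * ψ₁) * D / (2 * a) = ψ₁ / ψ₀ * D := by
      rw [mul_comm 2 a, ← div_div, hdq]; ring
    have e2 : ψ₁ / ψ₀ * D ≤ 4 / R ^ 2 / ψ₀ * (s * (3 * R)) := by
      refine (le_abs_self _).trans ?_
      rw [abs_mul, abs_div, abs_of_pos hψ0]
      gcongr
    rw [e1]
    calc ψ₁ / ψ₀ * D * (1 + E ^ 2)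
        ≤ 4 / R ^ 2 / ψ₀ * (s * (3 * R)) * (1 + E ^ 2) := by gcongr
      _ ≤ 4 / R ^ 2 / ψ₀ * (s * (3 * R)) * (E ^ 2 + E ^ 2) := by gcongr
      _ = 24 * s * E ^ 2 / (R * ψ₀) := by field_simp; ring
  have t2 : ∑ i, (-(1 / 2) * (2 * c ^ 2 * (ψ₀ * ψ₁) * Hs i +
        2 * c ^ 2 * (ψ₁ * ψ₁ + ψ₀ * ψ₂) * (d i * d i)) +
        (1 / 2 * (2 * c ^ 2 * (ψ₀ * ψ₁) * d i)) ^ 2 / a) ≤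
      s ^ 2 * (12 * n + 72) / (ψ₀ * R ^ 2) := by
    have e1 : ∀ i, -(1 / 2) * (2 * c ^ 2 * (ψ₀ * ψ₁) * Hs i +
        2 * c ^ 2 * (ψ₁ * ψ₁ + ψ₀ * ψ₂) * (d i * d i)) +
        (1 / 2 * (2 * c ^ 2 * (ψ₀ * ψ₁) * d i)) ^ 2 / a ≤
        a / ψ₀ * (12 / R ^ 2) + a / ψ₀ * (8 / R ^ 4) * d i ^ 2 := by
      intro i
      -- The `ψ₁²` terms cancel: the Hessian of the square contributes `-c² ψ₁² d²`, the gradient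
      -- term over `a` contributes `+c² ψ₁² d²`. Otherwise a factor `ψ₀⁻²` would survive.
      have f2 : -(1 / 2) * (2 * c ^ 2 * (ψ₀ * ψ₁) * Hs i +
          2 * c ^ 2 * (ψ₁ * ψ₁ + ψ₀ * ψ₂) * (d i * d i)) +
          (1 / 2 * (2 * c ^ 2 * (ψ₀ * ψ₁) * d i)) ^ 2 / a =
          a / ψ₀ * (-ψ₁ * Hs i) + a / ψ₀ * (-ψ₂) * d i ^ 2 := by
        rw [haψ]; field_simp; ring
      rw [f2]
      have f3 : -ψ₁ * Hs i ≤ 12 / R ^ 2 := by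
        calc -ψ₁ * Hs i ≤ -ψ₁ * 3 := mul_le_mul_of_nonneg_left (hHs i) (by linarith)
          _ ≤ 4 / R ^ 2 * 3 := by gcongr; linarith
          _ = 12 / R ^ 2 := by ring
      have f4 : -ψ₂ ≤ 8 / R ^ 4 := by linarith
      gcongr
    refine (Finset.sum_le_sum fun i _ => e1 i).trans ?_
    rw [Finset.sum_add_distrib, ← Finset.mul_sum (f := fun i => d i ^ 2), Finset.sum_const,
      Finset.card_univ, Fintype.card_fin, nsmul_eq_mul]
    calc (n : ℝ) * (a / ψ₀ * (12 / R ^ 2)) + a / ψ₀ * (8 / R ^ 4) * ∑ i, d i ^ 2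
        ≤ (n : ℝ) * (a / ψ₀ * (12 / R ^ 2)) + a / ψ₀ * (8 / R ^ 4) * (3 * R) ^ 2 := by gcongr
      _ = s ^ 2 * (12 * n + 72) / (ψ₀ * R ^ 2) := by rw [hsq]; field_simp; ring
  have t3 : -Rc ≤ s ^ 2 / (100 * (n + 1) * R ^ 2) := by
    have : s ^ 2 / (100 * (n + 1) * R ^ 2) = 1 / (100 * (n + 1) * R ^ 2) * a := by
      rw [hsq]; ring
    rw [this]; linarith
  have t4 : |∑ i, N i| ≤ n * s * k₁ := by
    refine (Finset.abs_sum_le_sum_abs _ _).trans ((Finset.sum_le_sum fun i _ => hN i).trans ?_)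
    rw [Finset.sum_const, Finset.card_univ, Fintype.card_fin, nsmul_eq_mul, mul_assoc]
  have t5 : |∑ i, 2 * c ^ 2 * (ψ₀ * ψ₁) * d i / a * κ i| ≤ 24 * n * s * k₀ / (R * ψ₀) := by
    have e1 : ∀ i, |2 * c ^ 2 * (ψ₀ * ψ₁) * d i / a * κ i| ≤ 24 * s * k₀ / (R * ψ₀) := by
      intro i
      rw [hdq, abs_mul, abs_mul, abs_div, abs_mul, abs_of_pos hψ0, abs_two]
      calc 2 * |ψ₁| / ψ₀ * |d i| * |κ i|
          ≤ 2 * (4 / R ^ 2) / ψ₀ * (3 * R) * (s * k₀) := by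
            have h1 := hd i
            have h2 := hκ i
            gcongr
        _ = 24 * s * k₀ / (R * ψ₀) := by field_simp; ring
    refine (Finset.abs_sum_le_sum_abs _ _).trans ((Finset.sum_le_sum fun i _ => e1 i).trans ?_)
    rw [Finset.sum_const, Finset.card_univ, Fintype.card_fin, nsmul_eq_mul]
    exact le_of_eq (by ring)
  have t6 : ∀ N₁ N₂ : ℝ, |N₁| ≤ n * s * k₁ → |N₂| ≤ 24 * n * s * k₀ / (R * ψ₀) →
      -(a * P * (N₁ + N₂)) ≤ s * E * (n * s * k₁ + 24 * n * s * k₀ / (R * ψ₀)) := by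
    intro N₁ N₂ h1 h2
    refine (neg_le_abs _).trans ?_
    rw [abs_mul, abs_mul, abs_of_pos ha, ← hsq]
    calc s ^ 2 * |P| * |N₁ + N₂| = s * (s * |P|) * |N₁ + N₂| := by ring
      _ ≤ s * E * (n * s * k₁ + 24 * n * s * k₀ / (R * ψ₀)) := by
        gcongr
        exact (abs_add_le _ _).trans (add_le_add h1 h2)
  refine le_of_cube_le hn hs0 hE1' hR hψ0 hψ1 hk₀ hk₁ (key.trans ?_)
  rw [sub_eq_add_neg]
  exact add_le_add (add_le_add t1 (mul_le_mul_of_nonneg_left (add_le_add t2 t3) hpos.le))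
    (t6 _ _ t4 t5)

theorem contDiffAt_comp_real {E : Type*} [NormedAddCommGroup E] [NormedSpace ℝ E] {q : ℝ → ℝ}
    {p : E → ℝ} {x : E} (hq : ContDiff ℝ 2 q) (hp : ContDiffAt ℝ 2 p x) :
    ContDiffAt ℝ 2 (fun y => q (p y)) x := hq.contDiffAt.comp x hp

theorem fderiv_comp_real {E : Type*} [NormedAddCommGroup E] [NormedSpace ℝ E] {q : ℝ → ℝ}
    {p : E → ℝ} {x : E} (hq : Differentiable ℝ q) (hp : DifferentiableAt ℝ p x) :
    fderiv ℝ (fun y => q (p y)) x = deriv q (p x) • fderiv ℝ p x :=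
  ((hq (p x)).hasDerivAt.comp_hasFDerivAt x hp.hasFDerivAt).fderiv

theorem hessBil_comp_real {E : Type*} [NormedAddCommGroup E] [NormedSpace ℝ E]
    {Γ : E → E →L[ℝ] E →L[ℝ] E} {q : ℝ → ℝ} {p : E → ℝ} {x : E} (hq : ContDiff ℝ 2 q)
    (hp : ContDiffAt ℝ 2 p x) (v w : E) :
    hessBil Γ (fun y => q (p y)) x v w = deriv q (p x) * hessBil Γ p x v w +
      deriv (deriv q) (p x) * (fderiv ℝ p x v * fderiv ℝ p x w) := by
  have hq1 : Differentiable ℝ q := hq.differentiable (by norm_num)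
  have hp1 : DifferentiableAt ℝ p x := hp.differentiableAt (by norm_num)
  have hdq : Differentiable ℝ (deriv q) :=
    ((contDiff_succ_iff_deriv (n := 1)).1 hq).2.2.differentiable (by norm_num)
  have hdp : DifferentiableAt ℝ (fderiv ℝ p) x :=
    (hp.fderiv_right (m := 1) (by norm_num)).differentiableAt (by norm_num)
  have h1 : fderiv ℝ (fun y => q (p y)) =ᶠ[𝓝 x] fun y => deriv q (p y) • fderiv ℝ p y := by
    filter_upwards [hp.eventually (by simp)] with y hy
    exact fderiv_comp_real hq1 (hy.differentiableAt (by norm_num))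
  have h2 : fderiv ℝ (fun y => deriv q (p y) • fderiv ℝ p y) x =
      deriv q (p x) • fderiv ℝ (fderiv ℝ p) x +
        (fderiv ℝ (fun y => deriv q (p y)) x).smulRight (fderiv ℝ p x) :=
    fderiv_fun_smul ((hdq (p x)).comp x hp1) hdp
  unfold hessBil
  rw [h1.fderiv_eq, h2, fderiv_comp_real hdq hp1, fderiv_comp_real hq1 hp1]
  simp
  ring

/-- The orthonormal frame consisting of the tangent vectors and the unit normal. -/
def adaptedFrame {Z : Type*} [NormedAddCommGroup Z] [NormedSpace ℝ Z]
    (B : Eucl (n + 1) → Eucl (n + 1) →L[ℝ] Eucl (n + 1) →L[ℝ] ℝ)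
    (X : Z → Eucl (n + 1)) (β : Fin n → Z) (τ z : Z) : Fin (n + 1) → Eucl (n + 1) :=
  Fin.snoc (fun i => dirDeriv X (β i) z) ((Real.sqrt (speedSq B X τ z))⁻¹ • dirDeriv X τ z)

/-! ### The estimate in the adapted orthonormal frame. -/

variable {Z : Type*} [NormedAddCommGroup Z] [NormedSpace ℝ Z]
  {G K : Eucl (n + 1) → Matrix (Fin (n + 1)) (Fin (n + 1)) ℝ}
  {X : Z → Eucl (n + 1)} {β : Fin n → Z} {τ z : Z}

namespace IsNormalMotion

theorem isOrthoFrame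
    (h : IsNormalMotion (fun x => bilin (G x)) (chris G) X β τ z)
    (honb : gram (fun x => bilin (G x)) X β z = 1)
    (ha : 0 < speedSq (fun x => bilin (G x)) X τ z) :
    IsOrthoFrame (G (X z)) (adaptedFrame (fun x => bilin (G x)) X β τ z) := by
  have h1 : ∀ i j, bilin (G (X z)) (dirDeriv X (β i) z) (dirDeriv X (β j) z) =
      (1 : Matrix (Fin n) (Fin n) ℝ) i j := fun i j => by rw [← honb]; rfl
  have h2 : ∀ i, bilin (G (X z)) (dirDeriv X (β i) z) (dirDeriv X τ z) = 0 :=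
    h.orth.self_of_nhds
  have h3 : ∀ i, bilin (G (X z)) (dirDeriv X τ z) (dirDeriv X (β i) z) = 0 := fun i => by
    rw [← h2 i]; exact h.symm_self _ _
  have h4 : bilin (G (X z)) (dirDeriv X τ z) (dirDeriv X τ z) =
    Real.sqrt (speedSq (fun x => bilin (G x)) X τ z) ^ 2 := (Real.sq_sqrt ha.le).symm
  have h5 := (Real.sqrt_pos.2 ha).ne'
  intro k l
  refine Fin.lastCases ?_ (fun i => ?_) k <;> refine Fin.lastCases ?_ (fun j => ?_) l
  · simp only [adaptedFrame, Fin.snoc_last, map_smul, _root_.smul_apply, h4, smul_eq_mul,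
      Matrix.one_apply_eq]
    field_simp
  · simp [adaptedFrame, h3, (Fin.castSucc_lt_last j).ne']
  · simp [adaptedFrame, h2, (Fin.castSucc_lt_last i).ne]
  · simp [adaptedFrame, h1, Matrix.one_apply]

theorem spans
    (h : IsNormalMotion (fun x => bilin (G x)) (chris G) X β τ z)
    (honb : gram (fun x => bilin (G x)) X β z = 1)
    (ha : 0 < speedSq (fun x => bilin (G x)) X τ z) :
    Spans (fun x => bilin (G x)) X β τ z := by
  intro Y
  conv_lhs => rw [← (h.isOrthoFrame honb ha).sum_smul Y]
  have hs : ∀ v, bilin (G (X z)) v Y = bilin (G (X z)) Y v := fun v => h.symm_self _ _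
  have h5 := Real.sq_sqrt ha.le
  simp only [hs]
  rw [Fin.sum_univ_castSucc]
  simp only [adaptedFrame, Fin.snoc_castSucc, Fin.snoc_last, map_smul, smul_smul, smul_eq_mul]
  congr 2
  set a := speedSq (fun x => bilin (G x)) X τ z
  have h6 := (Real.sqrt_pos.2 ha).ne'
  conv_rhs => rw [← h5]
  field_simp

/-- The sum over tangent directions is already the full trace, since the missing normal direction
contributes `R(T, T) T = 0`. -/
theorem sum_curv
    (h : IsNormalMotion (fun x => bilin (G x)) (chris G) X β τ z)
    (honb : gram (fun x => bilin (G x)) X β z = 1)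
    (ha : 0 < speedSq (fun x => bilin (G x)) X τ z)
    (hG : ∀ a b, ContDiffAt ℝ 2 (fun y => G y a b) (X z)) :
    ∑ i, bilin (G (X z)) (curv (chris G) (X z) (dirDeriv X τ z) (dirDeriv X (β i) z)
        (dirDeriv X τ z)) (dirDeriv X (β i) z) =
      -∑ a, ∑ b, ricciCoeff G (X z) a b * dirDeriv X τ z a * dirDeriv X τ z b := by
  have ho := h.isOrthoFrame honb ha
  set T := dirDeriv X τ z
  set x := X z
  rw [sum_ricciCoeff hG ho.det_ne_zero]
  let L : Eucl (n + 1) →L[ℝ] Eucl (n + 1) := ((fderiv ℝ (chris G) x).flip T).flip T -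
    (fderiv ℝ (chris G) x T).flip T + (chris G x).flip (chris G x T T) -
    (chris G x T).comp ((chris G x).flip T)
  have hL : ∀ v, L v = curv (chris G) x v T T := fun v => rfl
  have h1 := ho.sum_trace L
  simp only [hL] at h1
  rw [h1, Fin.sum_univ_castSucc]
  simp only [adaptedFrame, Fin.snoc_castSucc, Fin.snoc_last]
  have h2 : curv (chris G) x ((Real.sqrt (speedSq (fun x => bilin (G x)) X τ z))⁻¹ • T) T T =
      0 := by
    rw [← hL, map_smul, hL, curv_self, smul_zero]
  change _ = -(∑ i, bilin (G x) (dirDeriv X (β i) z) (curv (chris G) x (dirDeriv X (β i) z) T T) +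
    bilin (G x) _ (curv (chris G) x
      ((Real.sqrt (speedSq (fun x => bilin (G x)) X τ z))⁻¹ • T) T T))
  rw [h2, map_zero, add_zero, ← Finset.sum_neg_distrib]
  refine Finset.sum_congr rfl fun i _ => ?_
  rw [curv_swap, map_neg, _root_.neg_apply]
  congr 1
  exact h.symm_self _ _

/-- The gradient estimate at a point where the squared speed is touched from below by
`(c ψ(p))²`. -/
theorem div_speed_le (hn : 1 ≤ n)
    (h : IsNormalMotion (fun x => bilin (G x)) (chris G) X β τ z)
    (honb : gram (fun x => bilin (G x)) X β z = 1)
    (ha : 0 < speedSq (fun x => bilin (G x)) X τ z)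
    (hG : ∀ a b, ContDiffAt ℝ 2 (fun y => G y a b) (X z))
    (hK : ∀ a b, ContDiffAt ℝ 2 (fun y => K y a b) (X z))
    (hKsymm : ∀ a b, K (X z) a b = K (X z) b a)
    {p : Eucl (n + 1) → ℝ} (hp : ContDiffAt ℝ 2 p (X z)) {ψ : ℝ → ℝ} (hψ : ContDiff ℝ 2 ψ)
    {c R : ℝ} (hR : 0 < R) (hc : 0 < c)
    (hψ0 : 0 < ψ (p (X z))) (hψ1 : ψ (p (X z)) ≤ 1)
    (hψ' : deriv ψ (p (X z)) ≤ 0) (hψ'' : -(4 / R ^ 2) ≤ deriv ψ (p (X z)))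
    (hψ2 : -(8 / R ^ 4) ≤ deriv (deriv ψ) (p (X z)))
    (h0 : (c * ψ (p (X z))) ^ 2 = speedSq (fun x => bilin (G x)) X τ z)
    (hβ : ∀ i, ∀ᶠ r in 𝓝 (0 : ℝ), (c * ψ (p (X (z + r • β i)))) ^ 2 ≤
      speedSq (fun x => bilin (G x)) X τ (z + r • β i))
    (hτ : ∀ᶠ r in 𝓝[≤] (0 : ℝ), (c * ψ (p (X (z + r • τ)))) ^ 2 ≤
      speedSq (fun x => bilin (G x)) X τ (z + r • τ))
    (heq : ∀ᶠ r in 𝓝 (0 : ℝ), expansion (fun x => bilin (G x)) X β τ (z + r • τ) ^ 2 -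
      speedSq (fun x => bilin (G x)) X τ (z + r • τ) *
        hyperTrace (fun x => bilin (G x)) (fun x => bilin (K x)) X β (z + r • τ) ^ 2 = 1)
    (hpos : 0 < expansion (fun x => bilin (G x)) X β τ z)
    (hRic : -(1 / (100 * (n + 1) * R ^ 2)) * speedSq (fun x => bilin (G x)) X τ z ≤
      ∑ a, ∑ b, ricciCoeff G (X z) a b * dirDeriv X τ z a * dirDeriv X τ z b)
    (hgrad : Real.sqrt (∑ a, ∑ b, (G (X z))⁻¹ a b * pd a p (X z) * pd b p (X z)) ≤ 3 * R)
    (hhess : ∀ v : Eucl (n + 1), ∑ a, ∑ b, hessianCoeff G p (X z) a b * v a * v b ≤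
      3 * bilin (G (X z)) v v) :
    ψ (p (X z)) / Real.sqrt (speedSq (fun x => bilin (G x)) X τ z) ≤
      100 * n * (1 / R +
        Real.sqrt (∑ a, ∑ b, ∑ a', ∑ b', (G (X z))⁻¹ a a' * (G (X z))⁻¹ b b' *
          K (X z) a b * K (X z) a' b') +
        Real.sqrt (Real.sqrt (∑ c, ∑ a, ∑ b, ∑ c', ∑ a', ∑ b',
          (G (X z))⁻¹ c c' * (G (X z))⁻¹ a a' * (G (X z))⁻¹ b b' *
          covDerivCoeff G K (X z) c a b * covDerivCoeff G K (X z) c' a' b'))) := by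
  have ho := h.isOrthoFrame honb ha
  have hpd : ∀ v, fderiv ℝ p (X z) v = ∑ a, v a * pd a p (X z) := fun v =>
    clm_apply_eq_sum (fderiv ℝ p (X z)) v
  have hψd : Differentiable ℝ ψ := hψ.differentiable (by norm_num)
  set q : ℝ → ℝ := fun r => (c * ψ r) ^ 2 with hq
  have hqc : ContDiff ℝ 2 q := (contDiff_const.mul hψ).pow 2
  have hdψ : Differentiable ℝ (deriv ψ) :=
    ((contDiff_succ_iff_deriv (n := 1)).1 hψ).2.2.differentiable (by norm_num)
  have hq1 : deriv q = fun r => 2 * c ^ 2 * (ψ r * deriv ψ r) := by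
    funext r
    rw [(((hψd r).hasDerivAt.const_mul c).fun_pow 2).deriv]
    push_cast; ring
  have hq2 : ∀ r, deriv (deriv q) r =
      2 * c ^ 2 * (deriv ψ r * deriv ψ r + ψ r * deriv (deriv ψ) r) := by
    intro r
    rw [hq1]
    exact (((hψd r).hasDerivAt.mul (hdψ r).hasDerivAt).const_mul (2 * c ^ 2)).deriv
  have key := h.expansion_cube_le honb (h.spans honb ha) ha
    (K := fun x => bilin (K x)) (STIMCF.contDiffAt_bilin hK) (fun v w => bilin_symm hKsymm v w)
    (θ := fun x => q (p x)) (contDiffAt_comp_real hqc hp) h0 hβ hτ heq hpos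
  rw [fderiv_comp_real (hqc.differentiable (by norm_num)) (hp.differentiableAt (by norm_num)),
    h.sum_curv honb ha hG] at key
  simp only [hessBil_comp_real hqc hp, _root_.smul_apply, smul_eq_mul] at key
  have heq0 := heq.self_of_nhds
  simp only [zero_smul, add_zero] at heq0
  have hsq := Real.sq_sqrt ha.le
  have hs0 := Real.sqrt_pos.2 ha
  set a := speedSq (fun x => bilin (G x)) X τ z with ha_def
  set s := Real.sqrt a with hs_def
  set k₀ := Real.sqrt (∑ a, ∑ b, ∑ a', ∑ b', (G (X z))⁻¹ a a' * (G (X z))⁻¹ b b' *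
          K (X z) a b * K (X z) a' b') with hk₀
  set k₁ := Real.sqrt (∑ c, ∑ a, ∑ b, ∑ c', ∑ a', ∑ b',
          (G (X z))⁻¹ c c' * (G (X z))⁻¹ a a' * (G (X z))⁻¹ b b' *
          covDerivCoeff G K (X z) c a b * covDerivCoeff G K (X z) c' a' b') with hk₁
  set E := expansion (fun x => bilin (G x)) X β τ z with hE
  set P := hyperTrace (fun x => bilin (G x)) (fun x => bilin (K x)) X β z with hP
  set T := dirDeriv X τ z with hT
  set ψ₀ := ψ (p (X z)) with hψ₀
  set ψ₁ := deriv ψ (p (X z)) with hψ₁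
  set ψ₂ := deriv (deriv ψ) (p (X z)) with hψ₂
  set e := adaptedFrame (fun x => bilin (G x)) X β τ z with he
  have hei : ∀ i, dirDeriv X (β i) z = e (Fin.castSucc i) := fun i => by simp [he, adaptedFrame]
  have heT : T = s • e (Fin.last n) := by
    simp [he, adaptedFrame, smul_smul, ← ha_def, ← hs_def, hs0.ne', ← hT]
  have hgsum : ∑ k, fderiv ℝ p (X z) (e k) ^ 2 ≤ (3 * R) ^ 2 := by
    rw [ho.sum_inv] at hgrad
    have h1 := (Real.sqrt_le_left (by positivity)).1 hgrad
    refine le_trans (le_of_eq ?_) h1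
    exact Finset.sum_congr rfl fun k _ => by rw [hpd, sq]
  have hgk : ∀ k, |fderiv ℝ p (X z) (e k)| ≤ 3 * R := fun k =>
    abs_le_of_sq_le_sq ((Finset.single_le_sum (f := fun k => fderiv ℝ p (X z) (e k) ^ 2)
      (fun k _ => sq_nonneg _) (Finset.mem_univ k)).trans hgsum) (by positivity)
  have hgi : ∑ i, fderiv ℝ p (X z) (dirDeriv X (β i) z) ^ 2 ≤ (3 * R) ^ 2 := by
    rw [Fin.sum_univ_castSucc] at hgsum
    simp only [hei]
    linarith [sq_nonneg (fderiv ℝ p (X z) (e (Fin.last n)))]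
  have hgT : |fderiv ℝ p (X z) T| ≤ s * (3 * R) := by
    rw [heT, map_smul, smul_eq_mul, abs_mul, abs_of_pos hs0]
    exact mul_le_mul_of_nonneg_left (hgk _) hs0.le
  have hHs : ∀ i, hessBil (chris G) p (X z) (dirDeriv X (β i) z) (dirDeriv X (β i) z) ≤ 3 := by
    intro i
    rw [hessBil_eq_sum hp]
    refine (hhess _).trans ?_
    rw [hei, ho]; simp
  have hN : ∀ i, |covBil (chris G) (fun x => bilin (K x)) (X z) T (dirDeriv X (β i) z)
      (dirDeriv X (β i) z)| ≤ s * k₁ := by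
    intro i
    have e2 : covBil (chris G) (fun x => bilin (K x)) (X z) T (dirDeriv X (β i) z)
        (dirDeriv X (β i) z) = s * ∑ c, ∑ a, ∑ b, e (Fin.last n) c * e (Fin.castSucc i) a *
          e (Fin.castSucc i) b * covDerivCoeff G K (X z) c a b := by
      rw [covBil_eq_sum, hei, heT]
      simp only [Finset.mul_sum, covBil_basisVec fun a b => (hK a b).of_le (by norm_num),
        PiLp.smul_apply, smul_eq_mul]
      refine Finset.sum_congr rfl fun c _ => Finset.sum_congr rfl fun a _ =>
        Finset.sum_congr rfl fun b _ => by ring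
    rw [e2, abs_mul, abs_of_pos hs0]
    exact mul_le_mul_of_nonneg_left (ho.abs_trilin_le _ _ _ _) hs0.le
  have hκ : ∀ i, |bilin (K (X z)) T (dirDeriv X (β i) z)| ≤ s * k₀ := by
    intro i
    rw [heT, hei, map_smul, _root_.smul_apply, smul_eq_mul, abs_mul, abs_of_pos hs0]
    exact mul_le_mul_of_nonneg_left (ho.abs_bilin_le _ _ _) hs0.le
  have hdi : ∀ i, |fderiv ℝ p (X z) (dirDeriv X (β i) z)| ≤ 3 * R := fun i => by
    rw [hei]; exact hgk _
  simp only [hq2] at key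
  simp only [hq1] at key
  exact div_le_of_cube_le hn ha hs0 hsq hR hc (Real.sqrt_nonneg _) (Real.sqrt_nonneg _) hpos
    heq0 hψ0 hψ1 hψ' hψ'' hψ2 (by rw [← h0]; ring) hgT hdi hgi hHs hRic hN hκ key

end IsNormalMotion

end CoordinateEstimate

end

/-! ### Tensor fields in charts -/

section Charts

open Filter Topology

variable {m : ℕ} {M : Type*} [TopologicalSpace M] [ChartedSpace (Eucl m) M]

/-- The components of a tangent vector in the chart at `y`, as a vector of the model space. -/
def chartVec (y : M) {z : M} (v : TangentSpace (𝓡 m) z) : Eucl m :=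
  mfderiv (𝓡 m) 𝓘(ℝ, Eucl m) (extChartAt (𝓡 m) y) z v

theorem chartVec_smul (y : M) {z : M} (c : ℝ) (v : TangentSpace (𝓡 m) z) :
    chartVec y (c • v) = c • chartVec y v :=
  (mfderiv (𝓡 m) 𝓘(ℝ, Eucl m) (extChartAt (𝓡 m) y) z).map_smul c v

variable [IsManifold (𝓡 m) ∞ M]

theorem mfderiv_extChartAt_symm_chartVec (y : M) {u : Eucl m}
    (hu : u ∈ (extChartAt (𝓡 m) y).target)
    (v : TangentSpace (𝓡 m) ((extChartAt (𝓡 m) y).symm u)) :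
    mfderiv 𝓘(ℝ, Eucl m) (𝓡 m) (extChartAt (𝓡 m) y).symm u (chartVec y v) = v := by
  have : IsManifold (𝓡 m) 1 M := IsManifold.of_le (n := ∞) (by norm_num)
  have h := mfderivWithin_extChartAt_symm_comp_mfderiv_extChartAt (I := 𝓡 m) (x := y) hu
  rw [modelWithCornersSelf_coe, range_id, mfderivWithin_univ] at h
  exact congrArg (fun L => L v) h

theorem chartVec_mfderiv_extChartAt_symm (y : M) {u : Eucl m}
    (hu : u ∈ (extChartAt (𝓡 m) y).target) (w : Eucl m) :
    chartVec y (mfderiv 𝓘(ℝ, Eucl m) (𝓡 m) (extChartAt (𝓡 m) y).symm u w) = w := by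
  have : IsManifold (𝓡 m) 1 M := IsManifold.of_le (n := ∞) (by norm_num)
  have h := mfderiv_extChartAt_comp_mfderivWithin_extChartAt_symm (I := 𝓡 m) (x := y) hu
  rw [modelWithCornersSelf_coe, range_id, mfderivWithin_univ] at h
  exact congrArg (fun L => L w) h

theorem sum_frame (y : M) {u : Eucl m} (hu : u ∈ (extChartAt (𝓡 m) y).target)
    (v : TangentSpace (𝓡 m) ((extChartAt (𝓡 m) y).symm u)) :
    ∑ a, chartVec y v a • frame y u a = v := by
  conv_rhs => rw [← mfderiv_extChartAt_symm_chartVec y hu v]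
  exact (clm_apply_eq_sum (W := TangentSpace (𝓡 m) ((extChartAt (𝓡 m) y).symm u))
    (mfderiv 𝓘(ℝ, Eucl m) (𝓡 m) (extChartAt (𝓡 m) y).symm u) (chartVec y v)).symm

theorem apply_eq_bilin (T : ∀ y : M, TangentSpace (𝓡 m) y →L[ℝ] TangentSpace (𝓡 m) y →L[ℝ] ℝ)
    (y : M) {z : M} (hz : z ∈ (extChartAt (𝓡 m) y).source) (v w : TangentSpace (𝓡 m) z) :
    T z v w = bilin (tensorCoeff T y (extChartAt (𝓡 m) y z)) (chartVec y v) (chartVec y w) := by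
  obtain ⟨u, hu, rfl⟩ : ∃ u ∈ (extChartAt (𝓡 m) y).target, (extChartAt (𝓡 m) y).symm u = z :=
    ⟨_, (extChartAt (𝓡 m) y).map_source hz, (extChartAt (𝓡 m) y).left_inv hz⟩
  rw [(extChartAt (𝓡 m) y).right_inv hu, bilin_apply]
  conv_lhs => rw [← sum_frame y hu v]
  rw [map_sum, _root_.sum_apply]
  refine Finset.sum_congr rfl fun a _ => ?_
  rw [map_smul, _root_.smul_apply]
  conv_lhs => rw [← sum_frame y hu w]
  rw [map_sum, Finset.smul_sum]
  refine Finset.sum_congr rfl fun b _ => ?_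
  rw [map_smul]
  simp only [tensorCoeff, Matrix.of_apply, smul_eq_mul]
  ring

theorem contMDiffOn_frame (y : M) (a : Fin m) :
    ContMDiffOn 𝓘(ℝ, Eucl m) (𝓡 m).tangent ∞
      (fun u => (TotalSpace.mk' (Eucl m) ((extChartAt (𝓡 m) y).symm u) (frame y u a) :
        TangentBundle (𝓡 m) M)) (extChartAt (𝓡 m) y).target := by
  have : IsManifold (𝓡 m) 1 M := IsManifold.of_le (n := ∞) (by norm_num)
  have ho : IsOpen (extChartAt (𝓡 m) y).target := isOpen_extChartAt_target y
  have h1 : ContMDiffOn 𝓘(ℝ, Eucl m) (𝓡 m) ∞ (extChartAt (𝓡 m) y).symm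
      (extChartAt (𝓡 m) y).target := contMDiffOn_extChartAt_symm y
  have h2 := h1.contMDiffOn_tangentMapWithin (m := ∞) (by simp) ho.uniqueMDiffOn
  have h3 : ContMDiff 𝓘(ℝ, Eucl m) 𝓘(ℝ, Eucl m).tangent ∞
      (fun u : Eucl m => (TotalSpace.mk' (Eucl m) u (basisVec a) :
        TangentBundle 𝓘(ℝ, Eucl m) (Eucl m))) :=
    contMDiff_vectorSpace_iff_contDiff (V := fun _ => basisVec a) |>.2 contDiff_const
  have h4 := h2.comp h3.contMDiffOn (s := (extChartAt (𝓡 m) y).target) (fun u hu => hu)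
  refine h4.congr fun u hu => ?_
  simp only [Function.comp_def, tangentMapWithin, frame]
  rw [mfderivWithin_of_isOpen ho hu]

theorem contDiffAt_tensorCoeff
    {T : ∀ y : M, TangentSpace (𝓡 m) y →L[ℝ] TangentSpace (𝓡 m) y →L[ℝ] ℝ}
    (hT : ContMDiff (𝓡 m) ((𝓡 m).prod 𝓘(ℝ, Eucl m →L[ℝ] Eucl m →L[ℝ] ℝ)) ∞
      (fun y => TotalSpace.mk' (Eucl m →L[ℝ] Eucl m →L[ℝ] ℝ) y (T y)))
    (y : M) {u : Eucl m} (hu : u ∈ (extChartAt (𝓡 m) y).target) (a b : Fin m) :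
    ContDiffAt ℝ ∞ (fun u => tensorCoeff T y u a b) u := by
  have ho : IsOpen (extChartAt (𝓡 m) y).target := isOpen_extChartAt_target y
  have h1 : ContMDiffOn 𝓘(ℝ, Eucl m) (𝓡 m) ∞ (extChartAt (𝓡 m) y).symm
      (extChartAt (𝓡 m) y).target := contMDiffOn_extChartAt_symm y
  have h2 : ContMDiffOn 𝓘(ℝ, Eucl m) ((𝓡 m).prod 𝓘(ℝ)) ∞
      (fun u => TotalSpace.mk' ℝ (E := Bundle.Trivial M ℝ) ((extChartAt (𝓡 m) y).symm u)
        (T _ (frame y u a) (frame y u b))) (extChartAt (𝓡 m) y).target := by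
    apply ContMDiffOn.clm_bundle_apply₂ (F₁ := Eucl m) (F₂ := Eucl m)
    · exact hT.comp_contMDiffOn h1
    · exact contMDiffOn_frame y a
    · exact contMDiffOn_frame y b
  have h3 : ContMDiffOn 𝓘(ℝ, Eucl m) 𝓘(ℝ) ∞
      (fun u => T _ (frame y u a) (frame y u b)) (extChartAt (𝓡 m) y).target := by
    intro x hx
    have := h2 x hx
    simp only [contMDiffWithinAt_totalSpace] at this
    exact this.2
  exact (contMDiffOn_iff_contDiffOn.1 h3).contDiffAt (ho.mem_nhds hu)

variable [RiemannianBundle (fun y : M => TangentSpace (𝓡 m) y)]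

omit [IsManifold (𝓡 m) ∞ M] in
theorem metricCoeff_symm (y : M) (u : Eucl m) (a b : Fin m) :
    metricCoeff y u a b = metricCoeff y u b a := by
  simp only [metricCoeff, Matrix.of_apply]
  exact real_inner_comm _ _

variable [IsContMDiffRiemannianBundle (𝓡 m) ∞ (Eucl m) (fun y : M => TangentSpace (𝓡 m) y)]

theorem contDiffAt_metricCoeff (y : M) {u : Eucl m} (hu : u ∈ (extChartAt (𝓡 m) y).target)
    (a b : Fin m) : ContDiffAt ℝ ∞ (fun u => metricCoeff y u a b) u := by
  obtain ⟨g, hg, hgi⟩ := IsContMDiffRiemannianBundle.exists_contMDiff (IB := 𝓡 m) (n := ∞)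
    (F := Eucl m) (E := fun y : M => TangentSpace (𝓡 m) y)
  have h := contDiffAt_tensorCoeff hg y hu a b
  have h1 : (fun u => metricCoeff y u a b) = fun u => tensorCoeff g y u a b := by
    funext u
    simp only [metricCoeff, tensorCoeff, Matrix.of_apply]
    exact hgi _ _ _
  rw [h1]; exact h

theorem inner_eq_bilin (y : M) {z : M} (hz : z ∈ (extChartAt (𝓡 m) y).source)
    (v w : TangentSpace (𝓡 m) z) :
    inner ℝ v w = bilin (metricCoeff y (extChartAt (𝓡 m) y z)) (chartVec y v) (chartVec y w) := by
  obtain ⟨g, hg, hgi⟩ := IsContMDiffRiemannianBundle.exists_contMDiff (IB := 𝓡 m) (n := ∞)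
    (F := Eucl m) (E := fun y : M => TangentSpace (𝓡 m) y)
  have h1 : metricCoeff y = tensorCoeff g y := by
    funext u
    ext a b
    simp only [metricCoeff, tensorCoeff, Matrix.of_apply]
    exact hgi _ _ _
  rw [h1, ← apply_eq_bilin g y hz]
  exact hgi _ _ _

/-- A kernel vector of the coefficient matrix would represent a nonzero tangent vector of length
zero. -/
theorem det_metricCoeff_ne_zero (y : M) {u : Eucl m} (hu : u ∈ (extChartAt (𝓡 m) y).target) :
    (metricCoeff y u).det ≠ 0 := by
  intro h0
  obtain ⟨w, hw, hw0⟩ := Matrix.exists_mulVec_eq_zero_iff.2 h0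
  set v : TangentSpace (𝓡 m) ((extChartAt (𝓡 m) y).symm u) :=
    mfderiv 𝓘(ℝ, Eucl m) (𝓡 m) (extChartAt (𝓡 m) y).symm u (WithLp.toLp 2 w : Eucl m) with hv
  have hcv : chartVec y v = WithLp.toLp 2 w := chartVec_mfderiv_extChartAt_symm y hu _
  have h1 := inner_eq_bilin y ((extChartAt (𝓡 m) y).map_target hu) v v
  rw [(extChartAt (𝓡 m) y).right_inv hu, hcv, bilin_apply] at h1
  have h2 : ∑ a, ∑ b, metricCoeff y u a b * w a * w b = 0 := by
    refine Finset.sum_eq_zero fun a _ => ?_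
    have := congrFun hw0 a
    simp only [Matrix.mulVec, dotProduct, Pi.zero_apply] at this
    calc ∑ b, metricCoeff y u a b * w a * w b = w a * ∑ b, metricCoeff y u a b * w b := by
          rw [Finset.mul_sum]; exact Finset.sum_congr rfl fun b _ => by ring
      _ = 0 := by rw [this, mul_zero]
  rw [h2] at h1
  have h3 : v = 0 := inner_self_eq_zero.1 h1
  have h4 : chartVec y v = 0 := by
    rw [h3]; exact (mfderiv (𝓡 m) 𝓘(ℝ, Eucl m) (extChartAt (𝓡 m) y) _).map_zero
  rw [hcv] at h4
  exact hw (by simpa using h4)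

end Charts

/-! ### Maps into the manifold, read in charts -/

section ChartMaps

open Filter Topology

variable {m n : ℕ} {M : Type*} [TopologicalSpace M] [ChartedSpace (Eucl m) M]
  [IsManifold (𝓡 m) ∞ M]
  {Z : Type*} [NormedAddCommGroup Z] [NormedSpace ℝ Z] {f : Z → M} {z : Z}

theorem dirDeriv_chart {y : M} (hf : MDifferentiableAt 𝓘(ℝ, Z) (𝓡 m) f z)
    (hz : f z ∈ (extChartAt (𝓡 m) y).source) (ξ : Z) :
    dirDeriv (fun z => extChartAt (𝓡 m) y (f z)) ξ z =
      chartVec y (mfderiv 𝓘(ℝ, Z) (𝓡 m) f z ξ) := by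
  have : IsManifold (𝓡 m) 1 M := IsManifold.of_le (n := ∞) (by norm_num)
  have h1 : MDifferentiableAt (𝓡 m) 𝓘(ℝ, Eucl m) (extChartAt (𝓡 m) y) (f z) :=
    mdifferentiableAt_extChartAt (by rwa [← extChartAt_source (I := 𝓡 m)])
  have h2 := mfderiv_comp z h1 hf
  rw [mfderiv_eq_fderiv] at h2
  exact congrArg (fun L => L ξ) h2

theorem contDiffAt_chart {y : M} {k : ℕ∞ω} (hk : k ≤ (∞ : ℕ∞ω))
    (hf : ContMDiffAt 𝓘(ℝ, Z) (𝓡 m) ∞ f z)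
    (hz : f z ∈ (extChartAt (𝓡 m) y).source) :
    ContDiffAt ℝ k (fun z => extChartAt (𝓡 m) y (f z)) z := by
  have h1 : ContMDiffAt (𝓡 m) 𝓘(ℝ, Eucl m) ∞ (extChartAt (𝓡 m) y) (f z) :=
    contMDiffAt_extChartAt' (by rwa [← extChartAt_source (I := 𝓡 m)])
  exact (contMDiffAt_iff_contDiffAt.1 (h1.comp z hf)).of_le hk

omit [IsManifold (𝓡 m) ∞ M] in
theorem eventually_chart {y : M} (hf : ∀ᶠ z' in 𝓝 z, ContMDiffAt 𝓘(ℝ, Z) (𝓡 m) ∞ f z')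
    (hz : f z ∈ (extChartAt (𝓡 m) y).source) :
    ∀ᶠ z' in 𝓝 z, MDifferentiableAt 𝓘(ℝ, Z) (𝓡 m) f z' ∧
      f z' ∈ (extChartAt (𝓡 m) y).source := by
  have h1 : ∀ᶠ z' in 𝓝 z, f z' ∈ (extChartAt (𝓡 m) y).source :=
    hf.self_of_nhds.continuousAt.eventually ((isOpen_extChartAt_source y).mem_nhds hz)
  filter_upwards [hf, h1] with z' h2 h3
  exact ⟨h2.mdifferentiableAt (by simp), h3⟩

theorem gram_tensorCoeff
    (T : ∀ y : M, TangentSpace (𝓡 m) y →L[ℝ] TangentSpace (𝓡 m) y →L[ℝ] ℝ) {y : M}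
    (hf : MDifferentiableAt 𝓘(ℝ, Z) (𝓡 m) f z)
    (hz : f z ∈ (extChartAt (𝓡 m) y).source) (β : Fin n → Z) (i j : Fin n) :
    gram (fun x => bilin (tensorCoeff T y x)) (fun z => extChartAt (𝓡 m) y (f z)) β z i j =
      T (f z) (mfderiv 𝓘(ℝ, Z) (𝓡 m) f z (β i)) (mfderiv 𝓘(ℝ, Z) (𝓡 m) f z (β j)) := by
  rw [apply_eq_bilin T y hz, ← dirDeriv_chart hf hz, ← dirDeriv_chart hf hz]
  rfl

variable [RiemannianBundle (fun y : M => TangentSpace (𝓡 m) y)]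
  [IsContMDiffRiemannianBundle (𝓡 m) ∞ (Eucl m) (fun y : M => TangentSpace (𝓡 m) y)]

theorem metric_dirDeriv_chart {y : M} (hf : MDifferentiableAt 𝓘(ℝ, Z) (𝓡 m) f z)
    (hz : f z ∈ (extChartAt (𝓡 m) y).source) (ξ ζ : Z) :
    bilin (metricCoeff y (extChartAt (𝓡 m) y (f z)))
      (dirDeriv (fun z => extChartAt (𝓡 m) y (f z)) ξ z)
      (dirDeriv (fun z => extChartAt (𝓡 m) y (f z)) ζ z) =
      inner ℝ (mfderiv 𝓘(ℝ, Z) (𝓡 m) f z ξ) (mfderiv 𝓘(ℝ, Z) (𝓡 m) f z ζ) := by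
  rw [inner_eq_bilin y hz, dirDeriv_chart hf hz, dirDeriv_chart hf hz]

theorem gram_metricCoeff {y : M} (hf : MDifferentiableAt 𝓘(ℝ, Z) (𝓡 m) f z)
    (hz : f z ∈ (extChartAt (𝓡 m) y).source) (β : Fin n → Z) (i j : Fin n) :
    gram (fun x => bilin (metricCoeff y x)) (fun z => extChartAt (𝓡 m) y (f z)) β z i j =
      inner ℝ (mfderiv 𝓘(ℝ, Z) (𝓡 m) f z (β i)) (mfderiv 𝓘(ℝ, Z) (𝓡 m) f z (β j)) :=
  metric_dirDeriv_chart hf hz _ _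

/-- Smoothness, symmetry and metric compatibility hold in any chart for the Levi-Civita symbols;
only orthogonality is specific to the motion. -/
theorem isNormalMotion_chart {y : M} {β : Fin n → Z} {τ : Z}
    (hf : ∀ᶠ z' in 𝓝 z, ContMDiffAt 𝓘(ℝ, Z) (𝓡 m) ∞ f z')
    (hz : f z ∈ (extChartAt (𝓡 m) y).source)
    (horth : ∀ᶠ z' in 𝓝 z, ∀ i, inner ℝ (mfderiv 𝓘(ℝ, Z) (𝓡 m) f z' (β i))
      (mfderiv 𝓘(ℝ, Z) (𝓡 m) f z' τ) = 0) :
    IsNormalMotion (fun x => bilin (metricCoeff y x)) (chris (metricCoeff y))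
      (fun z => extChartAt (𝓡 m) y (f z)) β τ z := by
  have hxt : extChartAt (𝓡 m) y (f z) ∈ (extChartAt (𝓡 m) y).target :=
    (extChartAt (𝓡 m) y).map_source hz
  have hnt : ∀ᶠ x in 𝓝 (extChartAt (𝓡 m) y (f z)), x ∈ (extChartAt (𝓡 m) y).target :=
    (isOpen_extChartAt_target y).mem_nhds hxt
  have hsymm : ∀ x : Eucl m, ∀ᶠ x' in 𝓝 x, ∀ a b,
      metricCoeff y x' a b = metricCoeff y x' b a :=
    fun x => Eventually.of_forall fun x' => metricCoeff_symm y x'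
  refine ⟨contDiffAt_chart (ENat.LEInfty.out) hf.self_of_nhds hz,
    STIMCF.contDiffAt_bilin fun a b =>
      (contDiffAt_metricCoeff y hxt a b).of_le (ENat.LEInfty.out),
    contDiffAt_chris (k' := 3) (fun a b =>
      (contDiffAt_metricCoeff y hxt a b).of_le (ENat.LEInfty.out))
      (det_metricCoeff_ne_zero y hxt) (by norm_num), ?_, ?_, ?_, ?_⟩
  · exact Eventually.of_forall fun x v w => bilin_symm (metricCoeff_symm y x) v w
  · exact Eventually.of_forall fun x v w => chris_symm (hsymm x) v w
  · filter_upwards [hnt] with x hx u v w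
    exact covBil_metric (fun a b =>
      (contDiffAt_metricCoeff y hx a b).of_le (ENat.LEInfty.out)) (hsymm x)
      (det_metricCoeff_ne_zero y hx) u v w
  · filter_upwards [horth, eventually_chart hf hz] with z' h1 h2 i
    rw [metric_dirDeriv_chart h2.1 h2.2, h1]

theorem gram_chart_congr {y y' : M} (hf : ∀ᶠ z' in 𝓝 z, ContMDiffAt 𝓘(ℝ, Z) (𝓡 m) ∞ f z')
    (hz : f z ∈ (extChartAt (𝓡 m) y).source) (hz' : f z ∈ (extChartAt (𝓡 m) y').source)
    (β : Fin n → Z) :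
    gram (fun x => bilin (metricCoeff y x)) (fun z => extChartAt (𝓡 m) y (f z)) β =ᶠ[𝓝 z]
    gram (fun x => bilin (metricCoeff y' x)) (fun z => extChartAt (𝓡 m) y' (f z)) β := by
  filter_upwards [eventually_chart hf hz, eventually_chart hf hz'] with z' h1 h2
  ext i j
  rw [gram_metricCoeff h1.1 h1.2, gram_metricCoeff h2.1 h2.2]

/-- Mean curvature is defined in the chart at the moving point, whereas time derivatives need one
fixed chart. Invariance holds because the Gram matrices agree near `z`, not just at `z`. -/
theorem expansion_chart_congr {y y' : M}
    (hf : ∀ᶠ z' in 𝓝 z, ContMDiffAt 𝓘(ℝ, Z) (𝓡 m) ∞ f z')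
    (hz : f z ∈ (extChartAt (𝓡 m) y).source) (hz' : f z ∈ (extChartAt (𝓡 m) y').source)
    (β : Fin n → Z) (τ : Z) :
    expansion (fun x => bilin (metricCoeff y x)) (fun z => extChartAt (𝓡 m) y (f z)) β τ z =
    expansion (fun x => bilin (metricCoeff y' x)) (fun z => extChartAt (𝓡 m) y' (f z)) β τ z := by
  have h := gram_chart_congr hf hz hz' β
  unfold expansion
  rw [h.self_of_nhds]
  refine Finset.sum_congr rfl fun i _ => Finset.sum_congr rfl fun j _ => ?_
  rw [(dirDeriv_congr (h.mono fun w hw => by rw [hw]) τ).self_of_nhds]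

theorem hyperTrace_chart_congr {y y' : M}
    (T : ∀ y : M, TangentSpace (𝓡 m) y →L[ℝ] TangentSpace (𝓡 m) y →L[ℝ] ℝ)
    (hf : ∀ᶠ z' in 𝓝 z, ContMDiffAt 𝓘(ℝ, Z) (𝓡 m) ∞ f z')
    (hz : f z ∈ (extChartAt (𝓡 m) y).source) (hz' : f z ∈ (extChartAt (𝓡 m) y').source)
    (β : Fin n → Z) :
    hyperTrace (fun x => bilin (metricCoeff y x)) (fun x => bilin (tensorCoeff T y x))
      (fun z => extChartAt (𝓡 m) y (f z)) β z =
    hyperTrace (fun x => bilin (metricCoeff y' x)) (fun x => bilin (tensorCoeff T y' x))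
      (fun z => extChartAt (𝓡 m) y' (f z)) β z := by
  have h := gram_chart_congr hf hz hz' β
  have hd := hf.self_of_nhds.mdifferentiableAt (by simp)
  unfold hyperTrace
  rw [h.self_of_nhds]
  refine Finset.sum_congr rfl fun i _ => Finset.sum_congr rfl fun j _ => ?_
  rw [gram_tensorCoeff T hd hz, gram_tensorCoeff T hd hz']

end ChartMaps

/-! ### The flow in a chart of the hypersurface -/

section FlowMap

open Filter Topology

variable {n : ℕ} {S M : Type*} [TopologicalSpace S] [ChartedSpace (Eucl n) S]
  [IsManifold (𝓡 n) ∞ S] [TopologicalSpace M] [ChartedSpace (Eucl (n + 1)) M]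
  [RiemannianBundle (fun y : M => TangentSpace (𝓡 (n + 1)) y)]
  {K : ∀ y : M, TangentSpace (𝓡 (n + 1)) y →L[ℝ] TangentSpace (𝓡 (n + 1)) y →L[ℝ] ℝ}
  {T : ℝ} {F : S → ℝ → M} {ν : ∀ q s, TangentSpace (𝓡 (n + 1)) (F q s)}

/-- The flow, as a map of the coordinates of the chart at `q₀` and of time. -/
def flowMap (F : S → ℝ → M) (q₀ : S) (z : Eucl n × ℝ) : M :=
  F ((extChartAt (𝓡 n) q₀).symm z.1) z.2

/-- The spatial coordinate directions. -/
abbrev spaceDir (i : Fin n) : Eucl n × ℝ := (basisVec i, 0)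

/-- The time direction. -/
abbrev timeDir : Eucl n × ℝ := (0, 1)

/-- The space-time mean curvature along the flow. -/
abbrev flowPhi (K : ∀ y : M, TangentSpace (𝓡 (n + 1)) y →L[ℝ] TangentSpace (𝓡 (n + 1)) y →L[ℝ] ℝ)
    (F : S → ℝ → M) (ν : ∀ q s, TangentSpace (𝓡 (n + 1)) (F q s)) (q : S) (s : ℝ) : ℝ :=
  spacetimeMeanCurv (n := n) K (fun q' => F q' s) q (ν q s)

namespace IsSmoothSolution

omit [IsManifold (𝓡 n) ∞ S] in
theorem flowPhi_pos (hF : IsSmoothSolution K T F ν) (q : S) {s : ℝ} (hs : s ∈ Ico 0 T) :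
    0 < flowPhi K F ν q s := Real.sqrt_pos.2 (hF.pos q s hs)

theorem contMDiffAt_flowMap (hF : IsSmoothSolution K T F ν) (q₀ : S) {z : Eucl n × ℝ}
    (hz : z.1 ∈ (extChartAt (𝓡 n) q₀).target) (hs : z.2 ∈ Ioo 0 T) :
    ContMDiffAt 𝓘(ℝ, Eucl n × ℝ) (𝓡 (n + 1)) ∞ (flowMap F q₀) z := by
  have h1 : ContMDiffAt ((𝓡 n).prod 𝓘(ℝ, ℝ)) (𝓡 (n + 1)) ∞ (fun z : S × ℝ => F z.1 z.2)
      ((extChartAt (𝓡 n) q₀).symm z.1, z.2) := by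
    refine hF.smooth.contMDiffAt ?_
    exact prod_mem_nhds univ_mem (Filter.mem_of_superset (Ioo_mem_nhds hs.1 hs.2)
      Ioo_subset_Ico_self)
  have h2 : ContMDiffAt 𝓘(ℝ, Eucl n) (𝓡 n) ∞ (extChartAt (𝓡 n) q₀).symm z.1 :=
    (contMDiffOn_extChartAt_symm q₀).contMDiffAt ((isOpen_extChartAt_target q₀).mem_nhds hz)
  have h3 : ContMDiffAt 𝓘(ℝ, Eucl n × ℝ) 𝓘(ℝ, Eucl n) ∞ (Prod.fst : Eucl n × ℝ → Eucl n) z :=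
    contDiff_fst.contMDiff.contMDiffAt
  have h4 : ContMDiffAt 𝓘(ℝ, Eucl n × ℝ) 𝓘(ℝ, ℝ) ∞ (Prod.snd : Eucl n × ℝ → ℝ) z :=
    contDiff_snd.contMDiff.contMDiffAt
  have h5 : ContMDiffAt 𝓘(ℝ, Eucl n × ℝ) ((𝓡 n).prod 𝓘(ℝ, ℝ)) ∞
      (fun z : Eucl n × ℝ => ((extChartAt (𝓡 n) q₀).symm z.1, z.2)) z :=
    (h2.comp z h3).prodMk h4
  exact h1.comp z h5

theorem eventually_contMDiffAt_flowMap (hF : IsSmoothSolution K T F ν) (q₀ : S)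
    {z : Eucl n × ℝ} (hz : z.1 ∈ (extChartAt (𝓡 n) q₀).target) (hs : z.2 ∈ Ioo 0 T) :
    ∀ᶠ z' in 𝓝 z, ContMDiffAt 𝓘(ℝ, Eucl n × ℝ) (𝓡 (n + 1)) ∞ (flowMap F q₀) z' := by
  have h1 : (extChartAt (𝓡 n) q₀).target ×ˢ Ioo 0 T ∈ 𝓝 z :=
    prod_mem_nhds ((isOpen_extChartAt_target q₀).mem_nhds hz) (isOpen_Ioo.mem_nhds hs)
  filter_upwards [h1] with z' hz' using hF.contMDiffAt_flowMap q₀ hz'.1 hz'.2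

theorem mfderiv_flowMap_space (hF : IsSmoothSolution K T F ν) (q₀ : S) {u : Eucl n} {s : ℝ}
    (hu : u ∈ (extChartAt (𝓡 n) q₀).target) (hs : s ∈ Ioo 0 T) (w : Eucl n) :
    mfderiv 𝓘(ℝ, Eucl n × ℝ) (𝓡 (n + 1)) (flowMap F q₀) (u, s) (w, (0 : ℝ)) =
      mfderiv (𝓡 n) (𝓡 (n + 1)) (fun q => F q s) ((extChartAt (𝓡 n) q₀).symm u)
        (mfderiv 𝓘(ℝ, Eucl n) (𝓡 n) (extChartAt (𝓡 n) q₀).symm u w) := by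
  have h1 : MDifferentiableAt 𝓘(ℝ, Eucl n × ℝ) (𝓡 (n + 1)) (flowMap F q₀) (u, s) :=
    (hF.contMDiffAt_flowMap q₀ (z := (u, s)) hu hs).mdifferentiableAt (by simp)
  have hι : HasFDerivAt (fun u' : Eucl n => (u', s)) (ContinuousLinearMap.inl ℝ (Eucl n) ℝ) u :=
    hasFDerivAt_prodMk_left u s
  have h2 := mfderiv_comp u (I := 𝓘(ℝ, Eucl n)) (f := fun u' : Eucl n => (u', s))
    (g := flowMap F q₀) h1 hι.differentiableAt.mdifferentiableAt
  rw [mfderiv_eq_fderiv, hι.fderiv] at h2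
  have h3 : MDifferentiableAt (𝓡 n) (𝓡 (n + 1)) (fun q => F q s)
      ((extChartAt (𝓡 n) q₀).symm u) := by
    have e1 : ContMDiffAt ((𝓡 n).prod 𝓘(ℝ, ℝ)) (𝓡 (n + 1)) ∞ (fun z : S × ℝ => F z.1 z.2)
        ((extChartAt (𝓡 n) q₀).symm u, s) :=
      hF.smooth.contMDiffAt (prod_mem_nhds univ_mem
        (Filter.mem_of_superset (Ioo_mem_nhds hs.1 hs.2) Ioo_subset_Ico_self))
    have e2 : ContMDiffAt (𝓡 n) ((𝓡 n).prod 𝓘(ℝ, ℝ)) ∞ (fun q : S => (q, s))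
        ((extChartAt (𝓡 n) q₀).symm u) := contMDiffAt_id.prodMk contMDiffAt_const
    exact (ContMDiffAt.comp ((extChartAt (𝓡 n) q₀).symm u) (g := fun z : S × ℝ => F z.1 z.2)
      (f := fun q : S => (q, s)) e1 e2).mdifferentiableAt (by simp)
  have h4 : MDifferentiableAt 𝓘(ℝ, Eucl n) (𝓡 n) (extChartAt (𝓡 n) q₀).symm u :=
    ((contMDiffOn_extChartAt_symm (n := ∞) q₀).contMDiffAt
      ((isOpen_extChartAt_target q₀).mem_nhds hu)).mdifferentiableAt (by simp)
  have h5 := mfderiv_comp u h3 h4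
  exact (congrArg (fun L => L w) h2).symm.trans (congrArg (fun L => L w) h5)

theorem mfderiv_flowMap_time (hF : IsSmoothSolution K T F ν) (q₀ : S) {u : Eucl n} {s : ℝ}
    (hu : u ∈ (extChartAt (𝓡 n) q₀).target) (hs : s ∈ Ioo 0 T) :
    mfderiv 𝓘(ℝ, Eucl n × ℝ) (𝓡 (n + 1)) (flowMap F q₀) (u, s) timeDir =
      (flowPhi K F ν ((extChartAt (𝓡 n) q₀).symm u) s)⁻¹ •
        ν ((extChartAt (𝓡 n) q₀).symm u) s := by
  have h1 : MDifferentiableAt 𝓘(ℝ, Eucl n × ℝ) (𝓡 (n + 1)) (flowMap F q₀) (u, s) :=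
    (hF.contMDiffAt_flowMap q₀ (z := (u, s)) hu hs).mdifferentiableAt (by simp)
  have hι : HasFDerivAt (fun s' : ℝ => (u, s')) (ContinuousLinearMap.inr ℝ (Eucl n) ℝ) s :=
    hasFDerivAt_prodMk_right u s
  have h2 := mfderiv_comp s (I := 𝓘(ℝ, ℝ)) (f := fun s' : ℝ => (u, s'))
    (g := flowMap F q₀) h1 hι.differentiableAt.mdifferentiableAt
  rw [mfderiv_eq_fderiv, hι.fderiv] at h2
  have h3 := hF.flow ((extChartAt (𝓡 n) q₀).symm u) s ⟨hs.1.le, hs.2⟩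
  rw [mfderivWithin_of_mem_nhds (Filter.mem_of_superset (Ioo_mem_nhds hs.1 hs.2)
    Ioo_subset_Ico_self)] at h3
  exact (congrArg (fun L => L (1 : ℝ)) h2).symm.trans h3

theorem inner_flowMap_space_time (hF : IsSmoothSolution K T F ν) (q₀ : S) {u : Eucl n} {s : ℝ}
    (hu : u ∈ (extChartAt (𝓡 n) q₀).target) (hs : s ∈ Ioo 0 T) (w : Eucl n) :
    inner ℝ (mfderiv 𝓘(ℝ, Eucl n × ℝ) (𝓡 (n + 1)) (flowMap F q₀) (u, s) (w, (0 : ℝ)))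
      (mfderiv 𝓘(ℝ, Eucl n × ℝ) (𝓡 (n + 1)) (flowMap F q₀) (u, s) timeDir) = 0 := by
  rw [hF.mfderiv_flowMap_space q₀ hu hs, hF.mfderiv_flowMap_time q₀ hu hs]
  have h := hF.normal ((extChartAt (𝓡 n) q₀).symm u) s ⟨hs.1.le, hs.2⟩
    (mfderiv 𝓘(ℝ, Eucl n) (𝓡 n) (extChartAt (𝓡 n) q₀).symm u w)
  rw [real_inner_comm] at h
  exact (real_inner_smul_right _ _ _).trans (mul_eq_zero_of_right _ h)

theorem inner_flowMap_time (hF : IsSmoothSolution K T F ν) (q₀ : S) {u : Eucl n} {s : ℝ}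
    (hu : u ∈ (extChartAt (𝓡 n) q₀).target) (hs : s ∈ Ioo 0 T) :
    inner ℝ (mfderiv 𝓘(ℝ, Eucl n × ℝ) (𝓡 (n + 1)) (flowMap F q₀) (u, s) timeDir)
      (mfderiv 𝓘(ℝ, Eucl n × ℝ) (𝓡 (n + 1)) (flowMap F q₀) (u, s) timeDir) =
      (flowPhi K F ν ((extChartAt (𝓡 n) q₀).symm u) s ^ 2)⁻¹ := by
  rw [hF.mfderiv_flowMap_time q₀ hu hs]
  have h := hF.unit ((extChartAt (𝓡 n) q₀).symm u) s ⟨hs.1.le, hs.2⟩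
  have h2 := real_inner_smul_left (ν ((extChartAt (𝓡 n) q₀).symm u) s)
    ((flowPhi K F ν ((extChartAt (𝓡 n) q₀).symm u) s)⁻¹ • ν ((extChartAt (𝓡 n) q₀).symm u) s)
    (flowPhi K F ν ((extChartAt (𝓡 n) q₀).symm u) s)⁻¹
  have h3 := real_inner_smul_right (ν ((extChartAt (𝓡 n) q₀).symm u) s)
    (ν ((extChartAt (𝓡 n) q₀).symm u) s) (flowPhi K F ν ((extChartAt (𝓡 n) q₀).symm u) s)⁻¹
  refine h2.trans ?_
  rw [h3, h, mul_one, sq, mul_inv]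

end IsSmoothSolution

end FlowMap

/-! ### The curvature of the evolving hypersurface in terms of the flow map -/

section FlowCurvature

open Filter Topology

theorem pd_slice {n m : ℕ} {X : Eucl n × ℝ → Eucl m} {u : Eucl n} {s : ℝ}
    (hX : DifferentiableAt ℝ X (u, s)) (i : Fin n) (a : Fin m) :
    pd i (fun w => X (w, s) a) u = dirDeriv X (spaceDir i) (u, s) a := by
  have h1 : HasFDerivAt (fun w : Eucl n => (w, s)) (ContinuousLinearMap.inl ℝ (Eucl n) ℝ) u :=
    hasFDerivAt_prodMk_left u s
  have h2 : HasFDerivAt (fun w => X (w, s)) _ u := HasFDerivAt.comp u hX.hasFDerivAt h1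
  have h3 := (EuclideanSpace.proj a : Eucl m →L[ℝ] ℝ).hasFDerivAt.comp u h2
  unfold pd
  exact congrArg (fun L => L (basisVec i)) h3.fderiv

theorem pd_pd_slice {n m : ℕ} {X : Eucl n × ℝ → Eucl m} {u : Eucl n} {s : ℝ}
    (hX : ContDiffAt ℝ 2 X (u, s)) (i j : Fin n) (a : Fin m) :
    pd i (fun w => pd j (fun w => X (w, s) a) w) u =
      dirDeriv (dirDeriv X (spaceDir j)) (spaceDir i) (u, s) a := by
  have h1 : ∀ᶠ w in 𝓝 u, DifferentiableAt ℝ X (w, s) := by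
    have hc : ContinuousAt (fun w : Eucl n => (w, s)) u := by fun_prop
    refine (hc.eventually (hX.eventually (by simp))).mono fun w hw => ?_
    exact hw.differentiableAt (by norm_num)
  have h2 : (fun w => pd j (fun w => X (w, s) a) w) =ᶠ[𝓝 u]
      fun w => dirDeriv X (spaceDir j) (w, s) a := by
    filter_upwards [h1] with w hw using pd_slice hw j a
  rw [← pd_slice (X := dirDeriv X (spaceDir j))
    ((contDiffAt_dirDeriv (k := 1) hX (by norm_num) _).differentiableAt (by norm_num))]
  exact (dirDeriv_congr h2 (basisVec i)).self_of_nhds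

variable {n : ℕ} {S M : Type*} [TopologicalSpace S] [ChartedSpace (Eucl n) S]
  [IsManifold (𝓡 n) ∞ S] [TopologicalSpace M] [ChartedSpace (Eucl (n + 1)) M]
  [IsManifold (𝓡 (n + 1)) ∞ M]
  [RiemannianBundle (fun y : M => TangentSpace (𝓡 (n + 1)) y)]
  [IsContMDiffRiemannianBundle (𝓡 (n + 1)) ∞ (Eucl (n + 1))
    (fun y : M => TangentSpace (𝓡 (n + 1)) y)]
  {K : ∀ y : M, TangentSpace (𝓡 (n + 1)) y →L[ℝ] TangentSpace (𝓡 (n + 1)) y →L[ℝ] ℝ}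
  {T : ℝ} {F : S → ℝ → M} {ν : ∀ q s, TangentSpace (𝓡 (n + 1)) (F q s)}

namespace IsSmoothSolution

theorem isNormalMotion (hF : IsSmoothSolution K T F ν) (q : S) {y : M} {z : Eucl n × ℝ}
    (hz : z.1 ∈ (extChartAt (𝓡 n) q).target) (hs : z.2 ∈ Ioo 0 T)
    (hy : flowMap F q z ∈ (extChartAt (𝓡 (n + 1)) y).source) {β : Fin n → Eucl n × ℝ}
    (hβ : ∀ i, (β i).2 = 0) :
    IsNormalMotion (fun x => bilin (metricCoeff y x)) (chris (metricCoeff y))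
      (fun z => extChartAt (𝓡 (n + 1)) y (flowMap F q z)) β timeDir z := by
  refine isNormalMotion_chart (hF.eventually_contMDiffAt_flowMap q hz hs) hy ?_
  have h1 : (extChartAt (𝓡 n) q).target ×ˢ Ioo 0 T ∈ 𝓝 z :=
    prod_mem_nhds ((isOpen_extChartAt_target q).mem_nhds hz) (isOpen_Ioo.mem_nhds hs)
  filter_upwards [h1] with z' hz' i
  have h2 : β i = ((β i).1, (0 : ℝ)) := Prod.ext rfl (hβ i)
  rw [h2]
  exact hF.inner_flowMap_space_time q (u := z'.1) (s := z'.2) hz'.1 hz'.2 _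

omit [IsContMDiffRiemannianBundle (𝓡 (n + 1)) ∞ (Eucl (n + 1))
  (fun y : M => TangentSpace (𝓡 (n + 1)) y)] in
theorem chartVec_normal (hF : IsSmoothSolution K T F ν) (q : S) {s : ℝ} (hs : s ∈ Ioo 0 T)
    {y : M} (hy : F q s ∈ (extChartAt (𝓡 (n + 1)) y).source) :
    dirDeriv (fun z => extChartAt (𝓡 (n + 1)) y (flowMap F q z)) timeDir
      (extChartAt (𝓡 n) q q, s) = (flowPhi K F ν q s)⁻¹ • chartVec y (ν q s) := by
  have hu := mem_extChartAt_target (I := 𝓡 n) q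
  have h0 : (extChartAt (𝓡 n) q).symm (extChartAt (𝓡 n) q q) = q := extChartAt_to_inv q
  have hy' : flowMap F q (extChartAt (𝓡 n) q q, s) ∈ (extChartAt (𝓡 (n + 1)) y).source := by
    rw [flowMap, h0]; exact hy
  have h1 := (hF.contMDiffAt_flowMap q (z := (extChartAt (𝓡 n) q q, s)) hu hs).mdifferentiableAt
    (by simp)
  rw [dirDeriv_chart h1 hy', hF.mfderiv_flowMap_time q hu hs]
  have key : ∀ q', q' = q → chartVec y ((flowPhi K F ν q' s)⁻¹ • ν q' s) =
      (flowPhi K F ν q s)⁻¹ • chartVec y (ν q s) := by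
    rintro _ rfl
    exact chartVec_smul y _ _
  exact key _ h0

omit [IsContMDiffRiemannianBundle (𝓡 (n + 1)) ∞ (Eucl (n + 1))
  (fun y : M => TangentSpace (𝓡 (n + 1)) y)] in
theorem tangentCoeff_eq (hF : IsSmoothSolution K T F ν) (q : S) {s : ℝ} (hs : s ∈ Ioo 0 T)
    (i : Fin n) (a : Fin (n + 1)) :
    tangentCoeff (fun q' => F q' s) q i a =
      dirDeriv (fun z => extChartAt (𝓡 (n + 1)) (F q s) (flowMap F q z)) (spaceDir i)
        (extChartAt (𝓡 n) q q, s) a := by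
  have hu := mem_extChartAt_target (I := 𝓡 n) q
  have h0 : (extChartAt (𝓡 n) q).symm (extChartAt (𝓡 n) q q) = q := extChartAt_to_inv q
  have hy : flowMap F q (extChartAt (𝓡 n) q q, s) ∈
      (extChartAt (𝓡 (n + 1)) (F q s)).source := by
    rw [flowMap, h0]; exact mem_extChartAt_source _
  exact pd_slice ((contDiffAt_chart (k := 1) ENat.LEInfty.out
    (hF.contMDiffAt_flowMap q (z := (extChartAt (𝓡 n) q q, s)) hu hs) hy).differentiableAt
    (by norm_num)) i a

omit [IsContMDiffRiemannianBundle (𝓡 (n + 1)) ∞ (Eucl (n + 1))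
  (fun y : M => TangentSpace (𝓡 (n + 1)) y)] in
theorem restrict_eq (hF : IsSmoothSolution K T F ν) (q : S) {s : ℝ} (hs : s ∈ Ioo 0 T)
    (A : Eucl (n + 1) → Matrix (Fin (n + 1)) (Fin (n + 1)) ℝ) :
    restrict (n := n) (fun q' => F q' s) q
      (A (extChartAt (𝓡 (n + 1)) (F q s) (F q s))) =
    gram (fun x => bilin (A x)) (fun z => extChartAt (𝓡 (n + 1)) (F q s) (flowMap F q z)) spaceDir
      (extChartAt (𝓡 n) q q, s) := by
  have h0 : (extChartAt (𝓡 n) q).symm (extChartAt (𝓡 n) q q) = q := extChartAt_to_inv q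
  ext i j
  simp only [restrict, Matrix.of_apply, gram, bilin_apply, hF.tangentCoeff_eq q hs, flowMap, h0]

/-- In coordinates `ν` is `Φ` times the velocity, and pairing the velocity with `-∇_i ∂_j F` is half
the time derivative of the induced metric. -/
theorem secondFundForm_eq (hF : IsSmoothSolution K T F ν) (q : S) {s : ℝ} (hs : s ∈ Ioo 0 T)
    (i j : Fin n) :
    secondFundForm (n := n) (fun q' => F q' s) q (ν q s) i j =
      flowPhi K F ν q s * (1 / 2 * dirDeriv (fun z =>
        gram (fun x => bilin (metricCoeff (F q s) x))
          (fun z => extChartAt (𝓡 (n + 1)) (F q s) (flowMap F q z)) spaceDir z i j) timeDir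
        (extChartAt (𝓡 n) q q, s)) := by
  have hu := mem_extChartAt_target (I := 𝓡 n) q
  have h0 : (extChartAt (𝓡 n) q).symm (extChartAt (𝓡 n) q q) = q := extChartAt_to_inv q
  have hΦ := hF.flowPhi_pos q ⟨hs.1.le, hs.2⟩
  have hy : flowMap F q (extChartAt (𝓡 n) q q, s) ∈
      (extChartAt (𝓡 (n + 1)) (F q s)).source := by
    rw [flowMap, h0]; exact mem_extChartAt_source _
  have hm := hF.isNormalMotion q (z := (extChartAt (𝓡 n) q q, s)) hu hs hy
    (β := spaceDir) (fun _ => rfl)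
  have hX : extChartAt (𝓡 (n + 1)) (F q s) (flowMap F q (extChartAt (𝓡 n) q q, s)) =
      extChartAt (𝓡 (n + 1)) (F q s) (F q s) := by rw [flowMap, h0]
  have hν : chartVec (F q s) (ν q s) = flowPhi K F ν q s •
      dirDeriv (fun z => extChartAt (𝓡 (n + 1)) (F q s) (flowMap F q z)) timeDir
        (extChartAt (𝓡 n) q q, s) := by
    rw [hF.chartVec_normal q hs (mem_extChartAt_source _), smul_smul, mul_inv_cancel₀ hΦ.ne',
      one_smul]
  have hpp : ∀ b, pd i (fun w => pd j (localRep (fun q' => F q' s) q b) w)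
      (extChartAt (𝓡 n) q q) = dirDeriv (dirDeriv
        (fun z => extChartAt (𝓡 (n + 1)) (F q s) (flowMap F q z)) (spaceDir j)) (spaceDir i)
        (extChartAt (𝓡 n) q q, s) b := fun b =>
    pd_pd_slice (hm.contDiff_map.of_le (by norm_num)) i j b
  have hI := hm.dirDeriv_induced i j
  have hA := hm.metric_covAlong_tangent (spaceDir i) j
  have hc : ∀ b, covAlong (chris (metricCoeff (F q s)))
      (fun z => extChartAt (𝓡 (n + 1)) (F q s) (flowMap F q z)) (spaceDir i)
      (dirDeriv (fun z => extChartAt (𝓡 (n + 1)) (F q s) (flowMap F q z)) (spaceDir j))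
      (extChartAt (𝓡 n) q q, s) b =
      pd i (fun w => pd j (localRep (fun q' => F q' s) q b) w) (extChartAt (𝓡 n) q q) +
      ∑ c, ∑ d, christoffel (metricCoeff (F q s)) (extChartAt (𝓡 (n + 1)) (F q s) (F q s)) b c d *
        tangentCoeff (fun q' => F q' s) q i c * tangentCoeff (fun q' => F q' s) q j d := by
    intro b
    simp only [hpp, hF.tangentCoeff_eq q hs, ← hX, covAlong]
    rw [PiLp.add_apply, chris_apply]
  have hS : secondFundForm (n := n) (fun q' => F q' s) q (ν q s) i j =
      -bilin (metricCoeff (F q s) (extChartAt (𝓡 (n + 1)) (F q s) (F q s)))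
        (chartVec (F q s) (ν q s)) (covAlong (chris (metricCoeff (F q s)))
      (fun z => extChartAt (𝓡 (n + 1)) (F q s) (flowMap F q z)) (spaceDir i)
      (dirDeriv (fun z => extChartAt (𝓡 (n + 1)) (F q s) (flowMap F q z)) (spaceDir j))
      (extChartAt (𝓡 n) q q, s)) := by
    simp only [bilin_apply, hc]
    rfl
  simp only [gram, Matrix.of_apply]
  rw [hI, hS, hν, map_smul, ← hX, _root_.smul_apply, smul_eq_mul]
  rw [hm.symm_self] at hA
  rw [hA, hm.symm_self]
  ring

theorem meanCurv_eq (hF : IsSmoothSolution K T F ν) (q : S) {s : ℝ} (hs : s ∈ Ioo 0 T)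
    {y : M} (hy : F q s ∈ (extChartAt (𝓡 (n + 1)) y).source) :
    meanCurv (n := n) (fun q' => F q' s) q (ν q s) = flowPhi K F ν q s *
      expansion (fun x => bilin (metricCoeff y x))
        (fun z => extChartAt (𝓡 (n + 1)) y (flowMap F q z)) spaceDir timeDir
        (extChartAt (𝓡 n) q q, s) := by
  have hu := mem_extChartAt_target (I := 𝓡 n) q
  have h0 : (extChartAt (𝓡 n) q).symm (extChartAt (𝓡 n) q q) = q := extChartAt_to_inv q
  have hc := expansion_chart_congr (y := y) (y' := F q s) (f := flowMap F q)
    (z := (extChartAt (𝓡 n) q q, s)) (hF.eventually_contMDiffAt_flowMap q hu hs)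
    (by rw [flowMap, h0]; exact hy) (by rw [flowMap, h0]; exact mem_extChartAt_source _)
    spaceDir timeDir
  rw [hc, expansion, Finset.mul_sum]
  simp only [Finset.mul_sum]
  refine Finset.sum_congr rfl fun i _ => Finset.sum_congr rfl fun j _ => ?_
  rw [hF.secondFundForm_eq q hs, inducedMetric, hF.restrict_eq q hs]
  ring

theorem traceK_eq (hF : IsSmoothSolution K T F ν) (q : S) {s : ℝ} (hs : s ∈ Ioo 0 T)
    {y : M} (hy : F q s ∈ (extChartAt (𝓡 (n + 1)) y).source) :
    traceK (n := n) K (fun q' => F q' s) q =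
      hyperTrace (fun x => bilin (metricCoeff y x)) (fun x => bilin (tensorCoeff K y x))
        (fun z => extChartAt (𝓡 (n + 1)) y (flowMap F q z)) spaceDir
        (extChartAt (𝓡 n) q q, s) := by
  have hu := mem_extChartAt_target (I := 𝓡 n) q
  have h0 : (extChartAt (𝓡 n) q).symm (extChartAt (𝓡 n) q q) = q := extChartAt_to_inv q
  have hc := hyperTrace_chart_congr (y := y) (y' := F q s) (f := flowMap F q) K
    (z := (extChartAt (𝓡 n) q q, s)) (hF.eventually_contMDiffAt_flowMap q hu hs)
    (by rw [flowMap, h0]; exact hy) (by rw [flowMap, h0]; exact mem_extChartAt_source _)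
    spaceDir
  rw [hc, hyperTrace]
  refine Finset.sum_congr rfl fun i _ => Finset.sum_congr rfl fun j _ => ?_
  rw [inducedMetric, hF.restrict_eq q hs, hF.restrict_eq q hs]

theorem speedSq_eq (hF : IsSmoothSolution K T F ν) (q : S) {z : Eucl n × ℝ}
    (hz : z.1 ∈ (extChartAt (𝓡 n) q).target) (hs : z.2 ∈ Ioo 0 T)
    {y : M} (hy : flowMap F q z ∈ (extChartAt (𝓡 (n + 1)) y).source) :
    speedSq (fun x => bilin (metricCoeff y x))
      (fun z => extChartAt (𝓡 (n + 1)) y (flowMap F q z)) timeDir z =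
      (flowPhi K F ν ((extChartAt (𝓡 n) q).symm z.1) z.2 ^ 2)⁻¹ :=
  (metric_dirDeriv_chart ((hF.contMDiffAt_flowMap q hz hs).mdifferentiableAt (by simp)) hy
    timeDir timeDir).trans (hF.inner_flowMap_time q hz hs)

/-- The definition `Φ² = H² - P²` divided by `Φ²`. -/
theorem expansion_sq_sub (hF : IsSmoothSolution K T F ν) (q : S) {s : ℝ} (hs : s ∈ Ioo 0 T)
    {y : M} (hy : F q s ∈ (extChartAt (𝓡 (n + 1)) y).source) :
    expansion (fun x => bilin (metricCoeff y x))
        (fun z => extChartAt (𝓡 (n + 1)) y (flowMap F q z)) spaceDir timeDir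
        (extChartAt (𝓡 n) q q, s) ^ 2 -
      speedSq (fun x => bilin (metricCoeff y x))
        (fun z => extChartAt (𝓡 (n + 1)) y (flowMap F q z)) timeDir (extChartAt (𝓡 n) q q, s) *
      hyperTrace (fun x => bilin (metricCoeff y x)) (fun x => bilin (tensorCoeff K y x))
        (fun z => extChartAt (𝓡 (n + 1)) y (flowMap F q z)) spaceDir
        (extChartAt (𝓡 n) q q, s) ^ 2 = 1 := by
  have hu := mem_extChartAt_target (I := 𝓡 n) q
  have h0 : (extChartAt (𝓡 n) q).symm (extChartAt (𝓡 n) q q) = q := extChartAt_to_inv q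
  have hΦ := hF.flowPhi_pos q ⟨hs.1.le, hs.2⟩
  have hsq : flowPhi K F ν q s ^ 2 = meanCurv (n := n) (fun q' => F q' s) q (ν q s) ^ 2 -
      traceK (n := n) K (fun q' => F q' s) q ^ 2 :=
    Real.sq_sqrt (hF.pos q s ⟨hs.1.le, hs.2⟩).le
  rw [hF.meanCurv_eq q hs hy, hF.traceK_eq q hs hy] at hsq
  rw [hF.speedSq_eq q (z := (extChartAt (𝓡 n) q q, s)) hu hs (by rw [flowMap, h0]; exact hy)]
  dsimp only
  rw [h0]
  field_simp
  linarith

end IsSmoothSolution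

end FlowCurvature

/-! ### Orthonormalizing the parameter directions -/

section ChangeOfFrame

open Filter Topology

-- The witness is the inverse of the positive square root of `A`.
open scoped MatrixOrder in
theorem exists_congruence_eq_one {n : ℕ} {A : Matrix (Fin n) (Fin n) ℝ} (hA : A.PosDef) :
    ∃ L : Matrix (Fin n) (Fin n) ℝ, IsUnit L.det ∧ L.transpose * A * L = 1 := by
  have h0 : 0 ≤ A := Matrix.nonneg_iff_posSemidef.2 hA.posSemidef
  have hs : CFC.sqrt A * CFC.sqrt A = A := CFC.sqrt_mul_sqrt_self A h0
  have ht : (CFC.sqrt A).transpose = CFC.sqrt A := by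
    have := (Matrix.nonneg_iff_posSemidef.1 (CFC.sqrt_nonneg A)).isHermitian
    rwa [Matrix.IsHermitian, Matrix.conjTranspose_eq_transpose_of_trivial] at this
  have hd : IsUnit (CFC.sqrt A).det := by
    refine isUnit_iff_ne_zero.2 fun h => hA.det_pos.ne' ?_
    rw [← hs, Matrix.det_mul, h, zero_mul]
  refine ⟨(CFC.sqrt A)⁻¹, (Matrix.isUnit_nonsing_inv_det_iff).2 hd, ?_⟩
  rw [Matrix.transpose_nonsing_inv, ht]
  nth_rw 2 [← hs]
  rw [← Matrix.mul_assoc, Matrix.nonsing_inv_mul _ hd, one_mul, Matrix.mul_nonsing_inv _ hd]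

/-- The sum is the trace of `A⁻¹ Nᵀ`, which a congruence changes by conjugation with `L`. -/
theorem sum_inv_congruence {n : ℕ} (A N : Matrix (Fin n) (Fin n) ℝ)
    {L : Matrix (Fin n) (Fin n) ℝ} (hL : IsUnit L.det) :
    ∑ i, ∑ j, (L.transpose * A * L)⁻¹ i j * (L.transpose * N * L) i j =
      ∑ i, ∑ j, A⁻¹ i j * N i j := by
  have key : ∀ P Q : Matrix (Fin n) (Fin n) ℝ, ∑ i, ∑ j, P i j * Q i j =
      Matrix.trace (P * Q.transpose) := fun P Q => by
    simp [Matrix.trace, Matrix.mul_apply]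
  have h1 : L.transpose⁻¹ * L.transpose = 1 :=
    Matrix.nonsing_inv_mul _ (by rwa [Matrix.det_transpose])
  have h2 : L * L⁻¹ = 1 := Matrix.mul_nonsing_inv _ hL
  have h3 : (L.transpose * A * L)⁻¹ * (L.transpose * N * L).transpose =
      L⁻¹ * (A⁻¹ * N.transpose * L) := by
    rw [Matrix.mul_inv_rev, Matrix.mul_inv_rev, Matrix.transpose_mul, Matrix.transpose_mul,
      Matrix.transpose_transpose]
    calc L⁻¹ * (A⁻¹ * L.transpose⁻¹) * (L.transpose * (N.transpose * L)) =
        L⁻¹ * (A⁻¹ * (L.transpose⁻¹ * L.transpose) * (N.transpose * L)) := by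
          simp only [Matrix.mul_assoc]
      _ = _ := by rw [h1, Matrix.mul_one]; simp only [Matrix.mul_assoc]
  rw [key, key, h3, Matrix.trace_mul_comm, Matrix.mul_assoc, h2, Matrix.mul_one]

variable {E Z : Type*} [NormedAddCommGroup E] [NormedSpace ℝ E]
  [NormedAddCommGroup Z] [NormedSpace ℝ Z] {n : ℕ}
  {B K : E → E →L[ℝ] E →L[ℝ] ℝ} {X : Z → E} {β : Fin n → Z} {τ z : Z}

/-- The parameter directions `∑ⱼ Lⱼᵢ βⱼ`. -/
def changeFrame (β : Fin n → Z) (L : Matrix (Fin n) (Fin n) ℝ) (i : Fin n) : Z :=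
  ∑ j, L j i • β j

theorem gram_changeFrame (β : Fin n → Z) (L : Matrix (Fin n) (Fin n) ℝ) (y : Z) :
    gram B X (changeFrame β L) y = L.transpose * gram B X β y * L := by
  ext i j
  have h : ∀ i, dirDeriv X (changeFrame β L i) y = ∑ k, L k i • dirDeriv X (β k) y := fun i => by
    simp [dirDeriv, changeFrame, map_sum]
  simp only [gram, Matrix.of_apply, h, map_sum, map_smul, _root_.sum_apply, _root_.smul_apply,
    Matrix.mul_apply, Matrix.transpose_apply, smul_eq_mul, Finset.sum_mul, Finset.mul_sum]
  refine Finset.sum_congr rfl fun a _ => Finset.sum_congr rfl fun b _ => ?_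
  ring

theorem hyperTrace_changeFrame {L : Matrix (Fin n) (Fin n) ℝ} (hL : IsUnit L.det) :
    hyperTrace B K X (changeFrame β L) z = hyperTrace B K X β z := by
  simp only [hyperTrace, gram_changeFrame]
  exact sum_inv_congruence _ _ hL

/-- As `L` is constant, the time derivative of the Gram matrix undergoes the same congruence as the
matrix. One may therefore orthonormalize at a single point and keep the constraint along the whole
time line. -/
theorem expansion_changeFrame {L : Matrix (Fin n) (Fin n) ℝ} (hL : IsUnit L.det)
    (hd : ∀ i j, DifferentiableAt ℝ (fun y => gram B X β y i j) z) :
    expansion B X (changeFrame β L) τ z = expansion B X β τ z := by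
  have h : ∀ i j, 1 / 2 * dirDeriv (fun y => gram B X (changeFrame β L) y i j) τ z =
      (L.transpose * (Matrix.of fun i j => 1 / 2 * dirDeriv (fun y => gram B X β y i j) τ z) * L)
        i j := by
    intro i j
    have h1 : HasFDerivAt (fun y => gram B X (changeFrame β L) y i j)
        (∑ b, L b j • ∑ a, L a i • fderiv ℝ (fun y => gram B X β y a b) z) z := by
      have h2 : (fun y => gram B X (changeFrame β L) y i j) =
          fun y => ∑ b, L b j • ∑ a, L a i • gram B X β y a b := by
        funext y
        simp only [gram_changeFrame, Matrix.mul_apply, Matrix.transpose_apply, smul_eq_mul,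
          mul_comm (L _ j)]
      rw [h2]
      exact HasFDerivAt.fun_sum fun b _ => (HasFDerivAt.fun_sum fun a _ =>
        (hd a b).hasFDerivAt.const_smul (L a i)).const_smul (L b j)
    simp only [dirDeriv, h1.fderiv, Matrix.mul_apply, Matrix.transpose_apply, Matrix.of_apply,
      _root_.sum_apply, _root_.smul_apply, smul_eq_mul, Finset.mul_sum, Finset.sum_mul]
    refine Finset.sum_congr rfl fun b _ => Finset.sum_congr rfl fun a _ => ?_
    ring
  simp only [expansion, h]
  rw [gram_changeFrame]
  exact sum_inv_congruence _ _ hL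

end ChangeOfFrame

/-! ### Positivity of the induced metric. -/

section FlowFrame

open Filter Topology

variable {n : ℕ} {S M : Type*} [TopologicalSpace S] [ChartedSpace (Eucl n) S]
  [IsManifold (𝓡 n) ∞ S] [TopologicalSpace M] [ChartedSpace (Eucl (n + 1)) M]
  [IsManifold (𝓡 (n + 1)) ∞ M]
  [RiemannianBundle (fun y : M => TangentSpace (𝓡 (n + 1)) y)]
  [IsContMDiffRiemannianBundle (𝓡 (n + 1)) ∞ (Eucl (n + 1))
    (fun y : M => TangentSpace (𝓡 (n + 1)) y)]
  {K : ∀ y : M, TangentSpace (𝓡 (n + 1)) y →L[ℝ] TangentSpace (𝓡 (n + 1)) y →L[ℝ] ℝ}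
  {T : ℝ} {F : S → ℝ → M} {ν : ∀ q s, TangentSpace (𝓡 (n + 1)) (F q s)}

namespace IsSmoothSolution

/-- The immersion property makes the coordinate tangent vectors linearly independent, and this is
their Gram matrix. -/
theorem posDef_gram (hF : IsSmoothSolution K T F ν) (q : S) {u : Eucl n} {s : ℝ}
    (hu : u ∈ (extChartAt (𝓡 n) q).target) (hs : s ∈ Ioo 0 T) {y : M}
    (hy : flowMap F q (u, s) ∈ (extChartAt (𝓡 (n + 1)) y).source) :
    (gram (fun x => bilin (metricCoeff y x))
      (fun z => extChartAt (𝓡 (n + 1)) y (flowMap F q z)) spaceDir (u, s)).PosDef := by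
  have hd := (hF.contMDiffAt_flowMap q (z := (u, s)) hu hs).mdifferentiableAt (by simp)
  have : IsManifold (𝓡 n) 1 S := IsManifold.of_le (n := ∞) (by norm_num)
  set A : Eucl n →L[ℝ] TangentSpace (𝓡 (n + 1)) (flowMap F q (u, s)) :=
    (mfderiv (𝓡 n) (𝓡 (n + 1)) (fun q => F q s) ((extChartAt (𝓡 n) q).symm u)).comp
      (mfderiv 𝓘(ℝ, Eucl n) (𝓡 n) (extChartAt (𝓡 n) q).symm u) with hA
  have hinj : Function.Injective A := by
    intro v w hvw
    have h1 := hF.immersion _ s ⟨hs.1.le, hs.2⟩ hvw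
    have h2 := congrArg (chartVec q) h1
    exact (chartVec_mfderiv_extChartAt_symm q hu v).symm.trans
      (h2.trans (chartVec_mfderiv_extChartAt_symm q hu w))
  have hli : LinearIndependent ℝ fun i : Fin n => A (basisVec i) := by
    have h1 := (EuclideanSpace.basisFun (Fin n) ℝ).toBasis.linearIndependent
    have h2 := h1.map' A.toLinearMap (LinearMap.ker_eq_bot.2 hinj)
    have h3 : (fun i : Fin n => A (basisVec i)) =
        A.toLinearMap ∘ (EuclideanSpace.basisFun (Fin n) ℝ).toBasis := by
      funext i
      simp
    rw [h3]
    exact h2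
  have h3 : gram (fun x => bilin (metricCoeff y x))
      (fun z => extChartAt (𝓡 (n + 1)) y (flowMap F q z)) spaceDir (u, s) =
      Matrix.gram ℝ fun i : Fin n => A (basisVec i) := by
    ext i j
    rw [gram_metricCoeff hd hy, hF.mfderiv_flowMap_space q hu hs,
      hF.mfderiv_flowMap_space q hu hs]
    rfl
  rw [h3]
  exact Matrix.posDef_gram_of_linearIndependent hli

end IsSmoothSolution

end FlowFrame

/-! ### The estimate at an interior maximum -/

section InteriorEstimate

open Filter Topology

theorem chartVec_surjective {m : ℕ} {M : Type*} [TopologicalSpace M] [ChartedSpace (Eucl m) M]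
    [IsManifold (𝓡 m) ∞ M] (y : M) {z : M} (hz : z ∈ (extChartAt (𝓡 m) y).source) (v : Eucl m) :
    ∃ w : TangentSpace (𝓡 m) z, chartVec y w = v := by
  obtain ⟨u, hu, rfl⟩ : ∃ u ∈ (extChartAt (𝓡 m) y).target, (extChartAt (𝓡 m) y).symm u = z :=
    ⟨_, (extChartAt (𝓡 m) y).map_source hz, (extChartAt (𝓡 m) y).left_inv hz⟩
  exact ⟨_, chartVec_mfderiv_extChartAt_symm y hu v⟩

variable {n : ℕ} {S M : Type*} [TopologicalSpace S] [ChartedSpace (Eucl n) S]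
  [IsManifold (𝓡 n) ∞ S] [TopologicalSpace M] [ChartedSpace (Eucl (n + 1)) M]
  [IsManifold (𝓡 (n + 1)) ∞ M]
  [RiemannianBundle (fun y : M => TangentSpace (𝓡 (n + 1)) y)]
  [IsContMDiffRiemannianBundle (𝓡 (n + 1)) ∞ (Eucl (n + 1))
    (fun y : M => TangentSpace (𝓡 (n + 1)) y)]
  {K : ∀ y : M, TangentSpace (𝓡 (n + 1)) y →L[ℝ] TangentSpace (𝓡 (n + 1)) y →L[ℝ] ℝ}
  {T : ℝ} {F : S → ℝ → M} {ν : ∀ q s, TangentSpace (𝓡 (n + 1)) (F q s)}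

namespace IsSmoothSolution

/-- The gradient estimate at a point where `ψ(p) Φ` attains its maximum `c⁻¹` over earlier
times. -/
theorem cutoff_mul_flowPhi_le (hn : 1 ≤ n) (hF : IsSmoothSolution K T F ν)
    (hKsymm : ∀ y v w, K y v w = K y w v)
    (hKsmooth : ContMDiff (𝓡 (n + 1))
      ((𝓡 (n + 1)).prod 𝓘(ℝ, Eucl (n + 1) →L[ℝ] Eucl (n + 1) →L[ℝ] ℝ)) ∞
      (fun y => TotalSpace.mk' (Eucl (n + 1) →L[ℝ] Eucl (n + 1) →L[ℝ] ℝ) y (K y)))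
    {q : S} {s : ℝ} (hs : s ∈ Ioo 0 T)
    (hH : 0 < meanCurv (n := n) (fun q' => F q' s) q (ν q s))
    {R : ℝ} (hR : 0 < R)
    (hRic : ∀ v : TangentSpace (𝓡 (n + 1)) (F q s),
      -(1 / (100 * (n + 1) * R ^ 2)) * inner ℝ v v ≤ ricci (F q s) v v)
    {p : M → ℝ} (hp : ContMDiffAt (𝓡 (n + 1)) 𝓘(ℝ, ℝ) 2 p (F q s))
    (hpgrad : gradNorm (m := n + 1) p (F q s) ≤ 3 * R)
    (hphess : ∀ v : TangentSpace (𝓡 (n + 1)) (F q s),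
      hessian p (F q s) v v ≤ 3 * inner ℝ v v)
    {ψ : ℝ → ℝ} (hψ : ContDiff ℝ 2 ψ) {c : ℝ} (hc : 0 < c)
    (hψ0 : 0 < ψ (p (F q s))) (hψ1 : ψ (p (F q s)) ≤ 1)
    (hψ' : deriv ψ (p (F q s)) ≤ 0) (hψ'' : -(4 / R ^ 2) ≤ deriv ψ (p (F q s)))
    (hψ2 : -(8 / R ^ 4) ≤ deriv (deriv ψ) (p (F q s)))
    (h0 : (c * ψ (p (F q s))) ^ 2 = (flowPhi K F ν q s ^ 2)⁻¹)
    (hmax : ∀ᶠ w : S × ℝ in 𝓝 (q, s), w.2 ≤ s →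
      (c * ψ (p (F w.1 w.2))) ^ 2 ≤ (flowPhi K F ν w.1 w.2 ^ 2)⁻¹) :
    ψ (p (F q s)) * flowPhi K F ν q s ≤
      100 * n * (1 / R + tensorNorm K (F q s) + Real.sqrt (covDerivNorm K (F q s))) := by
  have hu := mem_extChartAt_target (I := 𝓡 n) q
  have hq : (extChartAt (𝓡 n) q).symm (extChartAt (𝓡 n) q q) = q := extChartAt_to_inv q
  have hΦ := hF.flowPhi_pos q ⟨hs.1.le, hs.2⟩
  have hys := mem_extChartAt_source (I := 𝓡 (n + 1)) (F q s)
  have hyt := mem_extChartAt_target (I := 𝓡 (n + 1)) (F q s)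
  have hy : flowMap F q (extChartAt (𝓡 n) q q, s) ∈
      (extChartAt (𝓡 (n + 1)) (F q s)).source := by
    rw [flowMap, hq]; exact hys
  have hysymm : (extChartAt (𝓡 (n + 1)) (F q s)).symm (extChartAt (𝓡 (n + 1)) (F q s) (F q s)) =
    F q s := extChartAt_to_inv _
  -- everything in the fixed charts at `q` and at `F q s`
  obtain ⟨X, hXdef⟩ : ∃ X : Eucl n × ℝ → Eucl (n + 1),
    X = fun z => extChartAt (𝓡 (n + 1)) (F q s) (flowMap F q z) := ⟨_, rfl⟩
  have hX : X (extChartAt (𝓡 n) q q, s) = extChartAt (𝓡 (n + 1)) (F q s) (F q s) := by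
    rw [hXdef]; simp only [flowMap, hq]
  have hnear : ∀ᶠ z in 𝓝 (extChartAt (𝓡 n) q q, s), z.1 ∈ (extChartAt (𝓡 n) q).target ∧
      z.2 ∈ Ioo 0 T ∧ flowMap F q z ∈ (extChartAt (𝓡 (n + 1)) (F q s)).source := by
    filter_upwards [prod_mem_nhds ((isOpen_extChartAt_target q).mem_nhds hu)
      (isOpen_Ioo.mem_nhds hs), eventually_chart (hF.eventually_contMDiffAt_flowMap q
        (z := (extChartAt (𝓡 n) q q, s)) hu hs) hy] with z h1 h2
    exact ⟨h1.1, h1.2, h2.2⟩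
  have hspeed : ∀ᶠ z in 𝓝 (extChartAt (𝓡 n) q q, s),
      speedSq (fun x => bilin (metricCoeff (F q s) x)) X timeDir z =
        (flowPhi K F ν ((extChartAt (𝓡 n) q).symm z.1) z.2 ^ 2)⁻¹ := by
    filter_upwards [hnear] with z hz
    rw [hXdef]
    exact hF.speedSq_eq q hz.1 hz.2.1 hz.2.2
  have hspeed0 : speedSq (fun x => bilin (metricCoeff (F q s) x)) X timeDir
      (extChartAt (𝓡 n) q q, s) = (flowPhi K F ν q s ^ 2)⁻¹ := by
    rw [hspeed.self_of_nhds, hq]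
  have htouch : ∀ᶠ z in 𝓝 (extChartAt (𝓡 n) q q, s), z.2 ≤ s →
      (c * ψ (p ((extChartAt (𝓡 (n + 1)) (F q s)).symm (X z)))) ^ 2 ≤
        speedSq (fun x => bilin (metricCoeff (F q s) x)) X timeDir z := by
    have hcont : ContinuousAt (fun z : Eucl n × ℝ => ((extChartAt (𝓡 n) q).symm z.1, z.2))
        (extChartAt (𝓡 n) q q, s) :=
      ((continuousAt_extChartAt_symm q).comp_of_eq continuousAt_fst rfl).prodMk continuousAt_snd
    have h1 := hcont.tendsto
    dsimp only at h1
    rw [hq] at h1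
    filter_upwards [hnear, hspeed, h1.eventually hmax] with z h2 h3 h4 h5
    rw [h3, hXdef]
    simp only [(extChartAt (𝓡 (n + 1)) (F q s)).left_inv h2.2.2]
    exact h4 h5
  -- an orthonormal frame
  have hmot : ∀ {z : Eucl n × ℝ}, z.1 ∈ (extChartAt (𝓡 n) q).target → z.2 ∈ Ioo 0 T →
      flowMap F q z ∈ (extChartAt (𝓡 (n + 1)) (F q s)).source → ∀ {β : Fin n → Eucl n × ℝ},
      (∀ i, (β i).2 = 0) → IsNormalMotion (fun x => bilin (metricCoeff (F q s) x))
        (chris (metricCoeff (F q s))) X β timeDir z := by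
    intro z h1 h2 h3 β h4
    rw [hXdef]; exact hF.isNormalMotion q h1 h2 h3 h4
  have hpd := hF.posDef_gram q hu hs hy
  rw [← hXdef] at hpd
  obtain ⟨L, hL, honb⟩ := exists_congruence_eq_one hpd
  rw [← gram_changeFrame] at honb
  -- The new directions keep time fixed, so touching holds on both sides along them, although it is
  -- known only for times up to `s`.
  have hβ0 : ∀ i, (changeFrame (spaceDir (n := n)) L i).2 = 0 := fun i => by
    simp [changeFrame, Prod.snd_sum]
  have hexp : ∀ s' ∈ Ioo 0 T, F q s' ∈ (extChartAt (𝓡 (n + 1)) (F q s)).source →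
      expansion (fun x => bilin (metricCoeff (F q s) x)) X (changeFrame spaceDir L) timeDir
        (extChartAt (𝓡 n) q q, s') = expansion (fun x => bilin (metricCoeff (F q s) x)) X
        spaceDir timeDir (extChartAt (𝓡 n) q q, s') := by
    intro s' hs' hy'
    have hm := hmot (z := (extChartAt (𝓡 n) q q, s')) hu hs' (by rw [flowMap, hq]; exact hy')
      (β := spaceDir) (fun _ => rfl)
    exact expansion_changeFrame hL fun i j =>
      (hm.contDiffAt_gram hm.contDiff_metric i j).differentiableAt (by norm_num)
  have hline : ∀ r : ℝ, ((extChartAt (𝓡 n) q q, s) : Eucl n × ℝ) + r • timeDir =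
      (extChartAt (𝓡 n) q q, s + r) := fun r => by
    ext1 <;> simp
  have hlT : dirDeriv X timeDir (extChartAt (𝓡 n) q q, s) =
      chartVec (F q s) ((flowPhi K F ν q s)⁻¹ • ν q s) := by
    rw [hXdef, hF.chartVec_normal q hs hys, chartVec_smul]
  have key := IsNormalMotion.div_speed_le (G := metricCoeff (F q s)) (K := tensorCoeff K (F q s))
    (X := X) (β := changeFrame spaceDir L) (τ := timeDir) (z := (extChartAt (𝓡 n) q q, s))
    hn (hmot (z := (extChartAt (𝓡 n) q q, s)) hu hs hy hβ0) honb
    (by rw [hspeed0]; positivity)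
    (fun a b => by
      rw [hX]; exact (contDiffAt_metricCoeff (F q s) hyt a b).of_le ENat.LEInfty.out)
    (fun a b => by
      rw [hX]; exact (contDiffAt_tensorCoeff hKsmooth (F q s) hyt a b).of_le ENat.LEInfty.out)
    (fun a b => hKsymm _ _ _)
    (p := fun u => p ((extChartAt (𝓡 (n + 1)) (F q s)).symm u))
    (by
      rw [hX, ← contMDiffAt_iff_contDiffAt]
      refine ContMDiffAt.comp_of_eq (g := p) hp ?_ hysymm
      exact ((contMDiffOn_extChartAt_symm (n := 2) (F q s)).contMDiffAt
        ((isOpen_extChartAt_target (F q s)).mem_nhds hyt)))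
    hψ hR hc
    (by simpa only [hX, hysymm] using hψ0)
    (by simpa only [hX, hysymm] using hψ1)
    (by simpa only [hX, hysymm] using hψ')
    (by simpa only [hX, hysymm] using hψ'')
    (by simpa only [hX, hysymm] using hψ2)
    (by simpa only [hX, hysymm, hspeed0] using h0)
    (fun i => ((tendsto_line _ _).eventually htouch).mono fun r hr => hr (by simp [hβ0]))
    (by
      filter_upwards [((tendsto_line _ _).mono_left nhdsWithin_le_nhds).eventually htouch,
        self_mem_nhdsWithin] with r h1 h2
      refine h1 ?_
      rw [hline]
      simpa using h2)
    (by
      filter_upwards [(tendsto_line _ _).eventually hnear] with r h1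
      rw [hline] at h1 ⊢
      have h2 : F q (s + r) ∈ (extChartAt (𝓡 (n + 1)) (F q s)).source := by
        have := h1.2.2
        rwa [flowMap, hq] at this
      rw [hexp _ h1.2.1 h2, hyperTrace_changeFrame hL, hXdef]
      exact hF.expansion_sq_sub q h1.2.1 h2)
    (by
      have h1 := hF.meanCurv_eq q hs hys
      rw [h1] at hH
      rw [hexp s hs hys, hXdef]
      exact pos_of_mul_pos_right hH hΦ.le)
    (by
      have h1 := hRic ((flowPhi K F ν q s)⁻¹ • ν q s)
      have h2 : inner ℝ ((flowPhi K F ν q s)⁻¹ • ν q s) ((flowPhi K F ν q s)⁻¹ • ν q s) =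
          (flowPhi K F ν q s ^ 2)⁻¹ := by
        rw [inner_eq_bilin (F q s) hys, ← hlT, ← hspeed0, speedSq, hX]
      rw [h2] at h1
      rw [hspeed0, hlT, hX]
      exact h1)
    (by rw [hX]; exact hpgrad)
    (fun v => by
      obtain ⟨w, rfl⟩ := chartVec_surjective (F q s) hys v
      rw [hX, ← inner_eq_bilin (F q s) hys]
      exact hphess w)
  -- The speed is `Φ⁻¹`, so dividing by it multiplies by `Φ`.
  rw [hspeed0, hX, hysymm, Real.sqrt_inv, Real.sqrt_sq hΦ.le, div_inv_eq_mul] at key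
  exact key

end IsSmoothSolution

end InteriorEstimate

/-! ### Continuity of the space-time mean curvature -/

section Continuity

open Filter Topology

variable {n : ℕ} {S M : Type*} [TopologicalSpace S] [ChartedSpace (Eucl n) S]
  [IsManifold (𝓡 n) ∞ S] [TopologicalSpace M] [ChartedSpace (Eucl (n + 1)) M]
  [IsManifold (𝓡 (n + 1)) ∞ M]
  [RiemannianBundle (fun y : M => TangentSpace (𝓡 (n + 1)) y)]
  [IsContMDiffRiemannianBundle (𝓡 (n + 1)) ∞ (Eucl (n + 1))
    (fun y : M => TangentSpace (𝓡 (n + 1)) y)]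
  {K : ∀ y : M, TangentSpace (𝓡 (n + 1)) y →L[ℝ] TangentSpace (𝓡 (n + 1)) y →L[ℝ] ℝ}
  {T : ℝ} {F : S → ℝ → M} {ν : ∀ q s, TangentSpace (𝓡 (n + 1)) (F q s)}

namespace IsSmoothSolution

omit [IsManifold (𝓡 (n + 1)) ∞ M] [IsContMDiffRiemannianBundle (𝓡 (n + 1)) ∞ (Eucl (n + 1))
  (fun y : M => TangentSpace (𝓡 (n + 1)) y)] in
theorem contMDiffOn_flowMap (hF : IsSmoothSolution K T F ν) (q : S) :
    ContMDiffOn 𝓘(ℝ, Eucl n × ℝ) (𝓡 (n + 1)) ∞ (flowMap F q)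
      ((extChartAt (𝓡 n) q).target ×ˢ Ico 0 T) := by
  have h2 : ContMDiffOn 𝓘(ℝ, Eucl n) (𝓡 n) ∞ (extChartAt (𝓡 n) q).symm
      (extChartAt (𝓡 n) q).target := contMDiffOn_extChartAt_symm q
  have h3 : ContMDiff 𝓘(ℝ, Eucl n × ℝ) 𝓘(ℝ, Eucl n) ∞ (Prod.fst : Eucl n × ℝ → Eucl n) :=
    contDiff_fst.contMDiff
  have h4 : ContMDiff 𝓘(ℝ, Eucl n × ℝ) 𝓘(ℝ, ℝ) ∞ (Prod.snd : Eucl n × ℝ → ℝ) :=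
    contDiff_snd.contMDiff
  have h5 : ContMDiffOn 𝓘(ℝ, Eucl n × ℝ) ((𝓡 n).prod 𝓘(ℝ, ℝ)) ∞
      (fun z : Eucl n × ℝ => ((extChartAt (𝓡 n) q).symm z.1, z.2))
      ((extChartAt (𝓡 n) q).target ×ˢ Ico 0 T) :=
    (h2.comp h3.contMDiffOn fun z hz => hz.1).prodMk h4.contMDiffOn
  exact hF.smooth.comp h5 fun z hz => ⟨mem_univ _, hz.2⟩

omit [IsManifold (𝓡 n) ∞ S] in
theorem uniqueDiffOn_target (q : S) :
    UniqueDiffOn ℝ ((extChartAt (𝓡 n) q).target ×ˢ Ico (0 : ℝ) T) :=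
  (isOpen_extChartAt_target q).uniqueDiffOn.prod (uniqueDiffOn_Ico 0 T)

omit [IsManifold (𝓡 (n + 1)) ∞ M] [IsContMDiffRiemannianBundle (𝓡 (n + 1)) ∞ (Eucl (n + 1))
  (fun y : M => TangentSpace (𝓡 (n + 1)) y)] in
theorem mfderivWithin_flowMap_time (hF : IsSmoothSolution K T F ν) (q : S) {z : Eucl n × ℝ}
    (hz : z ∈ (extChartAt (𝓡 n) q).target ×ˢ Ico 0 T) :
    mfderivWithin 𝓘(ℝ, Eucl n × ℝ) (𝓡 (n + 1)) (flowMap F q)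
      ((extChartAt (𝓡 n) q).target ×ˢ Ico 0 T) z timeDir =
      (flowPhi K F ν ((extChartAt (𝓡 n) q).symm z.1) z.2)⁻¹ •
        ν ((extChartAt (𝓡 n) q).symm z.1) z.2 := by
  have h1 : MDifferentiableWithinAt 𝓘(ℝ, Eucl n × ℝ) (𝓡 (n + 1)) (flowMap F q)
      ((extChartAt (𝓡 n) q).target ×ˢ Ico 0 T) (z.1, z.2) :=
    (hF.contMDiffOn_flowMap q z hz).mdifferentiableWithinAt (by simp)
  have hι : HasFDerivAt (fun s' : ℝ => (z.1, s')) (ContinuousLinearMap.inr ℝ (Eucl n) ℝ) z.2 :=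
    hasFDerivAt_prodMk_right z.1 z.2
  have hu : UniqueDiffWithinAt ℝ (Ico 0 T) z.2 := uniqueDiffOn_Ico 0 T z.2 hz.2
  have h2 := mfderivWithin_comp (I := 𝓘(ℝ, ℝ)) (f := fun s' : ℝ => (z.1, s'))
    (s := Ico 0 T) z.2 h1 hι.differentiableAt.mdifferentiableAt.mdifferentiableWithinAt
    (fun s' hs' => ⟨hz.1, hs'⟩) hu.uniqueMDiffWithinAt
  rw [mfderivWithin_eq_fderivWithin, hι.hasFDerivWithinAt.fderivWithin hu] at h2
  have h3 := hF.flow ((extChartAt (𝓡 n) q).symm z.1) z.2 hz.2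
  exact (congrArg (fun L => L (1 : ℝ)) h2).symm.trans h3

/-- No continuity of `ν` is assumed. Instead `Φ` is recovered from the squared length of the
velocity, which is `Φ⁻²`; derivatives within the half-open time interval include the initial time.
-/
theorem continuousOn_flowPhi_chart (hF : IsSmoothSolution K T F ν) (q : S) :
    ContinuousOn (fun z : Eucl n × ℝ => flowPhi K F ν ((extChartAt (𝓡 n) q).symm z.1) z.2)
      ((extChartAt (𝓡 n) q).target ×ˢ Ico 0 T) := by
  have : IsManifold (𝓡 (n + 1)) 1 M := IsManifold.of_le (n := ∞) (by norm_num)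
  have : IsContMDiffRiemannianBundle (𝓡 (n + 1)) 0 (Eucl (n + 1))
      (fun y : M => TangentSpace (𝓡 (n + 1)) y) :=
    IsContMDiffRiemannianBundle.of_le (n := ∞) ENat.LEInfty.out
  have h2 := (hF.contMDiffOn_flowMap q).contMDiffOn_tangentMapWithin (m := 0) (by simp)
    (uniqueDiffOn_target q).uniqueMDiffOn
  have h3 : ContMDiff 𝓘(ℝ, Eucl n × ℝ) 𝓘(ℝ, Eucl n × ℝ).tangent 0
      (fun u : Eucl n × ℝ => (TotalSpace.mk' (Eucl n × ℝ) u timeDir :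
        TangentBundle 𝓘(ℝ, Eucl n × ℝ) (Eucl n × ℝ))) :=
    contMDiff_vectorSpace_iff_contDiff (V := fun _ => timeDir) |>.2 contDiff_const
  have h4 := h2.comp h3.contMDiffOn (s := (extChartAt (𝓡 n) q).target ×ˢ Ico 0 T)
    (fun u hu => hu)
  have h5 : ContMDiffOn 𝓘(ℝ, Eucl n × ℝ) 𝓘(ℝ, ℝ) 0 (fun z => inner ℝ
      (mfderivWithin 𝓘(ℝ, Eucl n × ℝ) (𝓡 (n + 1)) (flowMap F q)
        ((extChartAt (𝓡 n) q).target ×ˢ Ico 0 T) z timeDir)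
      (mfderivWithin 𝓘(ℝ, Eucl n × ℝ) (𝓡 (n + 1)) (flowMap F q)
        ((extChartAt (𝓡 n) q).target ×ˢ Ico 0 T) z timeDir))
      ((extChartAt (𝓡 n) q).target ×ˢ Ico 0 T) :=
    ContMDiffOn.inner_bundle (IB := 𝓡 (n + 1)) (F := Eucl (n + 1))
      (E := fun y : M => TangentSpace (𝓡 (n + 1)) y) (b := flowMap F q) h4 h4
  have h6 : ContinuousOn (fun z : Eucl n × ℝ =>
      (flowPhi K F ν ((extChartAt (𝓡 n) q).symm z.1) z.2 ^ 2)⁻¹)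
      ((extChartAt (𝓡 n) q).target ×ˢ Ico 0 T) := by
    refine h5.continuousOn.congr fun z hz => ?_
    dsimp only
    rw [hF.mfderivWithin_flowMap_time q hz]
    have hν := hF.unit ((extChartAt (𝓡 n) q).symm z.1) z.2 hz.2
    set Φ := flowPhi K F ν ((extChartAt (𝓡 n) q).symm z.1) z.2
    refine Eq.symm ((real_inner_smul_left (F := TangentSpace (𝓡 (n + 1))
      (F ((extChartAt (𝓡 n) q).symm z.1) z.2)) _ _ _).trans ?_)
    rw [real_inner_smul_right, hν, mul_one, sq, mul_inv]
  have h7 : ContinuousOn (fun z : Eucl n × ℝ =>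
      Real.sqrt ((flowPhi K F ν ((extChartAt (𝓡 n) q).symm z.1) z.2 ^ 2)⁻¹)⁻¹)
      ((extChartAt (𝓡 n) q).target ×ˢ Ico 0 T) :=
    (h6.inv₀ fun z hz => inv_ne_zero (pow_ne_zero 2 (hF.flowPhi_pos _ hz.2).ne')).sqrt
  refine h7.congr fun z hz => ?_
  dsimp only
  rw [inv_inv, Real.sqrt_sq (hF.flowPhi_pos _ hz.2).le]

theorem continuousOn_flowPhi (hF : IsSmoothSolution K T F ν) :
    ContinuousOn (fun w : S × ℝ => flowPhi K F ν w.1 w.2) (univ ×ˢ Ico 0 T) := by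
  rintro ⟨q, s⟩ hw
  have hc : ContinuousAt (fun w : S × ℝ => (extChartAt (𝓡 n) q w.1, w.2)) (q, s) :=
    ((continuousAt_extChartAt q).comp_of_eq continuousAt_fst rfl).prodMk continuousAt_snd
  have hsrc : ∀ᶠ w : S × ℝ in 𝓝 (q, s), w.1 ∈ (extChartAt (𝓡 n) q).source :=
    continuousAt_fst.eventually (extChartAt_source_mem_nhds q)
  have h1 := (hF.continuousOn_flowPhi_chart q (extChartAt (𝓡 n) q q, s)
    ⟨mem_extChartAt_target q, hw.2⟩).tendsto
  have h2 : Tendsto (fun w : S × ℝ => (extChartAt (𝓡 n) q w.1, w.2))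
      (𝓝[univ ×ˢ Ico 0 T] (q, s))
      (𝓝[(extChartAt (𝓡 n) q).target ×ˢ Ico 0 T] (extChartAt (𝓡 n) q q, s)) := by
    refine tendsto_nhdsWithin_iff.2 ⟨hc.tendsto.mono_left nhdsWithin_le_nhds, ?_⟩
    filter_upwards [self_mem_nhdsWithin, nhdsWithin_le_nhds hsrc] with w h3 h4
    exact ⟨(extChartAt (𝓡 n) q).map_source h4, h3.2⟩
  have h3 := h1.comp h2
  dsimp only at h3
  rw [extChartAt_to_inv] at h3
  refine Tendsto.congr' ?_ h3
  filter_upwards [nhdsWithin_le_nhds hsrc] with w hw'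
  simp only [Function.comp_apply, (extChartAt (𝓡 n) q).left_inv hw']

end IsSmoothSolution

end Continuity

/-! ### The cutoff function -/

section Cutoff

open Filter Topology

/-- The profile of the cutoff function: it is `1` up to `1/2`, equals `4ρ(1 - ρ)` on `[1/2, 1]`,
and vanishes from `1` on. -/
def cutoff (ρ : ℝ) : ℝ := 4 * max (1 / 2) (min ρ 1) * (1 - max (1 / 2) (min ρ 1))

theorem continuous_cutoff : Continuous cutoff := by
  unfold cutoff
  fun_prop

theorem cutoff_of_le {ρ : ℝ} (h : ρ ≤ 1 / 2) : cutoff ρ = 1 := by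
  rw [cutoff, max_eq_left ((min_le_left _ _).trans h)]
  norm_num

theorem cutoff_of_mem {ρ : ℝ} (h : ρ ∈ Icc (1 / 2) 1) : cutoff ρ = 4 * ρ * (1 - ρ) := by
  rw [cutoff, min_eq_left h.2, max_eq_right h.1]

theorem cutoff_of_one_le {ρ : ℝ} (h : 1 ≤ ρ) : cutoff ρ = 0 := by
  rw [cutoff, min_eq_right h]
  norm_num

theorem antitone_cutoff : Antitone cutoff := by
  intro a b hab
  have h1 : max (1 / 2) (min a 1) ≤ max (1 / 2) (min b 1) := by gcongr
  have h2 : 1 / 2 ≤ max (1 / 2) (min a 1) := le_max_left _ _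
  unfold cutoff
  nlinarith

theorem cutoff_nonneg (ρ : ℝ) : 0 ≤ cutoff ρ := by
  rw [← cutoff_of_one_le (le_max_right ρ 1)]
  exact antitone_cutoff (le_max_left ρ 1)

theorem cutoff_le_one (ρ : ℝ) : cutoff ρ ≤ 1 := by
  rw [← cutoff_of_le (min_le_right ρ (1 / 2))]
  exact antitone_cutoff (min_le_left ρ (1 / 2))

/-- The parabola lies below the profile everywhere, so it can serve as a touching function at the
kink `ρ = 1/2` too. -/
theorem le_cutoff (ρ : ℝ) : 4 * ρ * (1 - ρ) ≤ cutoff ρ := by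
  rcases le_total ρ (1 / 2) with h | h
  · rw [cutoff_of_le h]
    nlinarith [sq_nonneg (2 * ρ - 1)]
  rcases le_total ρ 1 with h' | h'
  · rw [cutoff_of_mem ⟨h, h'⟩]
  · rw [cutoff_of_one_le h']
    nlinarith

/-- At a point where it is positive, the cutoff function is touched from below by a smooth
function with controlled derivatives. -/
theorem exists_smooth_touching_cutoff {R r : ℝ} (hR : 0 < R) (hr : 0 < cutoff (r / R ^ 2)) :
    ∃ ψ : ℝ → ℝ, ContDiff ℝ 2 ψ ∧ ψ r = cutoff (r / R ^ 2) ∧ deriv ψ r ≤ 0 ∧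
      -(4 / R ^ 2) ≤ deriv ψ r ∧ -(8 / R ^ 4) ≤ deriv (deriv ψ) r ∧
      ∀ᶠ r' in 𝓝 r, 0 ≤ ψ r' ∧ ψ r' ≤ cutoff (r' / R ^ 2) := by
  have hR2 : 0 < R ^ 2 := by positivity
  have hlt : r / R ^ 2 < 1 := by
    by_contra h
    rw [cutoff_of_one_le (not_lt.1 h)] at hr
    exact lt_irrefl _ hr
  rcases lt_or_ge (r / R ^ 2) (1 / 2) with h | h
  · refine ⟨fun _ => 1, contDiff_const, (cutoff_of_le h.le).symm, ?_, ?_, ?_, ?_⟩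
    · simp
    · simp only [deriv_const]
      have : 0 < 4 / R ^ 2 := by positivity
      linarith
    · simp only [deriv_const']
      have : 0 < 8 / R ^ 4 := by positivity
      linarith
    · have hc : ContinuousAt (fun r' : ℝ => r' / R ^ 2) r := by fun_prop
      filter_upwards [hc.eventually (gt_mem_nhds h)] with r' h'
      rw [cutoff_of_le h'.le]
      exact ⟨zero_le_one, le_rfl⟩
  -- Here `1/2 ≤ ρ < 1`, and the parabola has `ρ`-slope `4 (1 - 2ρ)` between `-4` and `0` and second
  -- derivative `-8`, before rescaling by `R²`.
  · have hd : ∀ y : ℝ, HasDerivAt (fun r' : ℝ => 4 * (r' / R ^ 2) * (1 - r' / R ^ 2))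
        (4 / R ^ 2 * (1 - 2 * (y / R ^ 2))) y := by
      intro y
      have h1 := (hasDerivAt_id y).div_const (R ^ 2)
      have h2 := (h1.const_mul 4).mul (h1.const_sub 1)
      refine h2.congr_deriv ?_
      simp only [id]
      field_simp
      ring
    have hd1 : deriv (fun r' : ℝ => 4 * (r' / R ^ 2) * (1 - r' / R ^ 2)) =
        fun y => 4 / R ^ 2 * (1 - 2 * (y / R ^ 2)) := funext fun y => (hd y).deriv
    have hd2 : deriv (fun y => 4 / R ^ 2 * (1 - 2 * (y / R ^ 2))) r = -(8 / R ^ 4) := by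
      have h1 := (((((hasDerivAt_id r).div_const (R ^ 2)).const_mul 2).const_sub 1).const_mul
        (4 / R ^ 2)).deriv
      refine h1.trans ?_
      field_simp
      ring
    have hpos : 0 < 4 / R ^ 2 := by positivity
    refine ⟨fun r' => 4 * (r' / R ^ 2) * (1 - r' / R ^ 2), by fun_prop,
      (cutoff_of_mem ⟨h, hlt.le⟩).symm, ?_, ?_, ?_, ?_⟩
    · rw [hd1]
      dsimp only
      nlinarith
    · rw [hd1]
      dsimp only
      nlinarith
    · rw [hd1, hd2]
    · have hc : ContinuousAt (fun r' : ℝ => r' / R ^ 2) r := by fun_prop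
      filter_upwards [hc.eventually (gt_mem_nhds hlt),
        hc.eventually (lt_mem_nhds (show 0 < r / R ^ 2 by linarith))] with r' h1 h2
      exact ⟨by nlinarith, le_cutoff _⟩

variable {M : Type*} [MetricSpace M]

open Classical in
/-- The cutoff function of the ball of radius `R` about `x`, built from a function `p` comparable
with the squared distance. -/
def ballCutoff (x : M) (R : ℝ) (p : M → ℝ) (y : M) : ℝ :=
  if y ∈ Metric.ball x R then cutoff (p y / R ^ 2) else 0

variable {x : M} {R : ℝ} {p : M → ℝ}

theorem ballCutoff_of_mem {y : M} (hy : y ∈ Metric.ball x R) :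
    ballCutoff x R p y = cutoff (p y / R ^ 2) := if_pos hy

theorem ballCutoff_of_notMem {y : M} (hy : y ∉ Metric.ball x R) : ballCutoff x R p y = 0 :=
  if_neg hy

theorem ballCutoff_nonneg (y : M) : 0 ≤ ballCutoff x R p y := by
  unfold ballCutoff
  split_ifs
  exacts [cutoff_nonneg _, le_rfl]

/-- At points outside the open ball, including its boundary, `p` gives no information; there `d² ≤
p` squeezes the cutoff between `0` and the continuous profile of `d²/R²`, which vanishes. -/
theorem continuous_ballCutoff (hR : 0 < R) (hp : ContinuousOn p (Metric.ball x R))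
    (hpd : ∀ y ∈ Metric.ball x R, dist x y ^ 2 ≤ p y) : Continuous (ballCutoff x R p) := by
  rw [continuous_iff_continuousAt]
  intro y
  by_cases hy : y ∈ Metric.ball x R
  · have hn : Metric.ball x R ∈ 𝓝 y := Metric.isOpen_ball.mem_nhds hy
    have h1 : ContinuousAt (fun y => cutoff (p y / R ^ 2)) y :=
      continuous_cutoff.continuousAt.comp ((hp.continuousAt hn).div_const _)
    refine h1.congr ?_
    filter_upwards [hn] with y' hy' using (ballCutoff_of_mem hy').symm
  · have h1 : Continuous fun y' => cutoff (dist x y' ^ 2 / R ^ 2) :=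
      continuous_cutoff.comp (by fun_prop)
    have h2 : cutoff (dist x y ^ 2 / R ^ 2) = 0 := by
      refine cutoff_of_one_le ?_
      rw [Metric.mem_ball, not_lt, dist_comm] at hy
      rw [one_le_div (by positivity)]
      gcongr
    have h3 := h1.tendsto y
    rw [h2] at h3
    rw [ContinuousAt, ballCutoff_of_notMem hy]
    refine tendsto_of_tendsto_of_tendsto_of_le_of_le tendsto_const_nhds h3
      (fun y' => ballCutoff_nonneg y') fun y' => ?_
    by_cases hy' : y' ∈ Metric.ball x R
    · rw [ballCutoff_of_mem hy']
      refine antitone_cutoff ?_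
      gcongr
      exact hpd y' hy'
    · rw [ballCutoff_of_notMem hy']
      exact cutoff_nonneg _

end Cutoff

/-! ### The local estimate -/

section LocalEstimate

open Filter Topology

variable {n : ℕ} {S M : Type*} [TopologicalSpace S] [ChartedSpace (Eucl n) S]
  [IsManifold (𝓡 n) ∞ S] [MetricSpace M] [ChartedSpace (Eucl (n + 1)) M]
  [IsManifold (𝓡 (n + 1)) ∞ M]
  [RiemannianBundle (fun y : M => TangentSpace (𝓡 (n + 1)) y)]
  [IsContMDiffRiemannianBundle (𝓡 (n + 1)) ∞ (Eucl (n + 1))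
    (fun y : M => TangentSpace (𝓡 (n + 1)) y)]
  {K : ∀ y : M, TangentSpace (𝓡 (n + 1)) y →L[ℝ] TangentSpace (𝓡 (n + 1)) y →L[ℝ] ℝ}
  {T : ℝ} {F : S → ℝ → M} {ν : ∀ q s, TangentSpace (𝓡 (n + 1)) (F q s)}

namespace IsSmoothSolution

/-- Properness provides a maximum point of cutoff times `Φ`. The two alternatives are that it lies
at the initial time or at a positive time, where the interior estimate applies. -/
theorem flowPhi_le_of_mem_half_ball (hn : 1 ≤ n) (hF : IsSmoothSolution K T F ν)
    (hKsymm : ∀ y v w, K y v w = K y w v)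
    (hKsmooth : ContMDiff (𝓡 (n + 1))
      ((𝓡 (n + 1)).prod 𝓘(ℝ, Eucl (n + 1) →L[ℝ] Eucl (n + 1) →L[ℝ] ℝ)) ∞
      (fun y => TotalSpace.mk' (Eucl (n + 1) →L[ℝ] Eucl (n + 1) →L[ℝ] ℝ) y (K y)))
    {t : ℝ} (htT : t < T)
    (hH : ∀ q, ∀ s ∈ Icc 0 t, 0 < meanCurv (n := n) (fun q' => F q' s) q (ν q s))
    {x : M} {R : ℝ} (hR : 0 < R)
    (hRic : ∀ y ∈ Metric.ball x R, ∀ v : TangentSpace (𝓡 (n + 1)) y,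
      -(1 / (100 * (n + 1) * R ^ 2)) * inner ℝ v v ≤ ricci y v v)
    {p : M → ℝ} (hp2 : ContMDiffOn (𝓡 (n + 1)) 𝓘(ℝ, ℝ) 2 p (Metric.ball x R))
    (hpd : ∀ y ∈ Metric.ball x R, dist x y ^ 2 ≤ p y ∧ p y ≤ 3 / 2 * dist x y ^ 2)
    (hpgrad : ∀ y ∈ Metric.ball x R, gradNorm (m := n + 1) p y ≤ 3 * dist x y)
    (hphess : ∀ y ∈ Metric.ball x R, ∀ v : TangentSpace (𝓡 (n + 1)) y,
      hessian p y v v ≤ 3 * inner ℝ v v)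
    (hproper : IsCompact {z : S × ℝ | z.2 ∈ Icc 0 t ∧ F z.1 z.2 ∈ closure (Metric.ball x R)})
    {q : S} {s : ℝ} (hs : s ∈ Icc 0 t) (hq : F q s ∈ Metric.ball x (R / 2)) :
    (∃ q', F q' 0 ∈ Metric.ball x R ∧ flowPhi K F ν q s ≤ flowPhi K F ν q' 0) ∨
      ∃ y ∈ Metric.ball x R, flowPhi K F ν q s ≤
        100 * n * (1 / R + tensorNorm K y + Real.sqrt (covDerivNorm K y)) := by
  have hIcc : ∀ {s}, s ∈ Icc 0 t → s ∈ Ico 0 T := fun h => ⟨h.1, h.2.trans_lt htT⟩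
  have hqR : F q s ∈ Metric.ball x R := Metric.ball_subset_ball (by linarith) hq
  -- On the half ball `p ≤ 3/2 · R²/4 = 3R²/8`, below the threshold `R²/2`.
  have hηq : ballCutoff x R p (F q s) = 1 := by
    rw [ballCutoff_of_mem hqR]
    refine cutoff_of_le ?_
    rw [div_le_iff₀ (by positivity)]
    rw [Metric.mem_ball, dist_comm] at hq
    have h1 := (hpd _ hqR).2
    have h2 : dist x (F q s) ^ 2 ≤ (R / 2) ^ 2 := by gcongr
    nlinarith [sq_nonneg R]
  have hηc : Continuous (ballCutoff x R p) :=
    continuous_ballCutoff hR hp2.continuousOn fun y hy => (hpd y hy).1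
  have hvc : ContinuousOn (fun w : S × ℝ =>
      ballCutoff x R p (F w.1 w.2) * flowPhi K F ν w.1 w.2)
      {z : S × ℝ | z.2 ∈ Icc 0 t ∧ F z.1 z.2 ∈ closure (Metric.ball x R)} :=
    ((hηc.comp_continuousOn hF.smooth.continuousOn).mul hF.continuousOn_flowPhi).mono
      fun z hz => ⟨mem_univ _, hIcc hz.1⟩
  obtain ⟨⟨q₁, s₁⟩, ⟨hs₁, -⟩, hmax⟩ := hproper.exists_isMaxOn
    ⟨(q, s), hs, subset_closure hqR⟩ hvc
  dsimp only at hs₁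
  have hΦ₁ := hF.flowPhi_pos q₁ (hIcc hs₁)
  -- Off the ball the product is zero, so the maximum over the compact set is one over all points
  -- and all times in `[0, t]`.
  have hle : ∀ q', ∀ s' ∈ Icc 0 t, ballCutoff x R p (F q' s') * flowPhi K F ν q' s' ≤
      ballCutoff x R p (F q₁ s₁) * flowPhi K F ν q₁ s₁ := by
    intro q' s' hs'
    by_cases h : F q' s' ∈ Metric.ball x R
    · exact hmax (show (q', s') ∈ _ from ⟨hs', subset_closure h⟩)
    · rw [ballCutoff_of_notMem h, zero_mul]
      exact mul_nonneg (ballCutoff_nonneg _) hΦ₁.le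
  have hΦle := hle q s hs
  rw [hηq, one_mul] at hΦle
  have hη₁ : 0 < ballCutoff x R p (F q₁ s₁) :=
    pos_of_mul_pos_left ((hF.flowPhi_pos q (hIcc hs)).trans_le hΦle) hΦ₁.le
  have hy₁ : F q₁ s₁ ∈ Metric.ball x R := by
    by_contra h
    rw [ballCutoff_of_notMem h] at hη₁
    exact lt_irrefl _ hη₁
  rw [ballCutoff_of_mem hy₁] at hη₁ hΦle hle
  rcases hs₁.1.eq_or_lt with h0 | h0
  · subst h0
    exact Or.inl ⟨q₁, hy₁, hΦle.trans (mul_le_of_le_one_left hΦ₁.le (cutoff_le_one _))⟩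
  · refine Or.inr ⟨F q₁ s₁, hy₁, ?_⟩
    have hs₁' : s₁ ∈ Ioo 0 T := ⟨h0, hs₁.2.trans_lt htT⟩
    obtain ⟨ψ, hψ, hψ0, hψ', hψ'', hψ2, htouch⟩ := exists_smooth_touching_cutoff hR hη₁
    rw [← hψ0] at hη₁ hΦle hle
    have hball : Metric.ball x R ∈ 𝓝 (F q₁ s₁) := Metric.isOpen_ball.mem_nhds hy₁
    have hFc : ContinuousAt (fun w : S × ℝ => F w.1 w.2) (q₁, s₁) :=
      hF.smooth.continuousOn.continuousAt (prod_mem_nhds univ_mem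
        (Filter.mem_of_superset (Ioo_mem_nhds hs₁'.1 hs₁'.2) Ioo_subset_Ico_self))
    have hpc : ContinuousAt (fun w : S × ℝ => p (F w.1 w.2)) (q₁, s₁) :=
      ContinuousAt.comp (f := fun w : S × ℝ => F w.1 w.2) (x := (q₁, s₁)) (g := p)
        (hp2.continuousOn.continuousAt hball) hFc
    refine hΦle.trans (hF.cutoff_mul_flowPhi_le hn hKsymm hKsmooth hs₁' (hH q₁ s₁ hs₁) hR
      (hRic _ hy₁) (hp2.contMDiffAt hball) ?_ (hphess _ hy₁) hψ
      -- The inverse of the maximal value: with it `c ψ(p) ≤ Φ⁻¹` nearby at earlier times, with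
      -- equality at the maximum point.
      (c := (ψ (p (F q₁ s₁)) * flowPhi K F ν q₁ s₁)⁻¹) (by positivity) hη₁
      (hψ0.le.trans (cutoff_le_one _)) hψ' hψ'' hψ2 ?_ ?_)
    · refine (hpgrad _ hy₁).trans ?_
      rw [Metric.mem_ball, dist_comm] at hy₁
      linarith
    · field_simp
    · have hpos : ∀ᶠ w : S × ℝ in 𝓝 (q₁, s₁), 0 < w.2 :=
        continuousAt_snd.eventually (lt_mem_nhds h0)
      filter_upwards [hFc.eventually hball, hpc.eventually htouch, hpos] with w h1 h2 h3 h4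
      have hw : w.2 ∈ Icc 0 t := ⟨h3.le, h4.trans hs₁.2⟩
      have hΦw := hF.flowPhi_pos w.1 (hIcc hw)
      have h5 := hle w.1 w.2 hw
      rw [ballCutoff_of_mem h1] at h5
      have h6 : ψ (p (F w.1 w.2)) * flowPhi K F ν w.1 w.2 ≤
          ψ (p (F q₁ s₁)) * flowPhi K F ν q₁ s₁ :=
        (mul_le_mul_of_nonneg_right h2.2 hΦw.le).trans h5
      have h7 : (ψ (p (F q₁ s₁)) * flowPhi K F ν q₁ s₁)⁻¹ * ψ (p (F w.1 w.2)) ≤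
          (flowPhi K F ν w.1 w.2)⁻¹ := by
        rw [inv_mul_le_iff₀ (by positivity), ← div_eq_mul_inv, le_div_iff₀ hΦw]
        exact h6
      rw [← inv_pow]
      have h8 : 0 ≤ (ψ (p (F q₁ s₁)) * flowPhi K F ν q₁ s₁)⁻¹ * ψ (p (F w.1 w.2)) :=
        mul_nonneg (by positivity) h2.1
      -- Squaring preserves the inequality because the touching function is nonnegative near the
      -- maximum point.
      gcongr

end IsSmoothSolution

end LocalEstimate

end STIMCF

end

/-! ### From the pointwise alternative to suprema. -/

theorem theorem3p3 (n : ℕ) (hn : 2 ≤ n) :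
    ∃ C : ℝ, 0 < C ∧
      ∀ (M : Type*) [MetricSpace M] [ChartedSpace (Eucl (n + 1)) M] [IsManifold (𝓡 (n + 1)) ∞ M]
        [RiemannianBundle (fun y : M => TangentSpace (𝓡 (n + 1)) y)]
        [IsContMDiffRiemannianBundle (𝓡 (n + 1)) ∞ (Eucl (n + 1))
          (fun y : M => TangentSpace (𝓡 (n + 1)) y)]
        [IsRiemannianManifold (𝓡 (n + 1)) M]
        -- the symmetric smooth `(0,2)`-tensor field `K`
        (K : ∀ y : M, TangentSpace (𝓡 (n + 1)) y →L[ℝ] TangentSpace (𝓡 (n + 1)) y →L[ℝ] ℝ)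
        (hKsymm : ∀ y v w, K y v w = K y w v)
        (hKsmooth : ContMDiff (𝓡 (n + 1))
          ((𝓡 (n + 1)).prod 𝓘(ℝ, Eucl (n + 1) →L[ℝ] Eucl (n + 1) →L[ℝ] ℝ)) ∞
          (fun y => TotalSpace.mk' (Eucl (n + 1) →L[ℝ] Eucl (n + 1) →L[ℝ] ℝ) y (K y)))
        -- the flow
        (S : Type*) [TopologicalSpace S] [T2Space S] [ChartedSpace (Eucl n) S]
        [IsManifold (𝓡 n) ∞ S]
        (T : ℝ) (F : S → ℝ → M) (ν : ∀ q s, TangentSpace (𝓡 (n + 1)) (F q s))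
        (hF : IsSmoothSolution K T F ν)
        (t : ℝ) (ht0 : 0 ≤ t) (htT : t < T)
        (hH : ∀ q, ∀ s ∈ Icc 0 t, 0 < meanCurv (n := n) (fun q' => F q' s) q (ν q s))
        -- the ball and the distance-like function
        (x : M) (R : ℝ) (hR : 0 < R) (hball : IsCompact (closure (Metric.ball x R)))
        (hRic : ∀ y ∈ Metric.ball x R, ∀ v : TangentSpace (𝓡 (n + 1)) y,
          -(1 / (100 * (n + 1) * R ^ 2)) * inner ℝ v v ≤ ricci y v v)
        (p : M → ℝ) (hp2 : ContMDiffOn (𝓡 (n + 1)) 𝓘(ℝ, ℝ) 2 p (Metric.ball x R))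
        (hpx : p x = 0)
        (hpd : ∀ y ∈ Metric.ball x R, dist x y ^ 2 ≤ p y ∧ p y ≤ 3 / 2 * dist x y ^ 2)
        (hpgrad : ∀ y ∈ Metric.ball x R, gradNorm (m := n + 1) p y ≤ 3 * dist x y)
        (hphess : ∀ y ∈ Metric.ball x R, ∀ v : TangentSpace (𝓡 (n + 1)) y,
          hessian p y v v ≤ 3 * inner ℝ v v)
        -- properness over the closed ball, automatic when `S` is compact
        (hproper : IsCompact {z : S × ℝ | z.2 ∈ Icc 0 t ∧ F z.1 z.2 ∈ closure (Metric.ball x R)}),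
        (⨆ (q : S) (s ∈ Icc 0 t) (_ : F q s ∈ Metric.ball x (R / 2)),
            ENNReal.ofReal (spacetimeMeanCurv (n := n) K (fun q' => F q' s) q (ν q s))) ≤
          max
            (⨆ (q : S) (_ : F q 0 ∈ Metric.ball x R),
              ENNReal.ofReal (spacetimeMeanCurv (n := n) K (fun q' => F q' 0) q (ν q 0)))
            (ENNReal.ofReal C *
              (ENNReal.ofReal (1 / R) +
                (⨆ y ∈ closure (Metric.ball x R), ENNReal.ofReal (tensorNorm K y)) +
                (⨆ y ∈ closure (Metric.ball x R), ENNReal.ofReal (covDerivNorm K y)) ^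
                  (1 / 2 : ℝ))) := by
  refine ⟨100 * n, by positivity, ?_⟩
  intro M _ _ _ _ _ _ K hKsymm hKsmooth S _ _ _ _ T F ν hF t ht0 htT hH x R hR hball hRic p hp2
    hpx hpd hpgrad hphess hproper
  refine iSup_le fun q => iSup₂_le fun s hs => iSup_le fun hq => ?_
  rcases hF.flowPhi_le_of_mem_half_ball (by omega) hKsymm hKsmooth htT hH hR hRic hp2 hpd hpgrad
    hphess hproper hs hq with ⟨q', hq', h⟩ | ⟨y, hy, h⟩
  · exact le_max_of_le_left (le_iSup₂_of_le q' hq' (ENNReal.ofReal_le_ofReal h))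
  -- The interior estimate involves `K` and `∇K` at a single point of the ball, so each norm is
  -- bounded by its supremum separately; extended reals make this meaningful without finiteness of
  -- the suprema.
  · refine le_max_of_le_right ((ENNReal.ofReal_le_ofReal h).trans ?_)
    have hK : 0 ≤ tensorNorm K y := Real.sqrt_nonneg _
    have hdK : 0 ≤ covDerivNorm K y := Real.sqrt_nonneg _
    rw [ENNReal.ofReal_mul (by positivity), ENNReal.ofReal_add (by positivity) (by positivity),
      ENNReal.ofReal_add (by positivity) hK, Real.sqrt_eq_rpow,
      ← ENNReal.ofReal_rpow_of_nonneg hdK (by norm_num)]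
    gcongr
    · exact le_iSup₂_of_le y (subset_closure hy) le_rfl
    · exact le_iSup₂_of_le y (subset_closure hy) le_rfl
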